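/- Let $\mathbb{K}$ be $\mathbb{R}$ or $\mathbb{C}$ and let $\mathfrak{g}$ be a finite-dimensional Lie algebra over $\mathbb{K}$ with basis $(\xi_i)$ and dual basis $(\xi_i^*)$. Write $a(z)=\sum_{n\in\mathbb{Z}}a_{(n)}z^{-n-1}$ for fields, and let $[\ ,\ ]$ be the supercommutator. **The algebras.** Let $\mathcal{W}(\mathfrak{g})$ be the semi-infinite Weil algebra, i.e. the vertex superalgebra (tensor product of a $bc$-system and a $\beta\gamma$-system) generated by odd fields $b^{\xi}(z),c^{\xi^*}(z)$ and even fields $\beta^{\xi}(z),\gamma^{\xi^*}(z)$ ($\xi\in\mathfrak{g}$, $\xi^*\in\mathfrak{g}^*$), linear in $\xi$ and $\xi^*$, whose only nontrivial supercommutators are $[b^{\xi}_{(m)},c^{\xi^*}_{(n)}]=\langle\xi^*,\xi\rangle\delta_{m+n,-1}=[\beta^{\xi}_{(m)},\gamma^{\xi^*}_{(n)}]$, acting on the module generated by a vacuum $\mathbf 1$ annihilated by all these modes with index $n\ge 0$. States are identified with their vertex operators. The fields $b,c,\beta,\gamma$ have degrees $-1,1,-2,2$ and weights $1,0,1,0$.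 Let $\langle c\rangle\subset\langle c,\gamma\rangle\subset\mathcal{W}(\mathfrak{g})$ be the vertex subalgebras generated by the $c^{\xi^*}$, and by the $c^{\xi^*}$ and $\gamma^{\xi^*}$, respectively. Let $d_{\mathcal W'}$ be the restriction to $\langle c,\gamma\rangle$ (which it preserves) of $D_{(0)}$, where $$D=-\sum_{i,j}\beta^{[\xi_i,\xi_j]}_{(-1)}\gamma^{\xi_j^*}_{(-1)}c^{\xi_i^*}-\tfrac12\sum_{i,j}c^{\xi_i^*}_{(-1)}c^{\xi_j^*}_{(-1)}b^{[\xi_i,\xi_j]}+\sum_i\gamma^{\xi_i^*}_{(-1)}b^{\xi_i}.$$ **The modules.** A differential $\mathfrak{sg}[t]$-module $(\mathcal{A},d_{\mathcal A})$ is a super vector space $\mathcal{A}=\bigoplus_{p,w\in\mathbb{Z}}\mathcal{A}^p[w]$ graded by degree $p$ and weight $w$ (compatibly with parity), with an odd operator $d_{\mathcal A}$ of degree $1$ and weight $0$, $d_{\mathcal A}^2=0$, and operators $L_{\xi,(n)}$ (even, degree $0$, weight $-n$) and $\iota_{\xi,(n)}$ (odd, degree $-1$, weight $-n$), linear in $\xi\in\mathfrak{g}$,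 for $n\ge 0$, such that $[L_{\xi,(m)},L_{\eta,(n)}]=L_{[\xi,\eta],(m+n)}$, $[L_{\xi,(m)},\iota_{\eta,(n)}]=\iota_{[\xi,\eta],(m+n)}$, $[\iota_{\xi,(m)},\iota_{\eta,(n)}]=0$, $[d_{\mathcal A},L_{\xi,(n)}]=0$, $[d_{\mathcal A},\iota_{\xi,(n)}]=L_{\xi,(n)}$, and for each $v\in\mathcal{A}$ one has $L_{\xi,(n)}v=\iota_{\xi,(n)}v=0$ for all $\xi$ and all sufficiently large $n$. Put $L_\xi(z)_-=\sum_{n\ge0}L_{\xi,(n)}z^{-n-1}$, $\iota_\xi(z)_-=\sum_{n\ge0}\iota_{\xi,(n)}z^{-n-1}$ and $\delta(z-w)_-=\sum_{n\ge0}z^{-n-1}w^n$. Module structures over $\langle c\rangle$ and $\langle c,\gamma\rangle$ on $\mathcal{A}$ are understood to be compatible with parity, degree and weight; given such a structure $Y$, write $c^{\xi^*,\mathcal A}(z)=Y(c^{\xi^*},z)$ and $\gamma^{\xi^*,\mathcal A}(z)=Y(\gamma^{\xi^*},z)$. A chiral $W^*$-module is a differential $\mathfrak{sg}[t]$-module $(\mathcal{A},d_{\mathcal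 A})$ with a $\langle c,\gamma\rangle$-module structure $Y$ such that, for all $x\in\langle c,\gamma\rangle$, $\xi\in\mathfrak{g}$, $\xi^*\in\mathfrak{g}^*$: (1) $[d_{\mathcal A},Y(x,z)]=Y(d_{\mathcal W'}x,z)$; (2) $[L_\xi(z)_-,c^{\xi^*,\mathcal A}(w)]=c^{\mathrm{ad}^*\xi\cdot\xi^*,\mathcal A}(w)\,\delta(z-w)_-$; (3) $[\iota_\xi(z)_-,c^{\xi^*,\mathcal A}(w)]=\langle\xi^*,\xi\rangle\,\delta(z-w)_-$. Here $\langle\mathrm{ad}^*\xi\cdot\xi^*,\eta\rangle=-\langle\xi^*,[\xi,\eta]\rangle$. **Proposition.** Let $(\mathcal{A},d_{\mathcal A})$ be a differential $\mathfrak{sg}[t]$-module with a $\langle c\rangle$-module structure $Y_0^{\mathcal A}$ such that $$[c^{\xi^*,\mathcal A}(z),[d_{\mathcal A},c^{\eta^*,\mathcal A}(w)]]=0\qquad\text{for all }\xi^*,\eta^*\in\mathfrak{g}^*.$$ Then there is a unique $\langle c,\gamma\rangle$-module structure $Y^{\mathcal A}$ on $\mathcal{A}$ such that $Y^{\mathcal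 A}|_{\langle c\rangle}=Y^{\mathcal A}_0$ and $[d_{\mathcal A},Y^{\mathcal A}(x,z)]=Y^{\mathcal A}(d_{\mathcal W'}x,z)$ for all $x\in\langle c,\gamma\rangle$. Moreover, if $$[\iota_\xi(z)_-,c^{\xi^*,\mathcal A}(w)]=\langle\xi^*,\xi\rangle\,\delta(z-w)_-\quad\text{and}\quad[\iota_\xi(z)_-,\gamma^{\xi^*,\mathcal A}(w)]=0$$ for all $\xi\in\mathfrak{g}$, $\xi^*\in\mathfrak{g}^*$, then $(\mathcal{A},d_{\mathcal A},Y^{\mathcal A})$ is a chiral $W^*$-module. -/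

import Mathlib

noncomputable section

namespace ChiralWeil

/-! ### Graded super vector spaces and fields -/

/-- The index group of a degree-weight-graded super vector space:
a triple (parity, degree, weight). -/
abbrev Grade : Type := ZMod 2 × ℤ × ℤ

/-- The Koszul sign `(-1) ^ (i * j)` of two parities. -/
def koszul (i j : ZMod 2) : ℤ := if i = 1 ∧ j = 1 then -1 else 1

/-- The supercommutator of two operators of parities `i` and `j`. -/
def sbracket {R : Type*} [Ring R] (i j : ZMod 2) (f g : R) : R :=
  f * g - koszul i j • (g * f)

section Fields

variable {𝕂 : Type*} [Field 𝕂] {A : Type*} [AddCommGroup A] [Module 𝕂 A]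

variable (𝕂 A) in
/-- The space of fields on `A`, that is, of the formal distributions
`a(z) = ∑ a_(n) z^(-n-1)` with coefficients in `End A` such that, for each vector `v`,
`a_(n) v = 0` for all large `n`. The field is given by its sequence of coefficients `n ↦ a_(n)`. -/
def fields : Submodule 𝕂 (ℤ → Module.End 𝕂 A) where
  carrier := {a | ∀ v : A, ∃ N : ℤ, ∀ n, N ≤ n → a n v = 0}
  zero_mem' := fun v => ⟨0, fun n _ => rfl⟩
  add_mem' := by
    intro a b ha hb v
    obtain ⟨N, hN⟩ := ha v
    obtain ⟨M, hM⟩ := hb v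
    refine ⟨max N M, fun n hn => ?_⟩
    simp [hN n (le_trans (le_max_left _ _) hn), hM n (le_trans (le_max_right _ _) hn)]
  smul_mem' := by
    intro r a ha v
    obtain ⟨N, hN⟩ := ha v
    exact ⟨N, fun n hn => by simp [hN n hn]⟩

variable (𝕂 A) in
/-- Fields on `A`. -/
abbrev Fld : Type _ := ↥(fields 𝕂 A)

/-- The coefficient `a_(n)` of the field `a(z) = ∑ a_(n) z^(-n-1)`. -/
def Fld.coeff (a : Fld 𝕂 A) (n : ℤ) : Module.End 𝕂 A := a.1 n

variable (𝕂 A) in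
/-- The identity field (the vacuum vector of a vertex superalgebra of fields). -/
def Fld.vac : Fld 𝕂 A :=
  ⟨fun n => if n = -1 then 1 else 0, fun v => ⟨0, fun n hn => by
    have h : n ≠ -1 := by omega
    simp [h]⟩⟩

/-- The `l`-th summand of the coefficient of index `k` of the `n`-th product,
applied to a vector `v`. -/
def nProdTerm (i j : ZMod 2) (n : ℤ) (a b : Fld 𝕂 A) (k : ℤ) (v : A) (l : ℕ) : A :=
  ((-1) ^ l * Ring.choose n l : ℤ) •
    (a.coeff (n - l) (b.coeff (k + l) v)
      - (koszul i j * (n.negOnePow : ℤ)) • b.coeff (n + k - l) (a.coeff l v))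

theorem nProdTerm_eventually (i j : ZMod 2) (n : ℤ) (a b : Fld 𝕂 A) (v : A) :
    ∃ N : ℕ, ∀ k : ℤ, ∀ l : ℕ, N ≤ l → (N : ℤ) ≤ k + l → nProdTerm i j n a b k v l = 0 := by
  obtain ⟨N, hN⟩ := a.2 v
  obtain ⟨M, hM⟩ := b.2 v
  refine ⟨max N.toNat M.toNat, fun k l hl hk => ?_⟩
  have h1 : b.coeff (k + l) v = 0 := hM _ (by omega)
  have h2 : a.coeff l v = 0 := hN _ (by omega)
  simp [nProdTerm, h1, h2]

theorem nProdTerm_finite (i j : ZMod 2) (n : ℤ) (a b : Fld 𝕂 A) (k : ℤ) (v : A) :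
    (Function.support (nProdTerm i j n a b k v)).Finite := by
  obtain ⟨N, hN⟩ := nProdTerm_eventually i j n a b v
  refine (Set.finite_lt_nat (N + (N - k).toNat)).subset fun l hl => ?_
  by_contra h
  simp only [Set.mem_ofPred_eq, not_lt] at h
  exact hl (hN k l (by omega) (by omega))

/-- The `n`-th product `a_(n) b` of two fields `a`, `b` of parities `i`, `j`:
`(a_(n) b)(z) = Res_x (a(x) b(z) ι_{x,z} (x-z)^n - (-1)^(ij) b(z) a(x) ι_{z,x} (x-z)^n)`,
where `ι_{x,z}` and `ι_{z,x}` are the expansions in the domains `|x| > |z|` and `|z| > |x|`.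
Every sum below has only finitely many nonzero terms. -/
def nProd (i j : ZMod 2) (n : ℤ) (a b : Fld 𝕂 A) : Fld 𝕂 A :=
  ⟨fun k =>
    { toFun := fun v => ∑ᶠ l : ℕ, nProdTerm i j n a b k v l
      map_add' := fun v w => by
        rw [← finsum_add_distrib (nProdTerm_finite i j n a b k v)
          (nProdTerm_finite i j n a b k w)]
        refine finsum_congr fun l => ?_
        simp only [nProdTerm, map_add]
        module
      map_smul' := fun r v => by
        rw [RingHom.id_apply, smul_finsum]
        refine finsum_congr fun l => ?_
        simp only [nProdTerm, map_smul]
        module },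
    fun v => by
      obtain ⟨N, hN⟩ := nProdTerm_eventually i j n a b v
      have hb : ∀ l : ℕ, ∃ M : ℤ, ∀ m, M ≤ m → b.coeff m (a.coeff l v) = 0 :=
        fun l => b.2 (a.coeff l v)
      choose M hM using hb
      obtain ⟨P, hP⟩ := b.2 v
      obtain ⟨Q, hQ⟩ := ((Finset.range N).image M).bddAbove
      refine ⟨max (max N P) (Q + N - n), fun k hk => ?_⟩
      refine finsum_eq_zero_of_forall_eq_zero fun l => ?_
      by_cases hl : N ≤ l
      · exact hN k l hl (by omega)
      · have h1 : b.coeff (k + l) v = 0 := hP _ (by omega)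
        have h2 : M l ≤ Q := hQ (by
          simp only [Finset.coe_image, Set.mem_image, Finset.mem_coe, Finset.mem_range]
          exact ⟨l, by omega, rfl⟩)
        have h3 : b.coeff (n + k - l) (a.coeff l v) = 0 := hM l _ (by omega)
        simp [nProdTerm, h1, h3]⟩

/-- The subspace of vectors of parity `i`. -/
def parityPart (gr : Grade → Submodule 𝕂 A) (i : ZMod 2) : Submodule 𝕂 A :=
  ⨆ (p : ℤ) (w : ℤ), gr (i, p, w)

/-- The field `a` has parity `i`. -/
def HasParity (gr : Grade → Submodule 𝕂 A) (a : Fld 𝕂 A) (i : ZMod 2) : Prop :=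
  ∀ (n : ℤ) (j : ZMod 2), ∀ v ∈ parityPart gr j, a.coeff n v ∈ parityPart gr (i + j)

/-- The field `a` has parity `i`, degree `p` and weight (conformal dimension) `w`. -/
def HasGrade (gr : Grade → Submodule 𝕂 A) (a : Fld 𝕂 A) (i : ZMod 2) (p w : ℤ) : Prop :=
  ∀ (n : ℤ) (j : ZMod 2) (q m : ℤ), ∀ v ∈ gr (j, q, m),
    a.coeff n v ∈ gr (i + j, p + q, w + m - n - 1)

/-- A space of fields which contains the identity field and is closed under all `n`-th products.
Such a space is also closed under `∂_z`, because `∂_z a = a_(-2) id`. -/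
structure IsFieldAlgebra (gr : Grade → Submodule 𝕂 A) (V : Submodule 𝕂 (Fld 𝕂 A)) : Prop where
  vac_mem : Fld.vac 𝕂 A ∈ V
  nProd_mem : ∀ (i j : ZMod 2) (n : ℤ) (a b : Fld 𝕂 A), a ∈ V → b ∈ V →
    HasParity gr a i → HasParity gr b j → nProd i j n a b ∈ V

/-- The space of fields generated by a set `S` of (mutually local, parity-homogeneous) fields.
With the vacuum `id`, the translation operator `∂_z` and the `n`-th products of fields it is the
vertex superalgebra generated by `S`. -/
def generatedBy (gr : Grade → Submodule 𝕂 A) (S : Set (Fld 𝕂 A)) : Submodule 𝕂 (Fld 𝕂 A) :=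
  sInf {V | IsFieldAlgebra gr V ∧ S ⊆ V}

theorem generatedBy_isFieldAlgebra (gr : Grade → Submodule 𝕂 A) (S : Set (Fld 𝕂 A)) :
    IsFieldAlgebra gr (generatedBy gr S) where
  vac_mem := by
    rw [generatedBy, Submodule.mem_sInf]
    exact fun V hV => hV.1.vac_mem
  nProd_mem := by
    intro i j n a b ha hb hi hj
    rw [generatedBy, Submodule.mem_sInf] at *
    exact fun V hV => hV.1.nProd_mem i j n a b (ha V hV) (hb V hV) hi hj

theorem subset_generatedBy (gr : Grade → Submodule 𝕂 A) (S : Set (Fld 𝕂 A)) :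
    S ⊆ generatedBy gr S := by
  intro a ha
  rw [SetLike.mem_coe, generatedBy, Submodule.mem_sInf]
  exact fun V hV => hV.2 ha

theorem generatedBy_mono (gr : Grade → Submodule 𝕂 A) {S T : Set (Fld 𝕂 A)} (h : S ⊆ T) :
    generatedBy gr S ≤ generatedBy gr T :=
  sInf_le ⟨generatedBy_isFieldAlgebra gr T, h.trans (subset_generatedBy gr T)⟩

variable {F : Type*} [AddCommGroup F] [Module 𝕂 F]

/-- `Y` makes the graded super vector space `(A, grA)` a module over the degree-weight-graded
vertex superalgebra `V` of fields on `(F, grF)`: the identity field acts as the identity, the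
action is compatible with parities, degrees and weights, and the Borcherds identity holds.
By the type of `Y`, each `Y(x, z)` is a field on `A`. -/
structure IsVertexModule (grF : Grade → Submodule 𝕂 F) {V : Submodule 𝕂 (Fld 𝕂 F)}
    (hV : IsFieldAlgebra grF V) (grA : Grade → Submodule 𝕂 A) (Y : V →ₗ[𝕂] Fld 𝕂 A) : Prop where
  map_vac : Y ⟨Fld.vac 𝕂 F, hV.vac_mem⟩ = Fld.vac 𝕂 A
  graded : ∀ (x : V) (i : ZMod 2) (p w : ℤ), HasGrade grF x.1 i p w → HasGrade grA (Y x) i p w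
  borcherds : ∀ (i j : ZMod 2) (a b : V) (hi : HasParity grF a.1 i) (hj : HasParity grF b.1 j)
    (m n k : ℤ) (v : A),
    ∑ᶠ l : ℕ, Ring.choose m l •
        (Y ⟨nProd i j (n + l) a.1 b.1,
          hV.nProd_mem i j (n + l) a.1 b.1 a.2 b.2 hi hj⟩).coeff (m + k - l) v
      = ∑ᶠ l : ℕ, ((-1) ^ l * Ring.choose n l : ℤ) •
        ((Y a).coeff (m + n - l) ((Y b).coeff (k + l) v)
          - (koszul i j * (n.negOnePow : ℤ)) •
            (Y b).coeff (n + k - l) ((Y a).coeff (m + l) v))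

end Fields

/-! ### The semi-infinite Weil algebra -/

section Weil

variable (𝕂 : Type*) [Field 𝕂] (V : Type*) [AddCommGroup V] [Module 𝕂 V]

/-- Labels of the modes. The label `(1, (v, φ), n)` stands for
`v ⊗ t^n + φ ⊗ t^n dt = b^v_(n) + c^φ_(n)` (odd) and
`(0, (v, φ), n)` for `v ⊗ t^n + φ ⊗ t^n dt = β^v_(n) + γ^φ_(n)` (even). -/
abbrev ModeLabel : Type _ := ZMod 2 × (V × Module.Dual 𝕂 V) × ℤ

variable {𝕂 V} in
/-- The bracket form: symmetric on the odd labels, alternating on the even ones, zero between an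
odd and an even label. -/
def labelForm (i j : ZMod 2) (x y : V × Module.Dual 𝕂 V) : 𝕂 :=
  if i = j then y.2 x.1 - koszul i i • x.2 y.1 else 0

/-- The relations of the enveloping algebra of the direct sum of the odd Lie superalgebra `𝔧(V)`
and the Heisenberg Lie algebra `𝔥(V)`, with both central elements put equal to `1`:
`[x_(m), y_(n)] = (x, y) Res t^(m+n) dt`. -/
inductive ModeRel : FreeAlgebra 𝕂 (ModeLabel 𝕂 V) → FreeAlgebra 𝕂 (ModeLabel 𝕂 V) → Prop
  | add (i : ZMod 2) (x y : V × Module.Dual 𝕂 V) (n : ℤ) :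
      ModeRel (FreeAlgebra.ι 𝕂 (i, x + y, n))
        (FreeAlgebra.ι 𝕂 (i, x, n) + FreeAlgebra.ι 𝕂 (i, y, n))
  | smul (i : ZMod 2) (r : 𝕂) (x : V × Module.Dual 𝕂 V) (n : ℤ) :
      ModeRel (FreeAlgebra.ι 𝕂 (i, r • x, n)) (r • FreeAlgebra.ι 𝕂 (i, x, n))
  | bracket (i j : ZMod 2) (x y : V × Module.Dual 𝕂 V) (m n : ℤ) :
      ModeRel (sbracket i j (FreeAlgebra.ι 𝕂 (i, x, m)) (FreeAlgebra.ι 𝕂 (j, y, n)))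
        (algebraMap 𝕂 _ (if m + n = -1 then labelForm i j x y else 0))

/-- The algebra of modes of the `bc`-system and the `βγ`-system. -/
abbrev ModeAlg : Type _ := RingQuot (ModeRel 𝕂 V)

variable {V} in
/-- The class of a mode in the algebra of modes. -/
def modeElt (i : ZMod 2) (x : V × Module.Dual 𝕂 V) (n : ℤ) : ModeAlg 𝕂 V :=
  RingQuot.mkAlgHom 𝕂 (ModeRel 𝕂 V) (FreeAlgebra.ι 𝕂 (i, x, n))

/-- The left ideal generated by the modes `x_(n)` with `n ≥ 0`. -/
def annihilators : Submodule (ModeAlg 𝕂 V) (ModeAlg 𝕂 V) :=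
  Submodule.span (ModeAlg 𝕂 V) {u | ∃ i x, ∃ n : ℤ, 0 ≤ n ∧ u = modeElt 𝕂 i x n}

/-- The space `𝓔(V) ⊗ 𝓢(V)` as an induced module: it is generated by a vacuum vector subject to
the condition that all modes `x_(n)` with `n ≥ 0` annihilate it. -/
abbrev Weil : Type _ := ModeAlg 𝕂 V ⧸ annihilators 𝕂 V

/-- The vacuum vector of `Weil`. -/
def Weil.vacuum : Weil 𝕂 V := Submodule.Quotient.mk 1

variable {V} in
/-- The operator `x_(n)` on `Weil`. -/
def modeOp (i : ZMod 2) (x : V × Module.Dual 𝕂 V) (n : ℤ) : Module.End 𝕂 (Weil 𝕂 V) :=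
  Algebra.lsmul 𝕂 𝕂 (Weil 𝕂 V) (modeElt 𝕂 i x n)

/-- `WeilMonomial u (i, p, w)`: the vector `u` is a product of modes `b^v_(n)`, `c^φ_(n)`,
`β^v_(n)`, `γ^φ_(n)` applied to the vacuum, with total parity `i`, degree `p`, weight `w`.
As fields, `b, c, β, γ` have degrees `-1, 1, -2, 2` and weights `1, 0, 1, 0`. -/
inductive WeilMonomial : Weil 𝕂 V → Grade → Prop
  | vacuum : WeilMonomial (Weil.vacuum 𝕂 V) (0, 0, 0)
  | b (v : V) (n : ℤ) (u : Weil 𝕂 V) (i : ZMod 2) (p w : ℤ) :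
      WeilMonomial u (i, p, w) → WeilMonomial (modeOp 𝕂 1 (v, 0) n u) (1 + i, -1 + p, -n + w)
  | c (φ : Module.Dual 𝕂 V) (n : ℤ) (u : Weil 𝕂 V) (i : ZMod 2) (p w : ℤ) :
      WeilMonomial u (i, p, w) → WeilMonomial (modeOp 𝕂 1 (0, φ) n u) (1 + i, 1 + p, -n - 1 + w)
  | beta (v : V) (n : ℤ) (u : Weil 𝕂 V) (i : ZMod 2) (p w : ℤ) :
      WeilMonomial u (i, p, w) → WeilMonomial (modeOp 𝕂 0 (v, 0) n u) (i, -2 + p, -n + w)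
  | gamma (φ : Module.Dual 𝕂 V) (n : ℤ) (u : Weil 𝕂 V) (i : ZMod 2) (p w : ℤ) :
      WeilMonomial u (i, p, w) → WeilMonomial (modeOp 𝕂 0 (0, φ) n u) (i, 2 + p, -n - 1 + w)

/-- The parity, degree and weight grading of `Weil`. -/
def weilGr (g : Grade) : Submodule 𝕂 (Weil 𝕂 V) :=
  Submodule.span 𝕂 {u | WeilMonomial 𝕂 V u g}

theorem modeElt_mul (i j : ZMod 2) (x y : V × Module.Dual 𝕂 V) (m n : ℤ) (h : m + n ≠ -1) :
    modeElt 𝕂 i x m * modeElt 𝕂 j y n = koszul i j • (modeElt 𝕂 j y n * modeElt 𝕂 i x m) := by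
  have := RingQuot.mkAlgHom_rel 𝕂 (ModeRel.bracket (𝕂 := 𝕂) i j x y m n)
  rw [if_neg h, map_zero, map_zero, sbracket, map_sub, map_zsmul, map_mul, map_mul] at this
  exact sub_eq_zero.mp this

theorem modeOp_mem_fields (i : ZMod 2) (x : V × Module.Dual 𝕂 V) :
    (fun n => modeOp 𝕂 i x n) ∈ fields 𝕂 (Weil 𝕂 V) := by
  have key : ∀ f : FreeAlgebra 𝕂 (ModeLabel 𝕂 V), ∀ u : Weil 𝕂 V,
      (∃ N : ℤ, ∀ n, N ≤ n → modeElt 𝕂 i x n • u = 0) →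
      ∃ N : ℤ, ∀ n, N ≤ n →
        modeElt 𝕂 i x n • (RingQuot.mkAlgHom 𝕂 (ModeRel 𝕂 V) f • u) = 0 := by
    intro f
    induction f using FreeAlgebra.induction with
    | grade0 r =>
      rintro u ⟨N, hN⟩
      refine ⟨N, fun n hn => ?_⟩
      rw [AlgHom.commutes, algebraMap_smul, smul_comm, hN n hn, smul_zero]
    | grade1 y =>
      rintro u ⟨N, hN⟩
      obtain ⟨j, y, m⟩ := y
      refine ⟨max N (-m), fun n hn => ?_⟩
      have h := modeElt_mul 𝕂 V i j x y n m (by omega)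
      change modeElt 𝕂 i x n • (modeElt 𝕂 j y m • u) = 0
      rw [← mul_smul, h, smul_assoc, mul_smul, hN n (by omega), smul_zero, smul_zero]
    | mul f g hf hg =>
      intro u hu
      have := hf _ (hg u hu)
      simpa only [map_mul, mul_smul] using this
    | add f g hf hg =>
      intro u hu
      obtain ⟨N, hN⟩ := hf u hu
      obtain ⟨M, hM⟩ := hg u hu
      refine ⟨max N M, fun n hn => ?_⟩
      rw [map_add, add_smul, smul_add, hN n (by omega), hM n (by omega), add_zero]
  intro v
  obtain ⟨u, rfl⟩ := Submodule.Quotient.mk_surjective _ v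
  obtain ⟨f, rfl⟩ := RingQuot.mkAlgHom_surjective 𝕂 (ModeRel 𝕂 V) u
  have := key f (Weil.vacuum 𝕂 V) ⟨0, fun n hn => by
    rw [Weil.vacuum, ← Submodule.Quotient.mk_smul, Submodule.Quotient.mk_eq_zero, smul_eq_mul,
      mul_one]
    exact Submodule.subset_span ⟨i, x, n, hn, rfl⟩⟩
  obtain ⟨N, hN⟩ := this
  refine ⟨N, fun n hn => ?_⟩
  have h := hN n hn
  rw [Weil.vacuum, ← Submodule.Quotient.mk_smul, smul_eq_mul, mul_one] at h
  exact h

variable {V} in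
/-- The field `x(z) = ∑ x_(n) z^(-n-1)` on `Weil`. -/
def modeField (i : ZMod 2) (x : V × Module.Dual 𝕂 V) : Fld 𝕂 (Weil 𝕂 V) :=
  ⟨fun n => modeOp 𝕂 i x n, modeOp_mem_fields 𝕂 V i x⟩

variable {V}

/-- The odd field `b^v(z)`. -/
def bField (v : V) : Fld 𝕂 (Weil 𝕂 V) := modeField 𝕂 1 (v, 0)

/-- The odd field `c^φ(z)`, the vertex operator of `c^φ_0 1`. -/
def cField (φ : Module.Dual 𝕂 V) : Fld 𝕂 (Weil 𝕂 V) := modeField 𝕂 1 (0, φ)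

/-- The even field `β^v(z)`. -/
def betaField (v : V) : Fld 𝕂 (Weil 𝕂 V) := modeField 𝕂 0 (v, 0)

/-- The even field `γ^φ(z)`, the vertex operator of `γ^φ_0 1`. -/
def gammaField (φ : Module.Dual 𝕂 V) : Fld 𝕂 (Weil 𝕂 V) := modeField 𝕂 0 (0, φ)

variable (V)

/-- The vertex superalgebra `⟨c⟩`; a state is identified with its vertex operator. -/
def cAlg : Submodule 𝕂 (Fld 𝕂 (Weil 𝕂 V)) :=
  generatedBy (weilGr 𝕂 V) (Set.range (cField 𝕂))

/-- The vertex superalgebra `⟨c, γ⟩`; a state is identified with its vertex operator. -/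
def cgAlg : Submodule 𝕂 (Fld 𝕂 (Weil 𝕂 V)) :=
  generatedBy (weilGr 𝕂 V) (Set.range (cField 𝕂) ∪ Set.range (gammaField 𝕂))

theorem cAlg_isFieldAlgebra : IsFieldAlgebra (weilGr 𝕂 V) (cAlg 𝕂 V) :=
  generatedBy_isFieldAlgebra _ _

theorem cgAlg_isFieldAlgebra : IsFieldAlgebra (weilGr 𝕂 V) (cgAlg 𝕂 V) :=
  generatedBy_isFieldAlgebra _ _

theorem cAlg_le_cgAlg : cAlg 𝕂 V ≤ cgAlg 𝕂 V :=
  generatedBy_mono _ Set.subset_union_left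

variable {V}

/-- `c^φ` as an element of `⟨c⟩`. -/
def cAlg.c (φ : Module.Dual 𝕂 V) : cAlg 𝕂 V :=
  ⟨cField 𝕂 φ, subset_generatedBy _ _ ⟨φ, rfl⟩⟩

/-- `c^φ` as an element of `⟨c, γ⟩`. -/
def cgAlg.c (φ : Module.Dual 𝕂 V) : cgAlg 𝕂 V :=
  ⟨cField 𝕂 φ, subset_generatedBy _ _ (Or.inl ⟨φ, rfl⟩)⟩

/-- `γ^φ` as an element of `⟨c, γ⟩`. -/
def cgAlg.gamma (φ : Module.Dual 𝕂 V) : cgAlg 𝕂 V :=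
  ⟨gammaField 𝕂 φ, subset_generatedBy _ _ (Or.inr ⟨φ, rfl⟩)⟩

end Weil

section Lie

variable {𝕂 : Type*} [Field 𝕂] {𝔤 : Type*} [LieRing 𝔤] [LieAlgebra 𝕂 𝔤]

/-- The coadjoint action: `⟨ad* ξ · φ, η⟩ = -⟨φ, [ξ, η]⟩`. -/
def coad (ξ : 𝔤) (φ : Module.Dual 𝕂 𝔤) : Module.Dual 𝕂 𝔤 :=
  -(φ ∘ₗ (LieAlgebra.ad 𝕂 𝔤 ξ : 𝔤 →ₗ[𝕂] 𝔤))

/-- The field `D(z)` with `D = J + K`, where, in terms of a basis `(ξ_i)` with dual basis `(ξ^*_i)`,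
`J = -∑ β^{[ξ_i, ξ_j]}_(-1) γ^{ξ^*_j}_(-1) c^{ξ^*_i} - 1/2 ∑ c^{ξ^*_i}_(-1) c^{ξ^*_j}_(-1) b^{[ξ_i, ξ_j]}`
and `K = ∑ γ^{ξ^*_i}_(-1) b^{ξ_i}`. -/
def weilD {ι : Type*} [Fintype ι] [DecidableEq ι] (e : Module.Basis ι 𝕂 𝔤) :
    Fld 𝕂 (Weil 𝕂 𝔤) :=
  - ∑ i, ∑ j, nProd 0 1 (-1) (betaField 𝕂 ⁅e i, e j⁆)
      (nProd 0 1 (-1) (gammaField 𝕂 (e.coord j)) (cField 𝕂 (e.coord i)))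
  - (1 / 2 : 𝕂) • ∑ i, ∑ j, nProd 1 0 (-1) (cField 𝕂 (e.coord i))
      (nProd 1 1 (-1) (cField 𝕂 (e.coord j)) (bField 𝕂 ⁅e i, e j⁆))
  + ∑ i, nProd 0 1 (-1) (gammaField 𝕂 (e.coord i)) (bField 𝕂 (e i))

/-- The differential `d x = D_(0) x` of the semi-infinite Weil complex on elements `x` of
parity `i`. -/
def weilDiff {ι : Type*} [Fintype ι] [DecidableEq ι] (e : Module.Basis ι 𝕂 𝔤) (i : ZMod 2)
    (x : Fld 𝕂 (Weil 𝕂 𝔤)) : Fld 𝕂 (Weil 𝕂 𝔤) :=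
  nProd 1 i 0 (weilD e) x

variable (𝕂 𝔤) in
/-- A differential `𝔰𝔤[t]`-module structure on a vector space `A`, where
`𝔰𝔤 = 𝔤 ⋉ 𝔤_{-1}`: a degree-weight-graded super vector space with a square-zero
differential of odd parity, degree `1` and weight `0`, and an action
`(ξ, η) t^n ↦ L_{ξ,(n)} + ι_{η,(n)}` of the Lie superalgebra `𝔰𝔤[t]`
which is compatible with the differentials, graded, and continuous for the discrete topology. -/
structure DiffSgtModule (A : Type*) [AddCommGroup A] [Module 𝕂 A] where
  /-- the subspaces of given parity, degree and weight -/
  gr : Grade → Submodule 𝕂 A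
  isInternal : DirectSum.IsInternal gr
  /-- the differential -/
  d : Module.End 𝕂 A
  d_sq : d * d = 0
  d_mem : ∀ (i : ZMod 2) (p w : ℤ), ∀ v ∈ gr (i, p, w), d v ∈ gr (i + 1, p + 1, w)
  /-- the operators `L_{ξ,(n)}` -/
  L : ℕ → 𝔤 →ₗ[𝕂] Module.End 𝕂 A
  /-- the operators `ι_{ξ,(n)}` -/
  iota : ℕ → 𝔤 →ₗ[𝕂] Module.End 𝕂 A
  L_mem : ∀ (n : ℕ) (ξ : 𝔤) (i : ZMod 2) (p w : ℤ), ∀ v ∈ gr (i, p, w),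
    L n ξ v ∈ gr (i, p, w - n)
  iota_mem : ∀ (n : ℕ) (ξ : 𝔤) (i : ZMod 2) (p w : ℤ), ∀ v ∈ gr (i, p, w),
    iota n ξ v ∈ gr (i + 1, p - 1, w - n)
  L_L : ∀ (m n : ℕ) (ξ η : 𝔤), sbracket 0 0 (L m ξ) (L n η) = L (m + n) ⁅ξ, η⁆
  L_iota : ∀ (m n : ℕ) (ξ η : 𝔤), sbracket 0 1 (L m ξ) (iota n η) = iota (m + n) ⁅ξ, η⁆
  iota_iota : ∀ (m n : ℕ) (ξ η : 𝔤), sbracket 1 1 (iota m ξ) (iota n η) = 0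
  d_L : ∀ (n : ℕ) (ξ : 𝔤), sbracket 1 0 d (L n ξ) = 0
  d_iota : ∀ (n : ℕ) (ξ : 𝔤), sbracket 1 1 d (iota n ξ) = L n ξ
  continuous : ∀ v : A, ∃ k : ℕ, ∀ n, k ≤ n → ∀ ξ : 𝔤, L n ξ v = 0 ∧ iota n ξ v = 0

variable {A : Type*} [AddCommGroup A] [Module 𝕂 A]

/-- Compatibility of a `⟨c, γ⟩`-action with the differentials: `d` preserves `⟨c, γ⟩` and
`[d_A, Y(x, z)] = Y(d x, z)` for all `x` (of some parity `i`) in `⟨c, γ⟩`. -/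
def DiffCompatible {ι : Type*} [Fintype ι] [DecidableEq ι] (e : Module.Basis ι 𝕂 𝔤)
    (M : DiffSgtModule 𝕂 𝔤 A) (Y : cgAlg 𝕂 𝔤 →ₗ[𝕂] Fld 𝕂 A) : Prop :=
  ∀ (i : ZMod 2) (x : cgAlg 𝕂 𝔤), HasParity (weilGr 𝕂 𝔤) x.1 i →
    ∃ y : cgAlg 𝕂 𝔤, y.1 = weilDiff e i x.1 ∧
      ∀ n : ℤ, sbracket 1 i M.d ((Y x).coeff n) = (Y y).coeff n

/-- The relation `[ι_ξ(z)_-, c^φ(w)] = ⟨φ, ξ⟩ δ(z - w)_-`, coefficientwise. -/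
def IotaCRelation (M : DiffSgtModule 𝕂 𝔤 A) (Y : cgAlg 𝕂 𝔤 →ₗ[𝕂] Fld 𝕂 A) : Prop :=
  ∀ (ξ : 𝔤) (φ : Module.Dual 𝕂 𝔤) (m : ℕ) (n : ℤ),
    sbracket 1 1 (M.iota m ξ) ((Y (cgAlg.c 𝕂 φ)).coeff n) =
      if (m : ℤ) + n = -1 then φ ξ • (1 : Module.End 𝕂 A) else 0

/-- The relation `[ι_ξ(z)_-, γ^φ(w)] = 0`, coefficientwise. -/
def IotaGammaRelation (M : DiffSgtModule 𝕂 𝔤 A) (Y : cgAlg 𝕂 𝔤 →ₗ[𝕂] Fld 𝕂 A) : Prop :=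
  ∀ (ξ : 𝔤) (φ : Module.Dual 𝕂 𝔤) (m : ℕ) (n : ℤ),
    sbracket 1 0 (M.iota m ξ) ((Y (cgAlg.gamma 𝕂 φ)).coeff n) = 0

/-- The relation `[L_ξ(z)_-, c^φ(w)] = c^{ad* ξ · φ}(w) δ(z - w)_-`, coefficientwise. -/
def LCRelation (M : DiffSgtModule 𝕂 𝔤 A) (Y : cgAlg 𝕂 𝔤 →ₗ[𝕂] Fld 𝕂 A) : Prop :=
  ∀ (ξ : 𝔤) (φ : Module.Dual 𝕂 𝔤) (m : ℕ) (n : ℤ),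
    sbracket 0 1 (M.L m ξ) ((Y (cgAlg.c 𝕂 φ)).coeff n) =
      (Y (cgAlg.c 𝕂 (coad ξ φ))).coeff (m + n)

/-- The triple `(A, d_A, Y)` is a chiral `W^*`-module with respect to `𝔤`. -/
structure IsChiralWStarModule {ι : Type*} [Fintype ι] [DecidableEq ι] (e : Module.Basis ι 𝕂 𝔤)
    (M : DiffSgtModule 𝕂 𝔤 A) (Y : cgAlg 𝕂 𝔤 →ₗ[𝕂] Fld 𝕂 A) : Prop where
  isVertexModule : IsVertexModule (weilGr 𝕂 𝔤) (cgAlg_isFieldAlgebra 𝕂 𝔤) M.gr Y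
  diff : DiffCompatible e M Y
  L_c : LCRelation M Y
  iota_c : IotaCRelation M Y

end Lie

end ChiralWeil

end

/-!
The action of `⟨c⟩` and the differential of `A` leave no choice for the action of `⟨c, γ⟩`: in the
semi-infinite Weil algebra `d c^φ = γ^φ - 1/2 ∑ φ([ξ_i, ξ_j]) c^{ξ_i^*} c^{ξ_j^*}`
(`adField_weilD_cField`), so that `γ^φ` has to act by the field
`[d, c^φ] + 1/2 ∑ φ([ξ_i, ξ_j]) c^{ξ_i^*} c^{ξ_j^*}`. This gives uniqueness, since two module
structures which agree on generators are equal (`IsVertexModule.ext_of_generators`).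

For existence, take these fields (`liftGens`) as the images of the generators. The hypothesis
`[c, [d, c]] = 0` and `d ^ 2 = 0` show that all their modes supercommute
(`sCommFamily_liftGens`). Fields with supercommuting modes satisfy the Borcherds identity
(`SComm.borcherds`), and on the subspace of the vectors on which they have poles of order at most
`N` they are Laurent series with supercommuting coefficients, whose products and divided
derivatives are the `n`-th products with `n < 0` (`IsRestr.nProd`). Every element of `⟨c, γ⟩` is a
linear combination of normally ordered monomials in derivatives of the generators, and it acts by
the same combination of monomials in the images of the generators. The action is defined by the
relation `actionGraph` between these two evaluations, which is closed under all `n`-th products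
(`wordPairs_nProd`).

Two points need the Weil algebra to be known well enough. First, the relation has to be
single-valued (`actionGraph_eq_zero`). The vectors which monomials create from the vacuum are
products of creation modes, and an explicit Fock space, the tensor product of an exterior algebra
and a polynomial algebra, shows that supercommuting elements can be substituted for the creation
modes (`exists_creationWord_eval`). A polynomial which vanishes in `⟨c, γ⟩` thus vanishes after the
substitution of supercommuting Laurent series. Secondly, a field in `⟨c, γ⟩` of a given grade has
to be a combination of monomials of this grade. This holds because the Weil algebra is the direct
sum of its graded pieces (`iSupIndep_weilGr`), which are eigenspaces of a rescaling of the modes.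

The brackets with the two differentials are superderivations of all `n`-th products
(`adField_nProd`), so their compatibility has to be checked on generators only. On `c` it holds by
the choice of the image of `γ`, and on `γ` the identity
`d γ^φ = - ∑ φ([ξ_i, ξ_j]) γ^{ξ_j^*} c^{ξ_i^*}` follows on both sides, on the module from the Jacobi
identity (`quadratic_differential`).

Finally, `L = [d, ι]`, and `[ι, c^φ]` is a scalar, so `[L, c^φ] = [ι, [d, c^φ]]` is computed from the
formula for `d c^φ` and the brackets of `ι` with `c` and `γ` (`lCRelation`).
-/

noncomputable section

namespace ChiralWeil

open LaurentSeries (hasseDeriv)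
open scoped TensorProduct

/-! ### Koszul signs and finite sums -/

theorem koszul_symm (i j : ZMod 2) : koszul i j = koszul j i := by
  revert i j; decide

theorem koszul_mul_self (i j : ZMod 2) : koszul i j * koszul i j = 1 := by
  revert i j; decide

theorem koszul_add_left (i j k : ZMod 2) : koszul (i + j) k = koszul i k * koszul j k := by
  revert i j k; decide

theorem koszul_add_right (i j k : ZMod 2) : koszul i (j + k) = koszul i j * koszul i k := by
  revert i j k; decide

theorem koszul_eq_or (i j : ZMod 2) : koszul i j = 1 ∨ koszul i j = -1 := by
  revert i j; decide

@[simp] theorem koszul_zero_left (j : ZMod 2) : koszul 0 j = 1 := by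
  revert j; decide

@[simp] theorem koszul_zero_right (j : ZMod 2) : koszul j 0 = 1 := by
  revert j; decide

@[simp] theorem koszul_one_one : koszul 1 1 = -1 := by decide

theorem finsum_eq_sum_range {M : Type*} [AddCommMonoid M] {f : ℕ → M} {N : ℕ}
    (h : ∀ l, N ≤ l → f l = 0) : ∑ᶠ l, f l = ∑ l ∈ Finset.range N, f l := by
  refine finsum_eq_sum_of_support_subset _ fun l hl => ?_
  rw [Finset.mem_coe, Finset.mem_range]
  by_contra hN
  exact hl (h l (by omega))

/-! ### Two-sided expansions of a difference power -/

section Residue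

variable {M : Type*} [AddCommGroup M]

/-- The coefficient extracted from the double sequence `f` by `x ^ m y ^ k` times the expansion of
`(x - y) ^ n` in the domain `|x| > |y|`. -/
def halfResidue (f : ℤ → ℤ → M) (m n k : ℤ) : M :=
  ∑ᶠ l : ℕ, ((-1) ^ l * Ring.choose n l : ℤ) • f (m + n - l) (k + l)

/-- The coefficient extracted from the double sequence `f` by `x ^ m y ^ k` times the difference
of the two expansions of `(x - y) ^ n`. -/
def residue (f : ℤ → ℤ → M) (m n k : ℤ) : M :=
  halfResidue f m n k - (n.negOnePow : ℤ) • halfResidue (fun p q => f q p) k n m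

theorem halfResidue_eq_sum {f : ℤ → ℤ → M} {N : ℤ} (hf : ∀ p q, N ≤ q → f p q = 0)
    (m n k : ℤ) {L : ℕ} (hL : N ≤ k + L) : halfResidue f m n k =
      ∑ l ∈ Finset.range L, ((-1) ^ l * Ring.choose n l : ℤ) • f (m + n - l) (k + l) := by
  refine finsum_eq_sum_range fun l hl => ?_
  rw [hf _ _ (by omega), smul_zero]

/-- Multiplying the factor `(x - y) ^ n` by `x = y + (x - y)`. -/
theorem halfResidue_recursion {f : ℤ → ℤ → M} {N : ℤ} (hf : ∀ p q, N ≤ q → f p q = 0)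
    (m n k : ℤ) : halfResidue f (m + 1) n k = halfResidue f m n (k + 1) +
      halfResidue f m (n + 1) k := by
  obtain ⟨L, hL⟩ : ∃ L : ℕ, N ≤ k + L := ⟨(N - k).toNat, by omega⟩
  rw [halfResidue_eq_sum hf (m + 1) n k (L := L + 1) (by omega),
    halfResidue_eq_sum hf m n (k + 1) (L := L) (by omega),
    halfResidue_eq_sum hf m (n + 1) k (L := L + 1) (by omega),
    Finset.sum_range_succ', Finset.sum_range_succ']
  have h0 : m + 1 + n = m + (n + 1) := by ring
  rw [h0, ← add_assoc (∑ l ∈ Finset.range L, _), ← Finset.sum_add_distrib]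
  congr 1
  · refine Finset.sum_congr rfl fun l _ => ?_
    have h2 : m + (n + 1) - ((l + 1 : ℕ) : ℤ) = m + n - l := by push_cast; ring
    have h3 : k + ((l + 1 : ℕ) : ℤ) = k + 1 + l := by push_cast; ring
    rw [h2, h3, ← add_smul, Ring.choose_succ_succ]
    congr 1
    ring
  · simp

theorem residue_recursion {f : ℤ → ℤ → M} {N : ℤ} (hf : ∀ p q, N ≤ q → f p q = 0)
    (hf' : ∀ p q, N ≤ p → f p q = 0) (m n k : ℤ) :
    residue f (m + 1) n k = residue f m n (k + 1) + residue f m (n + 1) k := by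
  have h1 := halfResidue_recursion hf m n k
  have h2 := halfResidue_recursion (f := fun p q => f q p) (fun p q h => hf' q p h) k n m
  simp only [residue, h1, h2, Int.negOnePow_succ, Units.val_neg, smul_add, neg_smul]
  abel

/-- The two expansions of a nonnegative power of `x - y` agree. -/
theorem residue_of_nonneg (f : ℤ → ℤ → M) (m n k : ℤ) (hn : 0 ≤ n) :
    residue f m n k = 0 := by
  lift n to ℕ using hn
  have key : ∀ g : ℤ → ℤ → M, ∀ m k : ℤ, halfResidue g m n k =
      ∑ l ∈ Finset.range (n + 1), ((-1) ^ l * (n.choose l : ℤ)) • g (m + n - l) (k + l) := by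
    intro g m k
    rw [halfResidue, finsum_eq_sum_range (N := n + 1)]
    · simp only [Ring.choose_natCast]
    · intro l hl
      rw [Ring.choose_natCast, Nat.choose_eq_zero_of_lt (by omega)]
      simp
  rw [residue, key, key, ← Finset.sum_range_reflect, Finset.smul_sum, sub_eq_zero]
  refine Finset.sum_congr rfl fun l hl => ?_
  have hl' : l ≤ n := by rw [Finset.mem_range] at hl; omega
  have e : n + 1 - 1 - l = n - l := by omega
  rw [e, Nat.choose_symm hl', smul_smul, Int.negOnePow_def]
  have h1 : m + (n : ℤ) - ((n - l : ℕ) : ℤ) = m + l := by push_cast [hl']; ring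
  have h2 : k + ((n - l : ℕ) : ℤ) = k + n - l := by push_cast [hl']; ring
  rw [h1, h2, ← mul_assoc]
  congr 2
  obtain ⟨r, rfl⟩ := Nat.exists_eq_add_of_le hl'
  rw [Nat.add_sub_cancel_left, zpow_natCast, pow_add]
  push_cast
  rw [mul_comm ((-1) ^ l : ℤ), mul_assoc, ← mul_pow]
  simp

end Residue

section Fields

variable {𝕂 : Type*} [Field 𝕂] {A : Type*} [AddCommGroup A] [Module 𝕂 A]

theorem Fld.ext {a b : Fld 𝕂 A} (h : ∀ n v, a.coeff n v = b.coeff n v) : a = b :=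
  Subtype.ext (funext fun n => LinearMap.ext (h n))

@[simp] theorem Fld.coeff_add (a b : Fld 𝕂 A) (n : ℤ) :
    (a + b).coeff n = a.coeff n + b.coeff n := rfl

@[simp] theorem Fld.coeff_smul (r : 𝕂) (a : Fld 𝕂 A) (n : ℤ) :
    (r • a).coeff n = r • a.coeff n := rfl

@[simp] theorem Fld.coeff_zero (n : ℤ) : (0 : Fld 𝕂 A).coeff n = 0 := rfl

@[simp] theorem Fld.coeff_neg (a : Fld 𝕂 A) (n : ℤ) : (-a).coeff n = -a.coeff n := rfl

@[simp] theorem Fld.coeff_sub (a b : Fld 𝕂 A) (n : ℤ) :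
    (a - b).coeff n = a.coeff n - b.coeff n := rfl

@[simp] theorem Fld.coeff_sum {κ : Type*} (s : Finset κ) (a : κ → Fld 𝕂 A) (n : ℤ) :
    (∑ x ∈ s, a x).coeff n = ∑ x ∈ s, (a x).coeff n := by
  classical
  induction s using Finset.induction_on with
  | empty => rfl
  | insert x s hx ih => rw [Finset.sum_insert hx, Finset.sum_insert hx, Fld.coeff_add, ih]

theorem Fld.coeff_vac (n : ℤ) : (Fld.vac 𝕂 A).coeff n = if n = -1 then 1 else 0 := rfl

theorem nProd_coeff (i j : ZMod 2) (n : ℤ) (a b : Fld 𝕂 A) (k : ℤ) (v : A) :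
    (nProd i j n a b).coeff k v = ∑ᶠ l : ℕ, nProdTerm i j n a b k v l := rfl

variable (𝕂 A) in
/-- The `n`-th product as a bilinear map. -/
def nProdHom (i j : ZMod 2) (n : ℤ) : Fld 𝕂 A →ₗ[𝕂] Fld 𝕂 A →ₗ[𝕂] Fld 𝕂 A :=
  LinearMap.mk₂ 𝕂 (nProd i j n)
    (fun a a' b => Fld.ext fun k v => by
      rw [Fld.coeff_add, LinearMap.add_apply]
      simp only [nProd_coeff]
      rw [← finsum_add_distrib (nProdTerm_finite i j n a b k v)
        (nProdTerm_finite i j n a' b k v)]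
      refine finsum_congr fun l => ?_
      simp only [nProdTerm, Fld.coeff_add, LinearMap.add_apply, map_add]
      module)
    (fun r a b => Fld.ext fun k v => by
      rw [Fld.coeff_smul, LinearMap.smul_apply]
      simp only [nProd_coeff]
      rw [smul_finsum]
      refine finsum_congr fun l => ?_
      simp only [nProdTerm, Fld.coeff_smul, LinearMap.smul_apply, map_smul]
      module)
    (fun a b b' => Fld.ext fun k v => by
      rw [Fld.coeff_add, LinearMap.add_apply]
      simp only [nProd_coeff]
      rw [← finsum_add_distrib (nProdTerm_finite i j n a b k v)
        (nProdTerm_finite i j n a b' k v)]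
      refine finsum_congr fun l => ?_
      simp only [nProdTerm, Fld.coeff_add, LinearMap.add_apply, map_add]
      module)
    (fun r a b => Fld.ext fun k v => by
      rw [Fld.coeff_smul, LinearMap.smul_apply]
      simp only [nProd_coeff]
      rw [smul_finsum]
      refine finsum_congr fun l => ?_
      simp only [nProdTerm, Fld.coeff_smul, LinearMap.smul_apply, map_smul]
      module)

@[simp] theorem nProdHom_apply (i j : ZMod 2) (n : ℤ) (a b : Fld 𝕂 A) :
    nProdHom 𝕂 A i j n a b = nProd i j n a b := rfl

theorem nProd_zero_left (i j : ZMod 2) (n : ℤ) (b : Fld 𝕂 A) : nProd i j n 0 b = 0 := by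
  rw [← nProdHom_apply, map_zero, LinearMap.zero_apply]

theorem nProd_zero_right (i j : ZMod 2) (n : ℤ) (a : Fld 𝕂 A) : nProd i j n a 0 = 0 := by
  rw [← nProdHom_apply, map_zero]

/-! ### Supercommuting fields -/

/-- The modes of `a` and `b` supercommute, `a` and `b` being given the parities `i` and `j`. -/
def SComm (i j : ZMod 2) (a b : Fld 𝕂 A) : Prop :=
  ∀ m n, a.coeff m * b.coeff n = koszul i j • (b.coeff n * a.coeff m)

theorem sComm_iff_sbracket {i j : ZMod 2} {a b : Fld 𝕂 A} :
    SComm i j a b ↔ ∀ m n, sbracket i j (a.coeff m) (b.coeff n) = 0 := by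
  simp only [SComm, sbracket, sub_eq_zero]

namespace SComm

variable {i j k : ZMod 2} {a b c : Fld 𝕂 A}

theorem apply (h : SComm i j a b) (m n : ℤ) (v : A) :
    a.coeff m (b.coeff n v) = koszul i j • b.coeff n (a.coeff m v) :=
  LinearMap.congr_fun (h m n) v

theorem symm (h : SComm i j a b) : SComm j i b a := fun m n => by
  rw [h n m, smul_smul, koszul_symm j i, koszul_mul_self, one_smul]

theorem zero_right : SComm i j a 0 := fun m n => by simp

theorem add_right (h : SComm i j a b) (h' : SComm i j a c) : SComm i j a (b + c) := fun m n => by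
  rw [Fld.coeff_add, mul_add, h m n, h' m n, add_mul, smul_add]

theorem smul_right (r : 𝕂) (h : SComm i j a b) : SComm i j a (r • b) := fun m n => by
  rw [Fld.coeff_smul, mul_smul_comm, h m n, smul_mul_assoc, smul_comm]

theorem vac_right : SComm i 0 a (Fld.vac 𝕂 A) := fun m n => by
  rw [Fld.coeff_vac]
  split <;> simp

/-- The `n`-th products of two fields which supercommute with `c` supercommute with `c`. -/
theorem nProd_right (hb : SComm k i c a) (hc : SComm k j c b) (n : ℤ) :
    SComm k (i + j) c (nProd i j n a b) := fun m p => by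
  refine LinearMap.ext fun v => ?_
  rw [LinearMap.smul_apply, Module.End.mul_apply, Module.End.mul_apply, nProd_coeff, nProd_coeff,
    map_finsum _ (nProdTerm_finite i j n a b p v), smul_finsum' _
      (nProdTerm_finite i j n a b p (c.coeff m v))]
  refine finsum_congr fun l => ?_
  simp only [nProdTerm, map_zsmul, map_sub, hb.apply, hc.apply, koszul_add_right]
  module

theorem nProd_left (hb : SComm i k a c) (hc : SComm j k b c) (n : ℤ) :
    SComm (i + j) k (nProd i j n a b) c :=
  (nProd_right hb.symm hc.symm n).symm

/-- On each vector, the products `a_p b_q` of modes vanish if `p` or `q` is large. -/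
theorem exists_bound (h : SComm i j a b) (v : A) : ∃ N : ℤ,
    (∀ p q, N ≤ q → a.coeff p (b.coeff q v) = 0) ∧
      ∀ p q, N ≤ p → a.coeff p (b.coeff q v) = 0 := by
  obtain ⟨N, hN⟩ := a.2 v
  obtain ⟨M, hM⟩ := b.2 v
  refine ⟨max N M, fun p q hq => ?_, fun p q hp => ?_⟩
  · have : b.coeff q v = 0 := hM q (by omega)
    rw [this, map_zero]
  · have : a.coeff p v = 0 := hN p (by omega)
    rw [h.apply, this, map_zero, smul_zero]

/-- The commutator side of the Borcherds identity, for supercommuting fields. -/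
theorem finsum_eq_residue (h : SComm i j a b) (m n k : ℤ) (v : A) :
    ∑ᶠ l : ℕ, ((-1) ^ l * Ring.choose n l : ℤ) •
        (a.coeff (m + n - l) (b.coeff (k + l) v)
          - (koszul i j * (n.negOnePow : ℤ)) • b.coeff (n + k - l) (a.coeff (m + l) v))
      = residue (fun p q => a.coeff p (b.coeff q v)) m n k := by
  obtain ⟨N, h1, h2⟩ := h.exists_bound v
  obtain ⟨L, hL⟩ : ∃ L : ℕ, N ≤ k + L ∧ N ≤ m + L :=
    ⟨(N - k).toNat + (N - m).toNat, by omega, by omega⟩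
  have e : ∀ l : ℕ, ((-1) ^ l * Ring.choose n l : ℤ) •
        (a.coeff (m + n - l) (b.coeff (k + l) v)
          - (koszul i j * (n.negOnePow : ℤ)) • b.coeff (n + k - l) (a.coeff (m + l) v))
      = ((-1) ^ l * Ring.choose n l : ℤ) • a.coeff (m + n - l) (b.coeff (k + l) v) -
        (n.negOnePow : ℤ) • ((-1) ^ l * Ring.choose n l : ℤ) •
          a.coeff (m + l) (b.coeff (k + n - l) v) := by
    intro l
    rw [h.apply (m + l), add_comm n k]
    module
  rw [finsum_congr e, residue, halfResidue_eq_sum h1 m n k hL.1,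
    halfResidue_eq_sum (f := fun p q => a.coeff q (b.coeff p v)) (fun p q hq => h2 q p hq) k n m
      hL.2, finsum_eq_sum_range (N := L), Finset.smul_sum, ← Finset.sum_sub_distrib]
  intro l hl
  rw [h1 _ _ (by omega), h2 (m + l) _ (by omega)]
  simp

theorem nProd_coeff_eq_residue (h : SComm i j a b) (n k : ℤ) (v : A) :
    (nProd i j n a b).coeff k v = residue (fun p q => a.coeff p (b.coeff q v)) 0 n k := by
  rw [← h.finsum_eq_residue, nProd_coeff]
  refine finsum_congr fun l => ?_
  simp only [nProdTerm, zero_add]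

theorem nProd_of_nonneg (h : SComm i j a b) {n : ℤ} (hn : 0 ≤ n) : nProd i j n a b = 0 := by
  refine Fld.ext fun k v => ?_
  rw [h.nProd_coeff_eq_residue, residue_of_nonneg _ _ _ _ hn]
  rfl

/-- The Borcherds identity for two supercommuting fields. Both sides satisfy the same recursion
`F (m + 1) n k = F m n (k + 1) + F m (n + 1) k`, which reduces the identity to the cases `m = 0`,
where it defines the `n`-th products, and `n ≥ 0`, where both sides vanish. -/
theorem borcherds (h : SComm i j a b) (m n k : ℤ) (v : A) :
    ∑ᶠ l : ℕ, Ring.choose m l • (nProd i j (n + l) a b).coeff (m + k - l) v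
      = ∑ᶠ l : ℕ, ((-1) ^ l * Ring.choose n l : ℤ) •
        (a.coeff (m + n - l) (b.coeff (k + l) v)
          - (koszul i j * (n.negOnePow : ℤ)) • b.coeff (n + k - l) (a.coeff (m + l) v)) := by
  rw [h.finsum_eq_residue]
  obtain ⟨N, h1, h2⟩ := h.exists_bound v
  set R := residue (fun p q => a.coeff p (b.coeff q v)) with hR
  set S : ℤ → ℤ → ℤ → A := fun m n k =>
    ∑ᶠ l : ℕ, Ring.choose m l • (nProd i j (n + l) a b).coeff (m + k - l) v with hS
  have hS0 : ∀ m n k : ℤ, ∀ L : ℕ, 0 ≤ n + L → S m n k =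
      ∑ l ∈ Finset.range L, Ring.choose m l • (nProd i j (n + l) a b).coeff (m + k - l) v := by
    intro m n k L hL
    refine finsum_eq_sum_range fun l hl => ?_
    rw [h.nProd_of_nonneg (by omega), Fld.coeff_zero, LinearMap.zero_apply, smul_zero]
  have hSrec : ∀ m n k, S (m + 1) n k = S m n (k + 1) + S m (n + 1) k := by
    intro m n k
    obtain ⟨L, hL⟩ : ∃ L : ℕ, 0 ≤ n + L := ⟨(-n).toNat, by omega⟩
    rw [hS0 (m + 1) n k (L + 1) (by omega), hS0 m n (k + 1) (L + 1) (by omega),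
      hS0 m (n + 1) k L (by omega), Finset.sum_range_succ', Finset.sum_range_succ',
      add_right_comm (Finset.sum _ _), ← Finset.sum_add_distrib]
    congr 1
    · refine Finset.sum_congr rfl fun l _ => ?_
      have e1 : m + 1 + k - ((l + 1 : ℕ) : ℤ) = m + k - l := by push_cast; ring
      have e2 : m + (k + 1) - ((l + 1 : ℕ) : ℤ) = m + k - l := by push_cast; ring
      have e3 : n + ((l + 1 : ℕ) : ℤ) = n + 1 + l := by push_cast; ring
      rw [e1, e2, e3, Ring.choose_succ_succ, add_smul, add_comm]
    · have e1 : m + 1 + k - ((0 : ℕ) : ℤ) = m + (k + 1) - ((0 : ℕ) : ℤ) := by ring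
      rw [e1]
      simp
  have hRrec : ∀ m n k, R (m + 1) n k = R m n (k + 1) + R m (n + 1) k :=
    fun m n k => residue_recursion h1 h2 m n k
  have hnonneg : ∀ m n k, 0 ≤ n → S m n k = R m n k := by
    intro m n k hn
    rw [hS0 m n k 0 (by simp [hn]), hR, residue_of_nonneg _ _ _ _ hn]
    rfl
  change S m n k = R m n k
  induction m using Int.induction_on generalizing n k with
  | zero =>
    rw [hR, ← h.nProd_coeff_eq_residue]
    change ∑ᶠ l : ℕ, _ = _
    rw [finsum_eq_single _ 0]
    · simp
    · intro l hl
      obtain ⟨l, rfl⟩ := Nat.exists_eq_succ_of_ne_zero hl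
      rw [Ring.choose_zero_succ, zero_smul]
  | succ m ih => rw [hSrec, hRrec, ih, ih]
  | pred m ih =>
    -- The recursion, read from right to left, lowers `n` for fixed `m`, starting from `n = 0`.
    have down : ∀ t : ℕ, ∀ k, S (-(m : ℤ) - 1) (-(t : ℤ)) k = R (-(m : ℤ) - 1) (-(t : ℤ)) k := by
      intro t
      induction t with
      | zero => exact fun k => hnonneg _ _ _ (by simp)
      | succ t iht =>
        intro k
        have a1 := hSrec (-(m : ℤ) - 1) (-((t + 1 : ℕ) : ℤ)) (k - 1)
        have a2 := hRrec (-(m : ℤ) - 1) (-((t + 1 : ℕ) : ℤ)) (k - 1)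
        have e1 : -((t + 1 : ℕ) : ℤ) + 1 = -(t : ℤ) := by push_cast; ring
        rw [sub_add_cancel, sub_add_cancel, e1, ih] at a1
        rw [sub_add_cancel, sub_add_cancel, e1, a1, iht] at a2
        exact add_right_cancel a2
    rcases le_total 0 n with hn | hn
    · exact hnonneg _ _ _ hn
    · have := down n.natAbs k
      rwa [show -(n.natAbs : ℤ) = n by omega] at this

end SComm

/-! ### Gradings of fields -/

theorem HasGrade.hasParity {gr : Grade → Submodule 𝕂 A} {a : Fld 𝕂 A} {i : ZMod 2} {p w : ℤ}
    (h : HasGrade gr a i p w) : HasParity gr a i := by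
  intro n j v hv
  have : parityPart gr j ≤ (parityPart gr (i + j)).comap (a.coeff n) := by
    refine iSup_le fun q => iSup_le fun m v hv => ?_
    exact le_iSup_of_le (f := fun p => ⨆ w, gr (i + j, p, w)) (p + q)
      (le_iSup (fun w => gr (i + j, p + q, w)) (w + m - n - 1)) (h n j q m v hv)
  exact this hv

theorem HasGrade.add {gr : Grade → Submodule 𝕂 A} {a b : Fld 𝕂 A} {i : ZMod 2} {p w : ℤ}
    (ha : HasGrade gr a i p w) (hb : HasGrade gr b i p w) : HasGrade gr (a + b) i p w :=
  fun n j q m v hv => add_mem (ha n j q m v hv) (hb n j q m v hv)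

theorem HasGrade.smul {gr : Grade → Submodule 𝕂 A} {a : Fld 𝕂 A} {i : ZMod 2} {p w : ℤ}
    (r : 𝕂) (ha : HasGrade gr a i p w) : HasGrade gr (r • a) i p w :=
  fun n j q m v hv => Submodule.smul_mem _ r (ha n j q m v hv)

theorem hasGrade_zero (gr : Grade → Submodule 𝕂 A) (i : ZMod 2) (p w : ℤ) :
    HasGrade gr (0 : Fld 𝕂 A) i p w :=
  fun _ _ _ _ _ _ => zero_mem _

theorem hasGrade_vac (gr : Grade → Submodule 𝕂 A) : HasGrade gr (Fld.vac 𝕂 A) 0 0 0 := by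
  intro n j q m v hv
  rw [Fld.coeff_vac]
  split_ifs with h
  · rw [Module.End.one_apply, zero_add, zero_add, h]
    convert! hv using 4
    ring
  · exact zero_mem _

theorem HasGrade.nProd {gr : Grade → Submodule 𝕂 A} {a b : Fld 𝕂 A} {i j : ZMod 2}
    {p q w u : ℤ} (ha : HasGrade gr a i p w) (hb : HasGrade gr b j q u) (n : ℤ) :
    HasGrade gr (nProd i j n a b) (i + j) (p + q) (w + u - n - 1) := by
  intro k j' q' m v hv
  rw [nProd_coeff]
  refine finsum_induction (· ∈ gr _) (zero_mem _) (fun _ _ => add_mem) fun l => ?_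
  refine Submodule.smul_of_tower_mem _ _ (sub_mem ?_ (Submodule.smul_of_tower_mem _ _ ?_))
  · convert! ha (n - l) _ _ _ _ (hb (k + l) _ _ _ _ hv) using 2
    ext1
    · exact add_assoc _ _ _
    · ext1
      · exact add_assoc _ _ _
      · dsimp only; ring
  · convert! hb (n + k - l) _ _ _ _ (ha l _ _ _ _ hv) using 2
    ext1
    · dsimp only; ring
    · ext1 <;> dsimp only <;> ring

/-! ### The commutator with an operator -/

/-- The field with modes `[d, a_(n)]`, where `d` is an operator of parity `i` and `a` a field of
parity `j`. -/
def adField (d : Module.End 𝕂 A) (i j : ZMod 2) : Fld 𝕂 A →ₗ[𝕂] Fld 𝕂 A where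
  toFun a := ⟨fun n => sbracket i j d (a.coeff n), fun v => by
    obtain ⟨N, hN⟩ := a.2 v
    obtain ⟨M, hM⟩ := a.2 (d v)
    refine ⟨max N M, fun n hn => ?_⟩
    have h1 : a.coeff n v = 0 := hN n (by omega)
    have h2 : a.coeff n (d v) = 0 := hM n (by omega)
    simp [sbracket, h1, h2]⟩
  map_add' a b := Fld.ext fun n v => by
    change sbracket i j d (a.coeff n + b.coeff n) v =
      (sbracket i j d (a.coeff n) + sbracket i j d (b.coeff n)) v
    congr 1
    simp only [sbracket, mul_add, add_mul, smul_add]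
    abel
  map_smul' r a := Fld.ext fun n v => by
    change sbracket i j d (r • a.coeff n) v = (r • sbracket i j d (a.coeff n)) v
    congr 1
    simp only [sbracket, mul_smul_comm, smul_mul_assoc, smul_sub, smul_comm r]

@[simp] theorem adField_coeff (d : Module.End 𝕂 A) (i j : ZMod 2) (a : Fld 𝕂 A) (n : ℤ) :
    (adField d i j a).coeff n = sbracket i j d (a.coeff n) := rfl

/-- The commutator with an operator is a superderivation of every `n`-th product. -/
theorem adField_nProd (d : Module.End 𝕂 A) (s i j : ZMod 2) (n : ℤ) (a b : Fld 𝕂 A) :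
    adField d s (i + j) (nProd i j n a b) =
      nProd (s + i) j n (adField d s i a) b + koszul s i • nProd i (s + j) n a (adField d s j b) := by
  refine Fld.ext fun k v => ?_
  have e : (koszul s i • nProd i (s + j) n a (adField d s j b)).coeff k v =
    koszul s i • (nProd i (s + j) n a (adField d s j b)).coeff k v := rfl
  rw [Fld.coeff_add, LinearMap.add_apply, e, adField_coeff, sbracket]
  simp only [LinearMap.sub_apply, LinearMap.smul_apply, Module.End.mul_apply]
  simp only [nProd_coeff]
  rw [map_finsum _ (nProdTerm_finite i j n a b k v),
    smul_finsum' _ (nProdTerm_finite i j n a b k (d v)),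
    smul_finsum' _ (nProdTerm_finite i (s + j) n a (adField d s j b) k v),
    ← finsum_add_distrib (g := fun l => koszul s i • nProdTerm i (s + j) n a (adField d s j b) k v l)
      (nProdTerm_finite (s + i) j n (adField d s i a) b k v)
      ((nProdTerm_finite i (s + j) n a (adField d s j b) k v).subset
        (Function.support_const_smul_subset (koszul s i) _)),
    ← finsum_sub_distrib (g := fun l => koszul s (i + j) • nProdTerm i j n a b k (d v) l)
      ((nProdTerm_finite i j n a b k v).subset fun l hl h => hl (by
      simp only [h, map_zero]))
      ((nProdTerm_finite i j n a b k (d v)).subset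
        (Function.support_const_smul_subset (koszul s (i + j)) _))]
  refine finsum_congr fun l => ?_
  simp only [nProdTerm, adField_coeff, sbracket, map_zsmul, map_sub, LinearMap.sub_apply,
    LinearMap.smul_apply, Module.End.mul_apply, koszul_add_right, koszul_add_left,
    koszul_symm i s]
  rcases koszul_eq_or s i with h1 | h1 <;> rcases koszul_eq_or s j with h2 | h2 <;>
    rw [h1, h2] <;> module

end Fields

/-! ### Products of Laurent series -/

section Laurent

variable {R : Type*} [Ring R]

theorem laurent_coeff_mul (f g : HahnSeries ℤ R) (n : ℤ) {s : Finset ℤ}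
    (hs : ∀ i, i ∉ s → f.coeff i = 0 ∨ g.coeff (n - i) = 0) :
    (f * g).coeff n = ∑ i ∈ s, f.coeff i * g.coeff (n - i) := by
  rw [HahnSeries.coeff_mul]
  refine Finset.sum_bij_ne_zero (fun ij _ _ => ij.1) ?_ ?_ ?_ ?_
  · intro ij hij h0
    rw [Finset.mem_antidiagonal] at hij
    by_contra hc
    rcases hs _ hc with h | h
    · exact h0 (by rw [h, zero_mul])
    · rw [show n - ij.1 = ij.2 by omega] at h
      exact h0 (by rw [h, mul_zero])
  · intro x hx _ y hy _ hxy
    rw [Finset.mem_antidiagonal] at hx hy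
    exact Prod.ext hxy (by omega)
  · intro i _ h0
    refine ⟨(i, n - i), Finset.mem_antidiagonal.mpr ⟨left_ne_zero_of_mul h0,
      right_ne_zero_of_mul h0, by ring⟩, h0, rfl⟩
  · intro ij hij _
    rw [Finset.mem_antidiagonal] at hij
    rw [show n - ij.1 = ij.2 by omega]

theorem laurent_exists_bound (f : HahnSeries ℤ R) : ∃ p : ℤ, ∀ i, i < p → f.coeff i = 0 :=
  ⟨f.order, fun _ hi => HahnSeries.coeff_eq_zero_of_lt_order hi⟩

theorem laurent_exists_box (f g : HahnSeries ℤ R) (n : ℤ) : ∃ L₀ : ℕ, ∀ L : ℕ, L₀ ≤ L →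
    (∀ i : ℤ, i < -L → f.coeff i = 0) ∧ ∀ i : ℤ, L ≤ i → g.coeff (n - i) = 0 := by
  obtain ⟨p, hp⟩ := laurent_exists_bound f
  obtain ⟨q, hq⟩ := laurent_exists_bound g
  exact ⟨(-p).toNat + (n - q + 1).toNat, fun L hL =>
    ⟨fun i hi => hp i (by omega), fun i hi => hq _ (by omega)⟩⟩

/-- Laurent series with coefficients that commute up to a sign `ε` commute up to this sign. -/
theorem laurent_mul_comm {f g : HahnSeries ℤ R} {ε : ℤ}
    (h : ∀ i j, f.coeff i * g.coeff j = ε • (g.coeff j * f.coeff i)) : f * g = ε • (g * f) := by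
  ext n
  obtain ⟨L, hL⟩ := laurent_exists_box f g n
  obtain ⟨h1, h2⟩ := hL L le_rfl
  rw [HahnSeries.coeff_smul, laurent_coeff_mul f g n (s := Finset.Ico (-L) L),
    laurent_coeff_mul g f n (s := (Finset.Ico (-L : ℤ) L).image (n - ·)), Finset.sum_image,
    Finset.smul_sum]
  · refine Finset.sum_congr rfl fun i _ => ?_
    rw [h, sub_sub_cancel]
  · intro x _ y _ hxy
    dsimp only at hxy
    omega
  · intro i hi
    by_cases hi' : n - i < -L
    · exact Or.inr (h1 _ hi')
    · refine Or.inl ?_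
      rw [← sub_sub_cancel n i]
      refine h2 _ ?_
      by_contra hc
      exact hi (Finset.mem_image.mpr ⟨n - i, Finset.mem_Ico.mpr ⟨by omega, by omega⟩, by simp⟩)
  · intro i hi
    rw [Finset.mem_Ico] at hi
    by_cases hi' : i < -L
    · exact Or.inl (h1 _ hi')
    · exact Or.inr (h2 _ (by omega))

variable {𝕂 : Type*} [Field 𝕂] [Algebra 𝕂 R]

theorem hasseDeriv_one_mul (f g : HahnSeries ℤ R) :
    hasseDeriv 𝕂 1 (f * g) = hasseDeriv 𝕂 1 f * g + f * hasseDeriv 𝕂 1 g := by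
  ext n
  obtain ⟨L₁, hL₁⟩ := laurent_exists_box f g (n + 1)
  obtain ⟨L₂, hL₂⟩ := laurent_exists_box f g n
  obtain ⟨h1, h2⟩ := hL₁ (L₁ + L₂ + 1) (by omega)
  obtain ⟨-, h3⟩ := hL₂ (L₁ + L₂ + 1) (by omega)
  set L := L₁ + L₂ + 1
  rw [HahnSeries.coeff_add, LaurentSeries.hasseDeriv_coeff, Nat.cast_one,
    laurent_coeff_mul f g (n + 1) (s := Finset.Ico (-L) (L + 1)),
    laurent_coeff_mul (hasseDeriv 𝕂 1 f) g n
      (s := (Finset.Ico (-L : ℤ) (L + 1)).image (fun i => i - 1)),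
    laurent_coeff_mul f (hasseDeriv 𝕂 1 g) n (s := Finset.Ico (-L) (L + 1)), Finset.sum_image,
    Finset.smul_sum, ← Finset.sum_add_distrib]
  · refine Finset.sum_congr rfl fun i _ => ?_
    simp only [LaurentSeries.hasseDeriv_coeff, Nat.cast_one, Ring.choose_one_right,
      sub_add_cancel, smul_mul_assoc, mul_smul_comm]
    rw [show n - (i - 1) = n + 1 - i by ring, show n - i + 1 = n + 1 - i by ring, ← add_smul]
    congr 1
    ring
  · intro x _ y _ hxy
    dsimp only at hxy
    omega
  · intro i hi
    rw [Finset.mem_Ico] at hi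
    by_cases hi' : i < -L
    · exact Or.inl (h1 _ hi')
    · refine Or.inr ?_
      rw [LaurentSeries.hasseDeriv_coeff, Nat.cast_one, show n - i + 1 = n + 1 - i by ring,
        h2 _ (by omega), smul_zero]
  · intro i hi
    by_cases hi' : i + 1 < -L
    · left
      rw [LaurentSeries.hasseDeriv_coeff, Nat.cast_one, h1 _ hi', smul_zero]
    · refine Or.inr (h3 _ ?_)
      by_contra hc
      exact hi (Finset.mem_image.mpr ⟨i + 1, Finset.mem_Ico.mpr ⟨by omega, by omega⟩, by simp⟩)
  · intro i hi
    rw [Finset.mem_Ico] at hi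
    by_cases hi' : i < -L
    · exact Or.inl (h1 _ hi')
    · exact Or.inr (h2 _ (by omega))

end Laurent

section Restriction

variable {𝕂 : Type*} [Field 𝕂] {A : Type*} [AddCommGroup A] [Module 𝕂 A]

/-! ### Restriction of fields to subspaces with bounded poles -/

/-- The field `a` preserves the subspace `C` and its restriction to `C` is given by the Laurent
series `f` with coefficients in `End C`; the coefficient of `z ^ k` is `a_(-1-k)`. -/
def IsRestr (C : Submodule 𝕂 A) (a : Fld 𝕂 A) (f : HahnSeries ℤ (Module.End 𝕂 C)) : Prop :=
  ∀ (k : ℤ) (v : C), (f.coeff k v : A) = a.coeff (-1 - k) v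

/-- A field which preserves `C` and has a pole of bounded order on `C` restricts to `C`. -/
theorem exists_isRestr {C : Submodule 𝕂 A} {a : Fld 𝕂 A} {N : ℤ}
    (h1 : ∀ n, ∀ v ∈ C, a.coeff n v ∈ C) (h2 : ∀ n, N ≤ n → ∀ v ∈ C, a.coeff n v = 0) :
    ∃ f, IsRestr C a f :=
  ⟨HahnSeries.ofSuppBddBelow (fun k => (a.coeff (-1 - k)).restrict (h1 _)) ⟨-1 - N, fun k hk => by
    by_contra hc
    exact hk (LinearMap.ext fun v => Subtype.ext (h2 _ (by omega) v.1 v.2))⟩, fun _ _ => rfl⟩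

theorem isRestr_vac (C : Submodule 𝕂 A) : IsRestr C (Fld.vac 𝕂 A) 1 := fun k v => by
  rw [Fld.coeff_vac, HahnSeries.coeff_one]
  by_cases h : k = 0
  · simp [h]
  · rw [if_neg h, if_neg (by omega)]
    rfl

namespace IsRestr

variable {C : Submodule 𝕂 A} {a b : Fld 𝕂 A} {f g : HahnSeries ℤ (Module.End 𝕂 C)}

theorem add (ha : IsRestr C a f) (hb : IsRestr C b g) : IsRestr C (a + b) (f + g) := fun k v => by
  simp [ha k v, hb k v]

theorem smul (r : 𝕂) (ha : IsRestr C a f) : IsRestr C (r • a) (r • f) := fun k v => by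
  simp [ha k v]

theorem zero : IsRestr C 0 0 := fun k v => by simp

theorem eq_of_eq (ha : IsRestr C a f) (hb : IsRestr C b f) (n : ℤ) {v : A} (hv : v ∈ C) :
    a.coeff n v = b.coeff n v := by
  have h1 := ha (-1 - n) ⟨v, hv⟩
  have h2 := hb (-1 - n) ⟨v, hv⟩
  rw [sub_sub_cancel] at h1 h2
  rw [← h1, ← h2]

theorem coeff_mul_comm {i j : ZMod 2} (h : SComm i j a b) (ha : IsRestr C a f)
    (hb : IsRestr C b g) (p q : ℤ) :
    f.coeff p * g.coeff q = koszul i j • (g.coeff q * f.coeff p) := by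
  ext v
  simp only [Module.End.mul_apply, LinearMap.smul_apply, Submodule.coe_smul_of_tower]
  rw [ha p, hb q, hb q, ha p, h.apply]

/-- Regroups the sum over the indices outside of `[-κ, 0)` into pairs, as in `nProdTerm`. -/
theorem sum_Ico_fold {M : Type*} [AddCommMonoid M] (κ : ℕ) (h : ℤ → M)
    (h0 : ∀ i : ℤ, -κ ≤ i → i < 0 → h i = 0) (L : ℕ) :
    ∑ i ∈ Finset.Ico (-κ - L : ℤ) L, h i = ∑ l ∈ Finset.range L, (h l + h (-1 - κ - l)) := by
  induction L with
  | zero =>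
    rw [Finset.range_zero, Finset.sum_empty]
    refine Finset.sum_eq_zero fun i hi => ?_
    rw [Finset.mem_Ico] at hi
    exact h0 i (by simpa using hi.1) (by simpa using hi.2)
  | succ L ih =>
    rw [Finset.sum_range_succ, ← ih]
    have e : Finset.Ico (-κ - (L + 1 : ℕ) : ℤ) (L + 1 : ℕ) =
        insert (L : ℤ) (insert (-1 - κ - L : ℤ) (Finset.Ico (-κ - L : ℤ) L)) := by
      ext i
      simp only [Finset.mem_Ico, Finset.mem_insert]
      omega
    rw [e, Finset.sum_insert, Finset.sum_insert]
    · abel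
    · simp only [Finset.mem_Ico]; omega
    · simp only [Finset.mem_Ico, Finset.mem_insert]; omega

theorem neg_one_pow_mul_choose (κ l : ℕ) :
    ((-1) ^ l * Ring.choose (-1 - κ : ℤ) l : ℤ) = ((l + κ).choose κ : ℤ) := by
  have h := Ring.choose_neg (1 + κ : ℤ) l
  rw [show (1 + κ : ℤ) + l - 1 = ((l + κ : ℕ) : ℤ) by push_cast; ring, Ring.choose_natCast] at h
  rw [show (-1 - κ : ℤ) = -(1 + κ) by ring, h, Units.smul_def, Int.negOnePow_def, zpow_natCast,
    smul_eq_mul, ← mul_assoc]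
  push_cast
  rw [← mul_pow, Nat.choose_symm_add]
  simp

/-- For supercommuting fields, the `n`-th products with `n < 0` restrict to products of
(derivatives of) Laurent series. -/
theorem nProd {i j : ZMod 2} (h : SComm i j a b) (ha : IsRestr C a f) (hb : IsRestr C b g)
    (κ : ℕ) : IsRestr C (nProd i j (-1 - κ) a b) (hasseDeriv 𝕂 κ f * g) := by
  intro m v
  obtain ⟨L, hL⟩ := laurent_exists_box f g m
  obtain ⟨h1, h2⟩ := hL L le_rfl
  rw [laurent_coeff_mul _ _ _ (s := Finset.Ico (-κ - L) L), sum_Ico_fold, nProd_coeff,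
    finsum_eq_sum_range (N := L)]
  · rw [LinearMap.sum_apply, AddSubmonoidClass.coe_finsetSum]
    refine Finset.sum_congr rfl fun l _ => ?_
    have e1 : Ring.choose ((l : ℤ) + κ) κ = ((l + κ).choose κ : ℤ) := by
      rw [← Nat.cast_add, Ring.choose_natCast]
    have e2 : Ring.choose (-1 - κ - l + κ : ℤ) κ = (-1) ^ κ * ((l + κ).choose κ : ℤ) := by
      have := neg_one_pow_mul_choose l κ
      rw [show (-1 - κ - l + κ : ℤ) = -1 - l by ring, add_comm l, Nat.choose_symm_add, ← this,
        ← mul_assoc, ← mul_pow]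
      simp
    have e3 : ((Int.negOnePow (-1 - κ) : ℤˣ) : ℤ) = - (-1) ^ κ := by
      rw [Int.negOnePow_sub, Int.negOnePow_neg, Int.negOnePow_one, Int.negOnePow_def,
        zpow_natCast]
      simp
    simp only [nProdTerm, LaurentSeries.hasseDeriv_coeff, e1, e2, e3, neg_one_pow_mul_choose,
      LinearMap.add_apply, smul_mul_assoc, LinearMap.smul_apply, Module.End.mul_apply,
      Submodule.coe_add, Submodule.coe_smul_of_tower, ha _, hb _]
    rw [h.apply (-1 - (-1 - κ - l + κ))]
    rw [show (-1 - (l + κ) : ℤ) = -1 - κ - l by ring, show (-1 - (m - l) : ℤ) = -1 - m + l by ring,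
      show (-1 - (-1 - κ - l + κ) : ℤ) = l by ring,
      show (-1 - (m - (-1 - κ - l)) : ℤ) = -1 - κ + (-1 - m) - l by ring]
    module
  · intro l hl
    have e1 : b.coeff (-1 - m + l) v = 0 := by
      have := hb (m - l) v
      rw [h2 l (by omega)] at this
      rw [show -1 - m + (l : ℤ) = -1 - (m - l) by ring, ← this]
      rfl
    have e2 : a.coeff l v = 0 := by
      have := ha (-1 - l) v
      rw [h1 _ (by omega), sub_sub_cancel] at this
      rw [← this]
      rfl
    simp [nProdTerm, e1, e2]
  · intro i hi1 hi2
    obtain ⟨r, hr⟩ : ∃ r : ℕ, i + κ = r := ⟨(i + κ).toNat, by omega⟩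
    rw [LaurentSeries.hasseDeriv_coeff, hr, Ring.choose_natCast,
      Nat.choose_eq_zero_of_lt (by omega)]
    simp
  · intro i hi
    rw [Finset.mem_Ico] at hi
    by_cases hi' : L ≤ i
    · exact Or.inr (h2 i hi')
    · left
      rw [LaurentSeries.hasseDeriv_coeff, h1 _ (by omega), smul_zero]

end IsRestr

end Restriction

/-! ### Derivatives of fields -/

section Deriv

variable {𝕂 : Type*} [Field 𝕂] {A : Type*} [AddCommGroup A] [Module 𝕂 A]

/-- The derivative `∂_z a(z)`. -/
def Fld.deriv : Fld 𝕂 A →ₗ[𝕂] Fld 𝕂 A where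
  toFun a := ⟨fun n => (-n) • a.coeff (n - 1), fun v => by
    obtain ⟨N, hN⟩ := a.2 v
    refine ⟨N + 1, fun n hn => ?_⟩
    have : a.coeff (n - 1) v = 0 := hN _ (by omega)
    rw [LinearMap.smul_apply, this, smul_zero]⟩
  map_add' a b := Fld.ext fun n v => LinearMap.congr_fun (smul_add (-n) _ _) v
  map_smul' r a := Fld.ext fun n v => LinearMap.congr_fun (smul_comm (-n) r (a.coeff (n - 1))) v

theorem Fld.deriv_coeff (a : Fld 𝕂 A) (n : ℤ) : a.deriv.coeff n = (-n) • a.coeff (n - 1) := rfl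

theorem Fld.deriv_vac : (Fld.vac 𝕂 A).deriv = 0 := by
  refine Fld.ext fun n v => ?_
  rw [Fld.deriv_coeff, Fld.coeff_vac]
  by_cases h : n = 0
  · simp [h]
  · rw [if_neg (by omega), smul_zero]
    rfl

theorem adField_vac (d : Module.End 𝕂 A) (i : ZMod 2) :
    adField d i 0 (Fld.vac 𝕂 A) = 0 := by
  refine Fld.ext fun n v => ?_
  rw [adField_coeff, Fld.coeff_vac, sbracket]
  split_ifs <;> simp

theorem IsRestr.deriv {C : Submodule 𝕂 A} {a : Fld 𝕂 A} {f : HahnSeries ℤ (Module.End 𝕂 C)}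
    (h : IsRestr C a f) : IsRestr C a.deriv (hasseDeriv 𝕂 1 f) := fun k v => by
  rw [LaurentSeries.hasseDeriv_coeff, Nat.cast_one, Ring.choose_one_right, LinearMap.smul_apply,
    Submodule.coe_smul_of_tower, h, Fld.deriv_coeff, LinearMap.smul_apply]
  rw [show -(-1 - k) = k + 1 by ring, show -1 - k - 1 = -1 - (k + 1) by ring]

theorem SComm.deriv_left {i j : ZMod 2} {a b : Fld 𝕂 A} (h : SComm i j a b) :
    SComm i j a.deriv b := fun m n => by
  rw [Fld.deriv_coeff, smul_mul_assoc, h, mul_smul_comm, smul_comm]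

theorem SComm.deriv_right {i j : ZMod 2} {a b : Fld 𝕂 A} (h : SComm i j a b) :
    SComm i j a b.deriv := h.symm.deriv_left.symm

end Deriv

/-! ### Normally ordered monomials in supercommuting fields -/

section Words

variable {𝕂 : Type*} [Field 𝕂] {A : Type*} [AddCommGroup A] [Module 𝕂 A]
  {B : Type*} [AddCommGroup B] [Module 𝕂 B] {L : Type*} (par : L → ZMod 2)

/-- The parity of a word in the letters `(x, k)`, where `(x, k)` stands for the `k`-th divided
derivative of the generator `x`. -/
def wordPar : List (L × ℕ) → ZMod 2
  | [] => 0
  | x :: w => par x.1 + wordPar w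

/-- The normally ordered monomial `∂^(k₁) X_{x₁} ⋯ ∂^(k_r) X_{x_r}`, with divided derivatives. -/
def word (X : L → Fld 𝕂 A) : List (L × ℕ) → Fld 𝕂 A
  | [] => Fld.vac 𝕂 A
  | x :: w => nProd (par x.1) (wordPar par w) (-1 - x.2) (X x.1) (word X w)

/-- The monomial in Laurent series given by a word. -/
def wordSeries {R : Type*} [Ring R] [Algebra 𝕂 R] (f : L → HahnSeries ℤ R) :
    List (L × ℕ) → HahnSeries ℤ R
  | [] => 1
  | x :: w => hasseDeriv 𝕂 x.2 (f x.1) * wordSeries f w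

theorem wordSeries_append {R : Type*} [Ring R] [Algebra 𝕂 R] (f : L → HahnSeries ℤ R)
    (w w' : List (L × ℕ)) :
    wordSeries (𝕂 := 𝕂) f (w ++ w') = wordSeries (𝕂 := 𝕂) f w * wordSeries (𝕂 := 𝕂) f w' := by
  induction w with
  | nil => simp [wordSeries]
  | cons x w ih => rw [List.cons_append, wordSeries, wordSeries, ih, mul_assoc]

theorem wordPar_append (w w' : List (L × ℕ)) :
    wordPar par (w ++ w') = wordPar par w + wordPar par w' := by
  induction w with
  | nil => simp [wordPar]
  | cons x w ih => rw [List.cons_append, wordPar, wordPar, ih, add_assoc]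

/-- A family of fields, of the parities given by `par`, with supercommuting modes. -/
def SCommFamily (X : L → Fld 𝕂 A) : Prop := ∀ x y, SComm (par x) (par y) (X x) (X y)

/-- The subspace of the vectors on which all the fields `X x` have poles of order at most `N`. -/
def bounded (X : L → Fld 𝕂 A) (N : ℤ) : Submodule 𝕂 A where
  carrier := {v | ∀ x p, N ≤ p → (X x).coeff p v = 0}
  zero_mem' := fun x p _ => map_zero _
  add_mem' := fun hv hw x p hp => by rw [map_add, hv x p hp, hw x p hp, add_zero]
  smul_mem' := fun r v hv x p hp => by rw [map_smul, hv x p hp, smul_zero]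

theorem exists_mem_bounded [Finite L] (X : L → Fld 𝕂 A) (v : A) : ∃ N, v ∈ bounded X N := by
  have h : ∀ x, ∃ N : ℤ, ∀ p, N ≤ p → (X x).coeff p v = 0 := fun x => (X x).2 v
  choose N hN using h
  obtain ⟨M, hM⟩ := (Set.finite_range N).bddAbove
  exact ⟨M, fun x p hp => hN x p ((hM ⟨x, rfl⟩).trans hp)⟩

variable {par}
variable {X : L → Fld 𝕂 A} {Y : L → Fld 𝕂 B}

theorem SCommFamily.exists_isRestr (hX : SCommFamily par X) (N : ℤ) (x : L) :
    ∃ f, IsRestr (bounded X N) (X x) f := by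
  refine ChiralWeil.exists_isRestr (N := N) (fun n v hv y p hp => ?_) fun n hn v hv => hv x n hn
  rw [(hX y x).apply, hv y p hp, map_zero, smul_zero]

variable (𝕂) in
/-- The Laurent series by which the generating field `X x` acts on `bounded X N`. -/
def genSeries (hX : SCommFamily par X) (N : ℤ) (x : L) :
    HahnSeries ℤ (Module.End 𝕂 (bounded X N)) := (hX.exists_isRestr N x).choose

theorem isRestr_genSeries (hX : SCommFamily par X) (N : ℤ) (x : L) :
    IsRestr (bounded X N) (X x) (genSeries 𝕂 hX N x) := (hX.exists_isRestr N x).choose_spec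

theorem SCommFamily.word_right (hX : SCommFamily par X) (x : L) (w : List (L × ℕ)) :
    SComm (par x) (wordPar par w) (X x) (word par X w) := by
  induction w with
  | nil => exact SComm.vac_right
  | cons y w ih => exact SComm.nProd_right (hX x y.1) ih _

theorem SCommFamily.word_word (hX : SCommFamily par X) (w w' : List (L × ℕ)) :
    SComm (wordPar par w) (wordPar par w') (word par X w) (word par X w') := by
  induction w with
  | nil => exact SComm.vac_right.symm
  | cons y w ih => exact SComm.nProd_left (hX.word_right y.1 w') ih _

theorem isRestr_word (hX : SCommFamily par X) (N : ℤ) (w : List (L × ℕ)) :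
    IsRestr (bounded X N) (word par X w) (wordSeries (𝕂 := 𝕂) (genSeries 𝕂 hX N) w) := by
  induction w with
  | nil => exact isRestr_vac _
  | cons x w ih =>
    exact IsRestr.nProd (hX.word_right x.1 w) (isRestr_genSeries hX N x.1) ih x.2

/-- Fields with the same restrictions to all the subspaces `bounded X N` are equal. -/
theorem ext_of_isRestr [Finite L] (X : L → Fld 𝕂 A) {a b : Fld 𝕂 A}
    (h : ∀ N, ∃ f, IsRestr (bounded X N) a f ∧ IsRestr (bounded X N) b f) : a = b := by
  refine Fld.ext fun n v => ?_
  obtain ⟨N, hN⟩ := exists_mem_bounded X v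
  obtain ⟨f, ha, hb⟩ := h N
  exact ha.eq_of_eq hb n hN

theorem nProd_word_word [Finite L] (hX : SCommFamily par X) (w w' : List (L × ℕ)) :
    nProd (wordPar par w) (wordPar par w') (-1) (word par X w) (word par X w') =
      word par X (w ++ w') := by
  refine ext_of_isRestr X fun N => ⟨_, ?_, isRestr_word hX N _⟩
  have := IsRestr.nProd (hX.word_word w w') (isRestr_word hX N w) (isRestr_word hX N w') 0
  rw [LaurentSeries.hasseDeriv_zero, LinearMap.id_apply, Nat.cast_zero, sub_zero] at this
  rwa [wordSeries_append]

/-- A one-letter word is its letter. -/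
theorem word_singleton [Finite L] (hX : SCommFamily par X) (x : L) :
    word par X [(x, 0)] = X x := by
  refine ext_of_isRestr X fun N => ⟨_, isRestr_word hX N _, ?_⟩
  simp only [wordSeries, LaurentSeries.hasseDeriv_zero, LinearMap.id_apply, mul_one]
  exact isRestr_genSeries hX N x

theorem deriv_word_cons [Finite L] (hX : SCommFamily par X) (x : L) (k : ℕ) (w : List (L × ℕ)) :
    (word par X ((x, k) :: w)).deriv = ((k + 1 : ℕ) : 𝕂) • word par X ((x, k + 1) :: w) +
      nProd (par x) (wordPar par w) (-1 - k) (X x) (word par X w).deriv := by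
  refine ext_of_isRestr X fun N => ⟨_, (isRestr_word hX N _).deriv, ?_⟩
  rw [wordSeries, hasseDeriv_one_mul, LaurentSeries.hasseDeriv_comp, add_comm 1 k,
    Nat.choose_one_right, smul_mul_assoc, ← Nat.cast_smul_eq_nsmul 𝕂]
  exact ((isRestr_word hX N ((x, k + 1) :: w)).smul _).add
    (IsRestr.nProd (hX.word_right x w).deriv_right (isRestr_genSeries hX N x)
      (isRestr_word hX N w).deriv k)

theorem nProd_deriv_word [Finite L] (hX : SCommFamily par X) (k : ℕ) (w w' : List (L × ℕ)) :
    nProd (wordPar par w) (wordPar par w') (-1 - k) (word par X w).deriv (word par X w') =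
      ((k + 1 : ℕ) : 𝕂) • nProd (wordPar par w) (wordPar par w') (-1 - (k + 1 : ℕ))
        (word par X w) (word par X w') := by
  refine ext_of_isRestr X fun N => ⟨_, IsRestr.nProd (hX.word_word w w').deriv_left
    (isRestr_word hX N w).deriv (isRestr_word hX N w') k, ?_⟩
  rw [LaurentSeries.hasseDeriv_comp, Nat.choose_symm_add, Nat.choose_one_right,
    smul_mul_assoc, ← Nat.cast_smul_eq_nsmul 𝕂]
  exact (IsRestr.nProd (hX.word_word w w') (isRestr_word hX N w) (isRestr_word hX N w') _).smul _

/-! ### Monomials in two families of fields with the same parities -/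

variable (par X Y)

/-- The pairs of fields obtained by evaluating one supercommutative polynomial of parity `i` on
two families of generators. -/
def wordPairs (i : ZMod 2) : Submodule 𝕂 (Fld 𝕂 A × Fld 𝕂 B) :=
  Submodule.span 𝕂 {u | ∃ w, wordPar par w = i ∧ u = (word par X w, word par Y w)}

variable {par X Y}

theorem mem_wordPairs (w : List (L × ℕ)) :
    (word par X w, word par Y w) ∈ wordPairs par X Y (wordPar par w) :=
  Submodule.subset_span ⟨w, rfl, rfl⟩

theorem wordPairs_le {i : ZMod 2} {S : Submodule 𝕂 (Fld 𝕂 A × Fld 𝕂 B)}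
    (h : ∀ w, wordPar par w = i → (word par X w, word par Y w) ∈ S) :
    wordPairs par X Y i ≤ S := by
  refine Submodule.span_le.mpr ?_
  rintro _ ⟨w, hw, rfl⟩
  exact h w hw

theorem wordPairs_bilinear {i j : ZMod 2} {S : Submodule 𝕂 (Fld 𝕂 A × Fld 𝕂 B)}
    (f : Fld 𝕂 A →ₗ[𝕂] Fld 𝕂 A →ₗ[𝕂] Fld 𝕂 A) (g : Fld 𝕂 B →ₗ[𝕂] Fld 𝕂 B →ₗ[𝕂] Fld 𝕂 B)
    (h : ∀ w w', wordPar par w = i → wordPar par w' = j →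
      (f (word par X w) (word par X w'), g (word par Y w) (word par Y w')) ∈ S)
    {u v : Fld 𝕂 A × Fld 𝕂 B} (hu : u ∈ wordPairs par X Y i) (hv : v ∈ wordPairs par X Y j) :
    (f u.1 v.1, g u.2 v.2) ∈ S := by
  have h1 : ∀ w, wordPar par w = i →
      wordPairs par X Y j ≤ S.comap ((f (word par X w)).prodMap (g (word par Y w))) :=
    fun w hw => wordPairs_le fun w' hw' => h w w' hw hw'
  have h2 : wordPairs par X Y i ≤ S.comap ((f.flip v.1).prodMap (g.flip v.2)) :=
    wordPairs_le fun w hw => h1 w hw hv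
  exact h2 hu

theorem wordPairs_sComm (hX : SCommFamily par X) (hY : SCommFamily par Y) {i j : ZMod 2}
    {u v : Fld 𝕂 A × Fld 𝕂 B} (hu : u ∈ wordPairs par X Y i) (hv : v ∈ wordPairs par X Y j) :
    SComm i j u.1 v.1 ∧ SComm i j u.2 v.2 := by
  have key : ∀ {i j : ZMod 2} {u v : Fld 𝕂 A × Fld 𝕂 B}, v ∈ wordPairs par X Y j →
      (∀ w, wordPar par w = j → SComm i j u.1 (word par X w) ∧ SComm i j u.2 (word par Y w)) →
      SComm i j u.1 v.1 ∧ SComm i j u.2 v.2 := by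
    intro i j u v hv h
    induction hv using Submodule.span_induction with
    | mem v hv =>
      obtain ⟨w, hw, rfl⟩ := hv
      exact h w hw
    | zero => exact ⟨SComm.zero_right, SComm.zero_right⟩
    | add v v' _ _ hv hv' => exact ⟨hv.1.add_right hv'.1, hv.2.add_right hv'.2⟩
    | smul r v _ hv => exact ⟨hv.1.smul_right r, hv.2.smul_right r⟩
  refine key hv fun w hw => ?_
  have := key (u := (word par X w, word par Y w)) (i := j) hu fun w' hw' => by
    rw [← hw, ← hw']
    exact ⟨hX.word_word w w', hY.word_word w w'⟩
  exact ⟨this.1.symm, this.2.symm⟩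

variable [Finite L]

theorem wordPairs_gen (hX : SCommFamily par X) (hY : SCommFamily par Y) (x : L) :
    (X x, Y x) ∈ wordPairs par X Y (par x) := by
  have := mem_wordPairs (par := par) (X := X) (Y := Y) [(x, 0)]
  rwa [word_singleton hX, word_singleton hY, wordPar, wordPar, add_zero] at this

theorem wordPairs_deriv (hX : SCommFamily par X) (hY : SCommFamily par Y) {i : ZMod 2}
    {u : Fld 𝕂 A × Fld 𝕂 B} (hu : u ∈ wordPairs par X Y i) :
    (u.1.deriv, u.2.deriv) ∈ wordPairs par X Y i := by
  have key : ∀ w, ((word par X w).deriv, (word par Y w).deriv) ∈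
      wordPairs par X Y (wordPar par w) := by
    intro w
    induction w with
    | nil =>
      simp only [word, Fld.deriv_vac]
      exact zero_mem _
    | cons x w ih =>
      obtain ⟨x, k⟩ := x
      rw [deriv_word_cons hX, deriv_word_cons hY]
      rw [← Prod.mk_add_mk, ← Prod.smul_mk]
      refine add_mem (Submodule.smul_mem _ ((k + 1 : ℕ) : 𝕂)
        (mem_wordPairs (par := par) (X := X) (Y := Y) ((x, k + 1) :: w))) ?_
      have : wordPairs par X Y (wordPar par w) ≤ (wordPairs par X Y (par x + wordPar par w)).comap
          ((nProdHom 𝕂 A (par x) (wordPar par w) (-1 - k) (X x)).prodMap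
            (nProdHom 𝕂 B (par x) (wordPar par w) (-1 - k) (Y x))) := by
        refine wordPairs_le fun w' hw' => ?_
        have := mem_wordPairs (par := par) (X := X) (Y := Y) ((x, k) :: w')
        rwa [word, word, wordPar, hw'] at this
      exact this ih
  have : wordPairs par X Y i ≤ (wordPairs par X Y i).comap (Fld.deriv.prodMap Fld.deriv) :=
    wordPairs_le fun w hw => hw ▸ key w
  exact this hu

/-- The pairs of equal polynomials in two families are closed under all `n`-th products. -/
theorem wordPairs_nProd [CharZero 𝕂] (hX : SCommFamily par X) (hY : SCommFamily par Y)
    {i j : ZMod 2} (n : ℤ) {u v : Fld 𝕂 A × Fld 𝕂 B} (hu : u ∈ wordPairs par X Y i)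
    (hv : v ∈ wordPairs par X Y j) :
    (nProd i j n u.1 v.1, nProd i j n u.2 v.2) ∈ wordPairs par X Y (i + j) := by
  rcases le_or_gt 0 n with hn | hn
  · obtain ⟨h1, h2⟩ := wordPairs_sComm hX hY hu hv
    rw [h1.nProd_of_nonneg hn, h2.nProd_of_nonneg hn]
    exact zero_mem _
  · obtain ⟨k, rfl⟩ : ∃ k : ℕ, n = -1 - k := ⟨(-1 - n).toNat, by omega⟩
    clear hn
    induction k generalizing u v with
    | zero =>
      refine wordPairs_bilinear (nProdHom 𝕂 A i j _) (nProdHom 𝕂 B i j _) ?_ hu hv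
      rintro w w' rfl rfl
      simp only [nProdHom_apply, Nat.cast_zero, sub_zero]
      rw [nProd_word_word hX, nProd_word_word hY, ← wordPar_append]
      exact mem_wordPairs _
    | succ k ih =>
      refine wordPairs_bilinear (nProdHom 𝕂 A i j _) (nProdHom 𝕂 B i j _) ?_ hu hv
      rintro w w' rfl rfl
      have := ih (wordPairs_deriv hX hY (mem_wordPairs w)) (mem_wordPairs w')
      rw [nProd_deriv_word hX, nProd_deriv_word hY] at this
      have hk : ((k + 1 : ℕ) : 𝕂) ≠ 0 := Nat.cast_ne_zero.mpr (Nat.succ_ne_zero k)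
      have := Submodule.smul_mem _ ((k + 1 : ℕ) : 𝕂)⁻¹ this
      rw [Prod.smul_mk, smul_smul, smul_smul, inv_mul_cancel₀ hk, one_smul, one_smul] at this
      exact this

/-- If the commutators of two operators with the generators are given by the same polynomials, then
so are those with all polynomials in the generators. -/
theorem wordPairs_adField [CharZero 𝕂] (hX : SCommFamily par X) (hY : SCommFamily par Y)
    {d : Module.End 𝕂 A} {d' : Module.End 𝕂 B} {s : ZMod 2}
    (h : ∀ x, (adField d s (par x) (X x), adField d' s (par x) (Y x)) ∈
      wordPairs par X Y (s + par x))
    {i : ZMod 2} {u : Fld 𝕂 A × Fld 𝕂 B} (hu : u ∈ wordPairs par X Y i) :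
    (adField d s i u.1, adField d' s i u.2) ∈ wordPairs par X Y (s + i) := by
  have key : ∀ w, (adField d s (wordPar par w) (word par X w),
      adField d' s (wordPar par w) (word par Y w)) ∈ wordPairs par X Y (s + wordPar par w) := by
    intro w
    induction w with
    | nil =>
      have e1 := adField_vac d s
      have e2 := adField_vac d' s
      rw [word, word, wordPar, e1, e2]
      exact zero_mem _
    | cons x w ih =>
      have h1 := wordPairs_nProd hX hY (-1 - x.2) (h x.1) (mem_wordPairs w)
      have h2 := wordPairs_nProd hX hY (-1 - x.2) (wordPairs_gen hX hY x.1) ih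
      rw [add_assoc] at h1
      rw [add_left_comm] at h2
      have h3 := add_mem h1 (Submodule.smul_of_tower_mem _ (koszul s (par x.1)) h2)
      rw [Prod.smul_mk, Prod.mk_add_mk] at h3
      dsimp only at h3
      rw [← adField_nProd, ← adField_nProd] at h3
      exact h3
  have : wordPairs par X Y i ≤ (wordPairs par X Y (s + i)).comap
      ((adField d s i).prodMap (adField d' s i)) := wordPairs_le fun w hw => hw ▸ key w
  exact this hu

end Words

/-! ### Representations of the algebra of modes -/

section Rep

variable {𝕂 : Type*} [Field 𝕂] {V : Type*} [AddCommGroup V] [Module 𝕂 V]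
  {N : Type*} [AddCommGroup N] [Module 𝕂 N]

theorem modeElt_add (i : ZMod 2) (x y : V × Module.Dual 𝕂 V) (n : ℤ) :
    modeElt 𝕂 i (x + y) n = modeElt 𝕂 i x n + modeElt 𝕂 i y n := by
  have := RingQuot.mkAlgHom_rel 𝕂 (ModeRel.add (𝕂 := 𝕂) i x y n)
  rwa [map_add] at this

theorem modeElt_smul (i : ZMod 2) (r : 𝕂) (x : V × Module.Dual 𝕂 V) (n : ℤ) :
    modeElt 𝕂 i (r • x) n = r • modeElt 𝕂 i x n := by
  have := RingQuot.mkAlgHom_rel 𝕂 (ModeRel.smul (𝕂 := 𝕂) i r x n)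
  rwa [map_smul] at this

variable (𝕂 V) in
/-- The operators `x_(n)` on `Weil`, as a linear function of the label `x`. -/
def modeOpHom (i : ZMod 2) (n : ℤ) :
    (V × Module.Dual 𝕂 V) →ₗ[𝕂] Module.End 𝕂 (Weil 𝕂 V) where
  toFun x := modeOp 𝕂 i x n
  map_add' x y := by simp only [modeOp, modeElt_add, map_add]
  map_smul' r x := by simp only [modeOp, modeElt_smul, map_smul, RingHom.id_apply]

theorem modeOpHom_apply (i : ZMod 2) (n : ℤ) (x : V × Module.Dual 𝕂 V) :
    modeOpHom 𝕂 V i n x = modeOp 𝕂 i x n := rfl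

/-- The canonical commutation relations of the modes. -/
theorem sbracket_modeOp (i j : ZMod 2) (x y : V × Module.Dual 𝕂 V) (m n : ℤ) :
    sbracket i j (modeOp 𝕂 i x m) (modeOp 𝕂 j y n) =
      algebraMap 𝕂 (Module.End 𝕂 (Weil 𝕂 V)) (if m + n = -1 then labelForm i j x y else 0) := by
  have := congrArg (Algebra.lsmul 𝕂 𝕂 (Weil 𝕂 V))
    (RingQuot.mkAlgHom_rel 𝕂 (ModeRel.bracket (𝕂 := 𝕂) i j x y m n))
  simp only [AlgHom.commutes] at this
  rw [← this]
  simp only [sbracket, map_sub, map_mul, map_zsmul]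
  rfl

theorem modeOp_vacuum (i : ZMod 2) (x : V × Module.Dual 𝕂 V) {n : ℤ} (hn : 0 ≤ n) :
    modeOp 𝕂 i x n (Weil.vacuum 𝕂 V) = 0 := by
  change modeElt 𝕂 i x n • (Submodule.Quotient.mk 1 : Weil 𝕂 V) = 0
  rw [← Submodule.Quotient.mk_smul, Submodule.Quotient.mk_eq_zero, smul_eq_mul, mul_one]
  exact Submodule.subset_span ⟨i, x, n, hn, rfl⟩

/-- Every vector of `Weil` is obtained from the vacuum by applying modes. -/
theorem weil_eq_top {S : Submodule 𝕂 (Weil 𝕂 V)} (h0 : Weil.vacuum 𝕂 V ∈ S)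
    (h1 : ∀ i v n, ∀ u ∈ S, modeOp 𝕂 i (v, 0) n u ∈ S)
    (h2 : ∀ i φ n, ∀ u ∈ S, modeOp 𝕂 i (0, φ) n u ∈ S) : S = ⊤ := by
  have key : ∀ f : FreeAlgebra 𝕂 (ModeLabel 𝕂 V), ∀ u ∈ S,
      RingQuot.mkAlgHom 𝕂 (ModeRel 𝕂 V) f • u ∈ S := by
    intro f
    induction f using FreeAlgebra.induction with
    | grade0 r =>
      intro u hu
      rw [AlgHom.commutes, algebraMap_smul]
      exact S.smul_mem r hu
    | grade1 l =>
      intro u hu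
      obtain ⟨i, ⟨v, φ⟩, n⟩ := l
      change modeElt 𝕂 i (v, φ) n • u ∈ S
      have e : ((v, φ) : V × Module.Dual 𝕂 V) = (v, 0) + (0, φ) := by simp
      rw [e, modeElt_add, add_smul]
      exact add_mem (h1 i v n u hu) (h2 i φ n u hu)
    | mul f g hf hg =>
      intro u hu
      rw [map_mul, mul_smul]
      exact hf _ (hg u hu)
    | add f g hf hg =>
      intro u hu
      rw [map_add, add_smul]
      exact add_mem (hf u hu) (hg u hu)
  refine eq_top_iff.mpr fun v _ => ?_
  obtain ⟨u, rfl⟩ := Submodule.Quotient.mk_surjective _ v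
  obtain ⟨f, rfl⟩ := RingQuot.mkAlgHom_surjective 𝕂 (ModeRel 𝕂 V) u
  have := key f _ h0
  rwa [Weil.vacuum, ← Submodule.Quotient.mk_smul, smul_eq_mul, mul_one] at this

/-- Operators which satisfy the relations of the modes define a representation of the algebra of
modes. -/
def modeRep (op : ZMod 2 → ℤ → (V × Module.Dual 𝕂 V) →ₗ[𝕂] Module.End 𝕂 N)
    (hop : ∀ i j x y m n, sbracket i j (op i m x) (op j n y) =
      algebraMap 𝕂 (Module.End 𝕂 N) (if m + n = -1 then labelForm i j x y else 0)) :
    ModeAlg 𝕂 V →ₐ[𝕂] Module.End 𝕂 N :=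
  RingQuot.liftAlgHom 𝕂 ⟨FreeAlgebra.lift 𝕂 fun l => op l.1 l.2.2 l.2.1, by
    intro a b h
    induction h with
    | add i x y n => simp
    | smul i r x n => simp
    | bracket i j x y m n =>
      have := hop i j x y m n
      simpa only [sbracket, map_sub, map_mul, map_zsmul, FreeAlgebra.lift_ι_apply,
        AlgHom.commutes] using this⟩

theorem modeRep_modeElt (op : ZMod 2 → ℤ → (V × Module.Dual 𝕂 V) →ₗ[𝕂] Module.End 𝕂 N)
    (hop : ∀ i j x y m n, sbracket i j (op i m x) (op j n y) =
      algebraMap 𝕂 (Module.End 𝕂 N) (if m + n = -1 then labelForm i j x y else 0))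
    (i : ZMod 2) (x : V × Module.Dual 𝕂 V) (n : ℤ) :
    modeRep op hop (modeElt 𝕂 i x n) = op i n x := by
  rw [modeRep, modeElt, RingQuot.liftAlgHom_mkAlgHom_apply, FreeAlgebra.lift_ι_apply]

/-- The universal property of `Weil` as an induced module. -/
theorem exists_weilLift (op : ZMod 2 → ℤ → (V × Module.Dual 𝕂 V) →ₗ[𝕂] Module.End 𝕂 N)
    (hop : ∀ i j x y m n, sbracket i j (op i m x) (op j n y) =
      algebraMap 𝕂 (Module.End 𝕂 N) (if m + n = -1 then labelForm i j x y else 0))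
    (v₀ : N) (h₀ : ∀ i x n, 0 ≤ n → op i n x v₀ = 0) :
    ∃ τ : Weil 𝕂 V →ₗ[𝕂] N, τ (Weil.vacuum 𝕂 V) = v₀ ∧
      ∀ i x n u, τ (modeOp 𝕂 i x n u) = op i n x (τ u) := by
  let ρ := modeRep op hop
  let f : ModeAlg 𝕂 V →ₛₗ[ρ.toRingHom] N :=
    { toFun := fun u => ρ u v₀
      map_add' := fun u w => by rw [map_add, LinearMap.add_apply]
      map_smul' := fun u w => by
        rw [smul_eq_mul, map_mul]
        rfl }
  have hf : annihilators 𝕂 V ≤ LinearMap.ker f := by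
    refine Submodule.span_le.mpr ?_
    rintro _ ⟨i, x, n, hn, rfl⟩
    change ρ (modeElt 𝕂 i x n) v₀ = 0
    rw [modeRep_modeElt, h₀ i x n hn]
  let g := (annihilators 𝕂 V).liftQ f hf
  have hg : ∀ (a : ModeAlg 𝕂 V) (u : Weil 𝕂 V), g (a • u) = ρ a (g u) := fun a u => by
    rw [map_smulₛₗ]
    rfl
  refine ⟨{ toFun := g, map_add' := map_add g, map_smul' := fun r u => ?_ }, ?_, ?_⟩
  · rw [← algebraMap_smul (ModeAlg 𝕂 V) r u, hg, AlgHom.commutes]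
    rfl
  · change ρ 1 v₀ = v₀
    rw [map_one]
    rfl
  · intro i x n u
    change g (modeElt 𝕂 i x n • u) = _
    rw [hg, modeRep_modeElt]
    rfl

/-! ### The grading of the semi-infinite Weil algebra -/

theorem modeOp_mem_weilGr_b (v : V) (n : ℤ) {u : Weil 𝕂 V} {i : ZMod 2} {p w : ℤ}
    (hu : u ∈ weilGr 𝕂 V (i, p, w)) :
    modeOp 𝕂 1 (v, 0) n u ∈ weilGr 𝕂 V (1 + i, -1 + p, -n + w) := by
  have : weilGr 𝕂 V (i, p, w) ≤
      (weilGr 𝕂 V (1 + i, -1 + p, -n + w)).comap (modeOp 𝕂 1 (v, 0) n) :=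
    Submodule.span_le.mpr fun u hu => Submodule.subset_span (WeilMonomial.b v n u i p w hu)
  exact this hu

theorem modeOp_mem_weilGr_c (φ : Module.Dual 𝕂 V) (n : ℤ) {u : Weil 𝕂 V} {i : ZMod 2} {p w : ℤ}
    (hu : u ∈ weilGr 𝕂 V (i, p, w)) :
    modeOp 𝕂 1 (0, φ) n u ∈ weilGr 𝕂 V (1 + i, 1 + p, -n - 1 + w) := by
  have : weilGr 𝕂 V (i, p, w) ≤
      (weilGr 𝕂 V (1 + i, 1 + p, -n - 1 + w)).comap (modeOp 𝕂 1 (0, φ) n) :=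
    Submodule.span_le.mpr fun u hu => Submodule.subset_span (WeilMonomial.c φ n u i p w hu)
  exact this hu

theorem modeOp_mem_weilGr_beta (v : V) (n : ℤ) {u : Weil 𝕂 V} {i : ZMod 2} {p w : ℤ}
    (hu : u ∈ weilGr 𝕂 V (i, p, w)) :
    modeOp 𝕂 0 (v, 0) n u ∈ weilGr 𝕂 V (i, -2 + p, -n + w) := by
  have : weilGr 𝕂 V (i, p, w) ≤
      (weilGr 𝕂 V (i, -2 + p, -n + w)).comap (modeOp 𝕂 0 (v, 0) n) :=
    Submodule.span_le.mpr fun u hu => Submodule.subset_span (WeilMonomial.beta v n u i p w hu)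
  exact this hu

theorem modeOp_mem_weilGr_gamma (φ : Module.Dual 𝕂 V) (n : ℤ) {u : Weil 𝕂 V} {i : ZMod 2}
    {p w : ℤ} (hu : u ∈ weilGr 𝕂 V (i, p, w)) :
    modeOp 𝕂 0 (0, φ) n u ∈ weilGr 𝕂 V (i, 2 + p, -n - 1 + w) := by
  have : weilGr 𝕂 V (i, p, w) ≤
      (weilGr 𝕂 V (i, 2 + p, -n - 1 + w)).comap (modeOp 𝕂 0 (0, φ) n) :=
    Submodule.span_le.mpr fun u hu => Submodule.subset_span (WeilMonomial.gamma φ n u i p w hu)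
  exact this hu

theorem hasGrade_cField (φ : Module.Dual 𝕂 V) : HasGrade (weilGr 𝕂 V) (cField 𝕂 φ) 1 1 0 := by
  intro n j q m v hv
  convert! modeOp_mem_weilGr_c φ n hv using 4
  ring

theorem hasGrade_gammaField (φ : Module.Dual 𝕂 V) :
    HasGrade (weilGr 𝕂 V) (gammaField 𝕂 φ) 0 2 0 := by
  intro n j q m v hv
  convert! modeOp_mem_weilGr_gamma φ n hv using 4
  · rw [zero_add]
  · ring

theorem iSup_weilGr : ⨆ g, weilGr 𝕂 V g = ⊤ := by
  have key : ∀ f : Module.End 𝕂 (Weil 𝕂 V),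
      (∀ g, ∀ u ∈ weilGr 𝕂 V g, f u ∈ ⨆ g, weilGr 𝕂 V g) →
      ∀ u ∈ ⨆ g, weilGr 𝕂 V g, f u ∈ ⨆ g, weilGr 𝕂 V g := by
    intro f hf u hu
    have : ⨆ g, weilGr 𝕂 V g ≤ (⨆ g, weilGr 𝕂 V g).comap f := iSup_le hf
    exact this hu
  have le : ∀ {g : Grade} {u : Weil 𝕂 V}, u ∈ weilGr 𝕂 V g → u ∈ ⨆ g, weilGr 𝕂 V g :=
    fun {g} {u} hu => le_iSup (weilGr 𝕂 V) g hu
  have two : ∀ i : ZMod 2, i = 0 ∨ i = 1 := by decide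
  refine weil_eq_top (le (Submodule.subset_span WeilMonomial.vacuum)) ?_ ?_
  · intro i v n
    refine key _ ?_
    rintro ⟨j, p, w⟩ u hu
    rcases two i with rfl | rfl
    · exact le (modeOp_mem_weilGr_beta v n hu)
    · exact le (modeOp_mem_weilGr_b v n hu)
  · intro i φ n
    refine key _ ?_
    rintro ⟨j, p, w⟩ u hu
    rcases two i with rfl | rfl
    · exact le (modeOp_mem_weilGr_gamma φ n hu)
    · exact le (modeOp_mem_weilGr_c φ n hu)

variable (𝕂) in
/-- An injective character of the group of grades. -/
def gradeChar (g : Grade) : 𝕂 := (if g.1 = 1 then -1 else 1) * 2 ^ g.2.1 * 3 ^ g.2.2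

theorem gradeChar_add [CharZero 𝕂] (g h : Grade) :
    gradeChar 𝕂 (g + h) = gradeChar 𝕂 g * gradeChar 𝕂 h := by
  obtain ⟨i, p, w⟩ := g
  obtain ⟨j, q, u⟩ := h
  have h1 : (if i + j = 1 then -1 else 1 : 𝕂) =
      (if i = 1 then -1 else 1) * (if j = 1 then -1 else 1) := by
    have h : ∀ i j : ZMod 2, (if i + j = 1 then -1 else 1 : ℤ) =
        (if i = 1 then -1 else 1) * (if j = 1 then -1 else 1) := by decide
    exact_mod_cast congrArg (Int.cast : ℤ → 𝕂) (h i j)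
  simp only [gradeChar, Prod.mk_add_mk, h1, zpow_add₀ (two_ne_zero : (2 : 𝕂) ≠ 0),
    zpow_add₀ (three_ne_zero : (3 : 𝕂) ≠ 0)]
  ring

theorem gradeChar_injective [CharZero 𝕂] : Function.Injective (gradeChar 𝕂) := by
  rintro ⟨i, p, w⟩ ⟨j, q, u⟩ h
  have hij : ∀ i j : ZMod 2, (if i = 1 then -1 else 1 : ℤ) = (if j = 1 then -1 else 1) → i = j := by
    decide
  have hcast : ∀ g, gradeChar 𝕂 g = ((gradeChar ℚ g : ℚ) : 𝕂) := by
    intro g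
    simp only [gradeChar]
    split_ifs <;> push_cast <;> rfl
  rw [hcast, hcast, Rat.cast_inj] at h
  have hsign : ∀ i : ZMod 2, (if i = 1 then -1 else 1 : ℚ) ≠ 0 := by
    intro i
    split_ifs <;> norm_num
  -- The valuations at `2` and `3` recover the degree and the weight.
  have hval : ∀ (r : ℕ) [Fact r.Prime] (i : ZMod 2) (p w : ℤ), padicValRat r (gradeChar ℚ (i, p, w))
      = p * padicValRat r 2 + w * padicValRat r 3 := by
    intro r _ i p w
    have h0 : padicValRat r (if i = 1 then -1 else 1 : ℚ) = 0 := by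
      split_ifs <;> simp
    simp only [gradeChar]
    rw [padicValRat.mul (mul_ne_zero (hsign i) (zpow_ne_zero _ two_ne_zero))
      (zpow_ne_zero _ three_ne_zero), padicValRat.mul (hsign i) (zpow_ne_zero _ two_ne_zero),
      padicValRat.zpow, padicValRat.zpow, h0, zero_add]
  have : Fact (Nat.Prime 2) := ⟨Nat.prime_two⟩
  have : Fact (Nat.Prime 3) := ⟨Nat.prime_three⟩
  have a1 : padicValRat 2 2 = 1 := by exact_mod_cast padicValRat.self (p := 2) (by norm_num)
  have a2 : padicValRat 3 3 = 1 := by exact_mod_cast padicValRat.self (p := 3) (by norm_num)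
  have a3 : padicValRat 2 3 = 0 := by
    have := padicValNat_primes (p := 2) (q := 3) (by norm_num)
    exact_mod_cast this
  have a4 : padicValRat 3 2 = 0 := by
    have := padicValNat_primes (p := 3) (q := 2) (by norm_num)
    exact_mod_cast this
  have hp := congrArg (padicValRat 2) h
  have hw := congrArg (padicValRat 3) h
  rw [hval 2, hval 2, a1, a3] at hp
  rw [hval 3, hval 3, a2, a4] at hw
  obtain rfl : p = q := by omega
  obtain rfl : w = u := by omega
  have hs := mul_right_cancel₀ (zpow_ne_zero _ two_ne_zero)
    (mul_right_cancel₀ (zpow_ne_zero _ three_ne_zero) h)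
  rw [hij i j (by exact_mod_cast hs)]

/-- The semi-infinite Weil algebra is the direct sum of its graded pieces: they are eigenspaces of
the operator which rescales the modes by an injective character of the group of grades. -/
theorem iSupIndep_weilGr [CharZero 𝕂] : iSupIndep (weilGr 𝕂 V) := by
  have hone : gradeChar 𝕂 0 = 1 := by simp [gradeChar]
  -- `α` rescales the modes of `b` and `β`, and `β` those of `c` and `γ`.
  let α : ZMod 2 → ℤ → 𝕂 := fun i n => gradeChar 𝕂 (if i = 1 then (1, -1, -n) else (0, -2, -n))
  let β : ZMod 2 → ℤ → 𝕂 := fun i n =>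
    gradeChar 𝕂 (if i = 1 then (1, 1, -n - 1) else (0, 2, -n - 1))
  have hαβ : ∀ i m n, m + n = -1 → α i m * β i n = 1 := by
    intro i m n hmn
    simp only [α, β, ← gradeChar_add]
    rw [← hone]
    congr 1
    split_ifs
    · exact Prod.ext (show (1 : ZMod 2) + 1 = 0 by decide) (Prod.ext (by simp) (by simp; omega))
    · exact Prod.ext (add_zero (0 : ZMod 2)) (Prod.ext (by simp) (by simp; omega))
  obtain ⟨T, hT0, hT⟩ := exists_weilLift (V := V)
    (fun i n => modeOpHom 𝕂 V i n ∘ₗ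
      LinearMap.prodMap (α i n • LinearMap.id) (β i n • LinearMap.id)) (fun i j x y m n => by
      simp only [LinearMap.comp_apply, modeOpHom_apply, sbracket_modeOp]
      congr 1
      split_ifs with hmn
      · simp only [labelForm]
        split_ifs with hij
        · subst hij
          have h1 := hαβ i m n hmn
          have h2 := hαβ i n m (by omega)
          simp only [LinearMap.prodMap_apply, LinearMap.smul_apply, LinearMap.id_apply, map_smul,
            smul_eq_mul]
          rw [← mul_assoc, ← mul_assoc, h1, h2, one_mul, one_mul]
        · rfl
      · rfl) (Weil.vacuum 𝕂 V) (fun i x n hn => modeOp_vacuum i _ hn)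
  have hle : ∀ g, weilGr 𝕂 V g ≤ Module.End.eigenspace T (gradeChar 𝕂 g) := by
    intro g
    refine Submodule.span_le.mpr fun u hu => ?_
    rw [SetLike.mem_coe, Module.End.mem_eigenspace_iff]
    have step : ∀ (i : ZMod 2) (x : V × Module.Dual 𝕂 V) (n : ℤ) (h : Grade)
        (u : Weil 𝕂 V) (g g' : Grade), T u = gradeChar 𝕂 g • u →
        (α i n • x.1, β i n • x.2) = gradeChar 𝕂 h • x →
        g' = h + g → T (modeOp 𝕂 i x n u) = gradeChar 𝕂 g' • modeOp 𝕂 i x n u := by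
      intro i x n h u g g' hu hx hg
      rw [hT, LinearMap.comp_apply]
      change modeOpHom 𝕂 V i n (α i n • x.1, β i n • x.2) (T u) = _
      rw [hx, map_smul, hu, hg, gradeChar_add, LinearMap.smul_apply,
        map_smul]
      exact (mul_smul (gradeChar 𝕂 h) (gradeChar 𝕂 g) (modeOp 𝕂 i x n u)).symm
    induction hu with
    | vacuum => rw [hT0, ← Prod.zero_eq_mk, ← Prod.zero_eq_mk, hone, one_smul]
    | b v n u i p w _ ih => exact step _ _ _ (1, -1, -n) _ _ _ ih (by simp [α]) rfl
    | c φ n u i p w _ ih => exact step _ _ _ (1, 1, -n - 1) _ _ _ ih (by simp [β]) rfl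
    | beta v n u i p w _ ih =>
      exact step _ _ _ (0, -2, -n) _ _ _ ih (by simp [α]) (by simp)
    | gamma φ n u i p w _ ih =>
      exact step _ _ _ (0, 2, -n - 1) _ _ _ ih (by simp [β]) (by simp)
  exact ((Module.End.eigenspaces_iSupIndep T).comp gradeChar_injective).mono hle

end Rep

/-! ### The Fock space -/

section Fock

variable {𝕂 : Type*} [Field 𝕂] {V : Type*} [AddCommGroup V] [Module 𝕂 V]

theorem labelForm_symm (i : ZMod 2) (x y : V × Module.Dual 𝕂 V) :
    labelForm i i x y = -(koszul i i • labelForm i i y x) := by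
  simp only [labelForm, if_true]
  rcases koszul_eq_or i i with h | h <;> rw [h] <;> simp

variable (𝕂 V) in
/-- The bracket form of labels of parity `i` as a bilinear map. -/
def labelFormHom (i : ZMod 2) :
    (V × Module.Dual 𝕂 V) →ₗ[𝕂] (V × Module.Dual 𝕂 V) →ₗ[𝕂] 𝕂 :=
  LinearMap.mk₂ 𝕂 (labelForm i i)
    (fun x x' y => by
      simp only [labelForm, if_true, Prod.fst_add, Prod.snd_add, map_add, LinearMap.add_apply,
        smul_add]
      abel)
    (fun r x y => by
      simp only [labelForm, if_true, Prod.smul_fst, Prod.smul_snd, map_smul, LinearMap.smul_apply,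
        smul_sub, smul_comm r])
    (fun x y y' => by
      simp only [labelForm, if_true, Prod.fst_add, Prod.snd_add, map_add, LinearMap.add_apply,
        smul_add]
      abel)
    (fun r x y => by
      simp only [labelForm, if_true, Prod.smul_fst, Prod.smul_snd, map_smul, LinearMap.smul_apply,
        smul_sub, smul_comm r])

theorem labelFormHom_apply (i : ZMod 2) (x y : V × Module.Dual 𝕂 V) :
    labelFormHom 𝕂 V i x y = labelForm i i x y := rfl

variable {κ : Type*} (b : Module.Basis κ 𝕂 (V × Module.Dual 𝕂 V))

/-- The pairing of the label `x`, placed at the annihilation mode of index `k`, with the basic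
creation modes. -/
def annCoeff (i : ZMod 2) (k : ℕ) (x : V × Module.Dual 𝕂 V) (s : κ × ℕ) : 𝕂 :=
  if s.2 = k then labelForm i i x (b s.1) else 0

theorem annCoeff_add (i : ZMod 2) (k : ℕ) (x y : V × Module.Dual 𝕂 V) :
    annCoeff b i k (x + y) = annCoeff b i k x + annCoeff b i k y := by
  ext s
  simp only [annCoeff, Pi.add_apply, ← labelFormHom_apply, map_add, LinearMap.add_apply]
  split_ifs <;> simp

theorem annCoeff_smul (i : ZMod 2) (k : ℕ) (r : 𝕂) (x : V × Module.Dual 𝕂 V) :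
    annCoeff b i k (r • x) = r • annCoeff b i k x := by
  ext s
  simp only [annCoeff, Pi.smul_apply, ← labelFormHom_apply, map_smul, LinearMap.smul_apply]
  split_ifs <;> simp

/-- The odd creation variable of label `x` and index `k`. -/
def oddVar (k : ℕ) : (V × Module.Dual 𝕂 V) →ₗ[𝕂] (κ × ℕ →₀ 𝕂) :=
  b.constr 𝕂 fun s => Finsupp.single (s, k) 1

/-- The even creation variable of label `x` and index `k`. -/
def evenVar (k : ℕ) : (V × Module.Dual 𝕂 V) →ₗ[𝕂] MvPolynomial (κ × ℕ) 𝕂 :=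
  b.constr 𝕂 fun s => MvPolynomial.X (s, k)

/-- Contraction with the label `x`, as a functional on the odd variables. -/
def oddAnn (k : ℕ) (x : V × Module.Dual 𝕂 V) : Module.Dual 𝕂 (κ × ℕ →₀ 𝕂) :=
  Finsupp.linearCombination 𝕂 (annCoeff b 1 k x)

/-- Contraction with the label `x`, as a derivation of polynomials in the even variables. -/
def evenAnn (k : ℕ) (x : V × Module.Dual 𝕂 V) :
    Derivation 𝕂 (MvPolynomial (κ × ℕ) 𝕂) (MvPolynomial (κ × ℕ) 𝕂) :=
  MvPolynomial.mkDerivation 𝕂 fun s => MvPolynomial.C (annCoeff b 0 k x s)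

theorem oddAnn_oddVar (k k' : ℕ) (x y : V × Module.Dual 𝕂 V) :
    oddAnn b k x (oddVar b k' y) = if k' = k then labelForm 1 1 x y else 0 := by
  have : oddAnn b k x ∘ₗ oddVar b k' = if k' = k then labelFormHom 𝕂 V 1 x else 0 := by
    refine b.ext fun s => ?_
    simp only [LinearMap.comp_apply, oddVar, Module.Basis.constr_basis, oddAnn,
      Finsupp.linearCombination_single, one_smul, annCoeff]
    split_ifs <;> rfl
  rw [← LinearMap.comp_apply, this]
  split_ifs <;> rfl

theorem evenAnn_evenVar (k k' : ℕ) (x y : V × Module.Dual 𝕂 V) :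
    evenAnn b k x (evenVar b k' y) =
      MvPolynomial.C (if k' = k then labelForm 0 0 x y else 0) := by
  have : (evenAnn b k x).toLinearMap ∘ₗ evenVar b k' =
      Algebra.linearMap 𝕂 _ ∘ₗ (if k' = k then labelFormHom 𝕂 V 0 x else 0) := by
    refine b.ext fun s => ?_
    simp only [LinearMap.comp_apply, evenVar, Module.Basis.constr_basis]
    change MvPolynomial.mkDerivation 𝕂 _ (MvPolynomial.X (s, k')) = _
    rw [MvPolynomial.mkDerivation_X, annCoeff]
    split_ifs <;> rfl
  have h := LinearMap.congr_fun this y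
  refine h.trans ?_
  split_ifs <;> rfl

/-- The modes of the odd fields on the exterior algebra: creation modes are multiplications,
annihilation modes are contractions. -/
def oddOp (n : ℤ) :
    (V × Module.Dual 𝕂 V) →ₗ[𝕂] Module.End 𝕂 (ExteriorAlgebra 𝕂 (κ × ℕ →₀ 𝕂)) :=
  if n < 0 then
    (Algebra.lmul 𝕂 (ExteriorAlgebra 𝕂 (κ × ℕ →₀ 𝕂))).toLinearMap ∘ₗ
      ExteriorAlgebra.ι 𝕂 ∘ₗ oddVar b (-1 - n).toNat
  else
    (CliffordAlgebra.contractLeft (Q := (0 : QuadraticForm 𝕂 (κ × ℕ →₀ 𝕂)))) ∘ₗ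
      { toFun := oddAnn b n.toNat
        map_add' := fun x y => by
          rw [oddAnn, annCoeff_add]
          exact Finsupp.lhom_ext fun s r => by simp [oddAnn, mul_add]
        map_smul' := fun r x => by
          rw [oddAnn, annCoeff_smul]
          exact Finsupp.lhom_ext fun s r' => by simp [oddAnn, mul_left_comm] }

/-- The modes of the even fields on the polynomial algebra: creation modes are multiplications,
annihilation modes are derivations. -/
def evenOp (n : ℤ) :
    (V × Module.Dual 𝕂 V) →ₗ[𝕂] Module.End 𝕂 (MvPolynomial (κ × ℕ) 𝕂) :=
  if n < 0 then
    (Algebra.lmul 𝕂 (MvPolynomial (κ × ℕ) 𝕂)).toLinearMap ∘ₗ evenVar b (-1 - n).toNat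
  else
    { toFun := fun x => (evenAnn b n.toNat x).toLinearMap
      map_add' := fun x y => by
        have : evenAnn b n.toNat (x + y) = evenAnn b n.toNat x + evenAnn b n.toNat y :=
          MvPolynomial.derivation_ext fun s => by
            simp [evenAnn, annCoeff_add, MvPolynomial.mkDerivation_X]
        rw [this]
        rfl
      map_smul' := fun r x => by
        have : evenAnn b n.toNat (r • x) = r • evenAnn b n.toNat x :=
          MvPolynomial.derivation_ext fun s => by
            simp [evenAnn, annCoeff_smul, MvPolynomial.mkDerivation_X, MvPolynomial.smul_eq_C_mul]
        rw [this]
        rfl }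

theorem oddOp_neg {n : ℤ} (hn : n < 0) (x : V × Module.Dual 𝕂 V)
    (u : ExteriorAlgebra 𝕂 (κ × ℕ →₀ 𝕂)) :
    oddOp b n x u = ExteriorAlgebra.ι 𝕂 (oddVar b (-1 - n).toNat x) * u := by
  rw [oddOp, if_pos hn]
  rfl

theorem oddOp_nonneg {n : ℤ} (hn : 0 ≤ n) (x : V × Module.Dual 𝕂 V)
    (u : ExteriorAlgebra 𝕂 (κ × ℕ →₀ 𝕂)) :
    oddOp b n x u = CliffordAlgebra.contractLeft (oddAnn b n.toNat x) u := by
  rw [oddOp, if_neg (by omega)]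
  rfl

theorem evenOp_neg {n : ℤ} (hn : n < 0) (x : V × Module.Dual 𝕂 V)
    (u : MvPolynomial (κ × ℕ) 𝕂) :
    evenOp b n x u = evenVar b (-1 - n).toNat x * u := by
  rw [evenOp, if_pos hn]
  rfl

theorem evenOp_nonneg {n : ℤ} (hn : 0 ≤ n) (x : V × Module.Dual 𝕂 V)
    (u : MvPolynomial (κ × ℕ) 𝕂) :
    evenOp b n x u = evenAnn b n.toNat x u := by
  rw [evenOp, if_neg (by omega)]
  rfl

theorem sbracket_oddOp (x y : V × Module.Dual 𝕂 V) (m n : ℤ) :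
    sbracket 1 1 (oddOp b m x) (oddOp b n y) =
      algebraMap 𝕂 _ (if m + n = -1 then labelForm 1 1 x y else 0) := by
  have mixed : ∀ (x y : V × Module.Dual 𝕂 V) (m n : ℤ), 0 ≤ m → n < 0 → ∀ u,
      oddOp b m x (oddOp b n y u) + oddOp b n y (oddOp b m x u) =
        (if m + n = -1 then labelForm 1 1 x y else 0) • u := by
    intro x y m n hm hn u
    rw [oddOp_nonneg b hm, oddOp_nonneg b hm, oddOp_neg b hn, oddOp_neg b hn]
    change CliffordAlgebra.contractLeft _ (CliffordAlgebra.ι _ _ * u) + _ = _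
    rw [CliffordAlgebra.contractLeft_ι_mul, oddAnn_oddVar]
    have : ((-1 - n).toNat = m.toNat) = (m + n = -1) := by
      rw [eq_iff_iff]; omega
    simp only [this]
    exact sub_add_cancel _ _
  refine LinearMap.ext fun u => ?_
  rw [sbracket, koszul_one_one, neg_smul, one_smul, sub_neg_eq_add, Module.algebraMap_end_apply]
  change oddOp b m x (oddOp b n y u) + oddOp b n y (oddOp b m x u) = _
  rcases lt_or_ge m 0 with hm | hm <;> rcases lt_or_ge n 0 with hn | hn
  · rw [if_neg (by omega), zero_smul, oddOp_neg b hm, oddOp_neg b hm, oddOp_neg b hn,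
      oddOp_neg b hn, ← mul_assoc, ← mul_assoc, ← add_mul, ExteriorAlgebra.ι_add_mul_swap, zero_mul]
  · rw [add_comm, mixed y x n m hn hm, add_comm n m, labelForm_symm 1 x y]
    simp
  · exact mixed x y m n hm hn u
  · rw [if_neg (by omega), zero_smul, oddOp_nonneg b hm, oddOp_nonneg b hm, oddOp_nonneg b hn,
      oddOp_nonneg b hn, CliffordAlgebra.contractLeft_comm]
    exact neg_add_cancel _

theorem sbracket_evenOp (x y : V × Module.Dual 𝕂 V) (m n : ℤ) :
    sbracket 0 0 (evenOp b m x) (evenOp b n y) =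
      algebraMap 𝕂 _ (if m + n = -1 then labelForm 0 0 x y else 0) := by
  have mixed : ∀ (x y : V × Module.Dual 𝕂 V) (m n : ℤ), 0 ≤ m → n < 0 → ∀ u,
      evenOp b m x (evenOp b n y u) - evenOp b n y (evenOp b m x u) =
        (if m + n = -1 then labelForm 0 0 x y else 0) • u := by
    intro x y m n hm hn u
    rw [evenOp_nonneg b hm, evenOp_nonneg b hm, evenOp_neg b hn, evenOp_neg b hn,
      Derivation.leibniz, evenAnn_evenVar]
    have : ((-1 - n).toNat = m.toNat) = (m + n = -1) := by
      rw [eq_iff_iff]; omega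
    simp only [this, smul_eq_mul, add_sub_cancel_left, MvPolynomial.smul_eq_C_mul]
    ring
  refine LinearMap.ext fun u => ?_
  rw [sbracket, koszul_zero_left, one_smul, Module.algebraMap_end_apply]
  change evenOp b m x (evenOp b n y u) - evenOp b n y (evenOp b m x u) = _
  rcases lt_or_ge m 0 with hm | hm <;> rcases lt_or_ge n 0 with hn | hn
  · rw [if_neg (by omega), zero_smul, evenOp_neg b hm, evenOp_neg b hm, evenOp_neg b hn,
      evenOp_neg b hn]
    ring
  · rw [← neg_sub, mixed y x n m hn hm, add_comm n m, labelForm_symm 0 x y]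
    split_ifs <;> simp
  · exact mixed x y m n hm hn u
  · rw [if_neg (by omega), zero_smul, evenOp_nonneg b hm, evenOp_nonneg b hm, evenOp_nonneg b hn,
      evenOp_nonneg b hn]
    have : ⁅evenAnn b m.toNat x, evenAnn b n.toNat y⁆ = 0 :=
      MvPolynomial.derivation_ext fun s => by
        rw [Derivation.commutator_apply, evenAnn, evenAnn, MvPolynomial.mkDerivation_X,
          MvPolynomial.mkDerivation_X, MvPolynomial.derivation_C, MvPolynomial.derivation_C,
          sub_zero]
        rfl
    have h := congrArg (fun D => D u) this
    rwa [Derivation.commutator_apply] at h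

variable (κ 𝕂) in
/-- The Fock space of the `bc`- and `βγ`-systems: polynomials in the odd and even creation
variables. -/
abbrev Fock : Type _ :=
  ExteriorAlgebra 𝕂 (κ × ℕ →₀ 𝕂) ⊗[𝕂] MvPolynomial (κ × ℕ) 𝕂

/-- The modes on the Fock space. -/
def fockOp (i : ZMod 2) (n : ℤ) :
    (V × Module.Dual 𝕂 V) →ₗ[𝕂] Module.End 𝕂 (Fock 𝕂 κ) :=
  if i = 1 then (Module.End.rTensorAlgHom 𝕂 _ _).toLinearMap ∘ₗ oddOp b n
  else (Module.End.lTensorAlgHom 𝕂 _ _).toLinearMap ∘ₗ evenOp b n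

/-- The Fock space is a representation of the modes. Odd and even modes commute because they act on
different factors of the tensor product. -/
theorem sbracket_fockOp (i j : ZMod 2) (x y : V × Module.Dual 𝕂 V) (m n : ℤ) :
    sbracket i j (fockOp b i m x) (fockOp b j n y) =
      algebraMap 𝕂 _ (if m + n = -1 then labelForm i j x y else 0) := by
  have two : ∀ i : ZMod 2, i = 0 ∨ i = 1 := by decide
  have h01 : (0 : ZMod 2) ≠ 1 := by decide
  have comm : ∀ f g, Module.End.lTensorAlgHom 𝕂 (MvPolynomial (κ × ℕ) 𝕂)
      (ExteriorAlgebra 𝕂 (κ × ℕ →₀ 𝕂)) f * Module.End.rTensorAlgHom 𝕂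
      (ExteriorAlgebra 𝕂 (κ × ℕ →₀ 𝕂)) (MvPolynomial (κ × ℕ) 𝕂) g =
      Module.End.rTensorAlgHom 𝕂 _ _ g * Module.End.lTensorAlgHom 𝕂 _ _ f := fun f g =>
    (LinearMap.lTensor_comp_rTensor _ _ _).trans (LinearMap.rTensor_comp_lTensor _ _ _).symm
  rcases two i with rfl | rfl <;> rcases two j with rfl | rfl
  · simp only [fockOp, if_neg h01, LinearMap.comp_apply, AlgHom.toLinearMap_apply]
    rw [← AlgHom.commutes (Module.End.lTensorAlgHom 𝕂 _ _), ← sbracket_evenOp b]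
    simp only [sbracket, map_sub, map_mul, map_zsmul]
  · simp only [fockOp, if_neg h01, if_true, LinearMap.comp_apply, AlgHom.toLinearMap_apply]
    simp [sbracket, labelForm, comm]
  · simp only [fockOp, if_neg h01, if_true, LinearMap.comp_apply, AlgHom.toLinearMap_apply]
    simp [sbracket, labelForm, comm]
  · simp only [fockOp, if_true, LinearMap.comp_apply, AlgHom.toLinearMap_apply]
    rw [← AlgHom.commutes (Module.End.rTensorAlgHom 𝕂 _ _), ← sbracket_oddOp b]
    simp only [sbracket, map_sub, map_mul, map_zsmul]

theorem fockOp_one {n : ℤ} (hn : 0 ≤ n) (i : ZMod 2) (x : V × Module.Dual 𝕂 V) :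
    fockOp b i n x 1 = 0 := by
  rw [fockOp]
  split_ifs
  · change LinearMap.rTensor _ (oddOp b n x) (1 ⊗ₜ 1) = 0
    rw [LinearMap.rTensor_tmul, oddOp_nonneg b hn, CliffordAlgebra.contractLeft_one,
      TensorProduct.zero_tmul]
  · change LinearMap.lTensor _ (evenOp b n x) (1 ⊗ₜ 1) = 0
    rw [LinearMap.lTensor_tmul, evenOp_nonneg b hn, Derivation.map_one_eq_zero,
      TensorProduct.tmul_zero]

/-- The creation variables in the Fock space. -/
def fockVar (i : ZMod 2) (k : ℕ) (x : V × Module.Dual 𝕂 V) : Fock 𝕂 κ :=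
  if i = 1 then ExteriorAlgebra.ι 𝕂 (oddVar b k x) ⊗ₜ 1 else 1 ⊗ₜ evenVar b k x

theorem fockOp_create (i : ZMod 2) (k : ℕ) (x : V × Module.Dual 𝕂 V) (u : Fock 𝕂 κ) :
    fockOp b i (-1 - k) x u = fockVar b i k x * u := by
  have hk : (-1 - (k : ℤ)) < 0 := by omega
  have hk' : (-1 - (-1 - (k : ℤ))).toNat = k := by omega
  rw [fockOp, fockVar]
  split_ifs
  · change LinearMap.rTensor _ (oddOp b (-1 - k) x) u = _
    induction u using TensorProduct.induction_on with
    | zero => simp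
    | tmul p q =>
      rw [LinearMap.rTensor_tmul, oddOp_neg b hk, hk', Algebra.TensorProduct.tmul_mul_tmul, one_mul]
    | add p q hp hq => rw [map_add, mul_add, hp, hq]
  · change LinearMap.lTensor _ (evenOp b (-1 - k) x) u = _
    induction u using TensorProduct.induction_on with
    | zero => simp
    | tmul p q =>
      rw [LinearMap.lTensor_tmul, evenOp_neg b hk, hk', Algebra.TensorProduct.tmul_mul_tmul,
        one_mul]
    | add p q hp hq => rw [map_add, mul_add, hp, hq]

end Fock

/-! ### Evaluation of supercommutative polynomials -/

section Evaluation

variable {𝕂 : Type*} [Field 𝕂] {R : Type*} [Ring R] [Algebra 𝕂 R]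

/-- Commuting elements of a noncommutative algebra can be substituted for the variables of a
polynomial, since they generate a commutative subalgebra. -/
theorem exists_polynomial_eval {σ : Type*} (θ : σ → R) (hθ : ∀ s t, Commute (θ s) (θ t)) :
    ∃ g : MvPolynomial σ 𝕂 →ₐ[𝕂] R, ∀ s, g (MvPolynomial.X s) = θ s := by
  have hcomm : ∀ a ∈ Set.range θ, ∀ b ∈ Set.range θ, a * b = b * a := by
    rintro _ ⟨s, rfl⟩ _ ⟨t, rfl⟩
    exact hθ s t
  have hadj := Algebra.isMulCommutative_adjoin 𝕂 hcomm
  let : CommRing (Algebra.adjoin 𝕂 (Set.range θ)) :=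
    { (Algebra.adjoin 𝕂 (Set.range θ)).toRing with mul_comm := hadj.is_comm.comm }
  exact ⟨(Algebra.adjoin 𝕂 (Set.range θ)).val.comp (MvPolynomial.aeval fun s =>
    (⟨θ s, Algebra.subset_adjoin ⟨s, rfl⟩⟩ : Algebra.adjoin 𝕂 (Set.range θ))), fun s => by simp⟩

theorem exists_exterior_eval [CharZero 𝕂] {σ : Type*} (θ : σ → R)
    (hθ : ∀ s t, θ s * θ t = -(θ t * θ s)) :
    ∃ f : ExteriorAlgebra 𝕂 (σ →₀ 𝕂) →ₐ[𝕂] R,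
      ∀ m, f (ExteriorAlgebra.ι 𝕂 m) = Finsupp.linearCombination 𝕂 θ m := by
  have h1 : ∀ s m, θ s * Finsupp.linearCombination 𝕂 θ m =
      -(Finsupp.linearCombination 𝕂 θ m * θ s) := by
    intro s m
    induction m using Finsupp.induction_linear with
    | zero => simp
    | add m m' hm hm' => rw [map_add, mul_add, add_mul, hm, hm', neg_add]
    | single t r => simp [hθ s t]
  have h2 : ∀ m m', Finsupp.linearCombination 𝕂 θ m * Finsupp.linearCombination 𝕂 θ m' =
      -(Finsupp.linearCombination 𝕂 θ m' * Finsupp.linearCombination 𝕂 θ m) := by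
    intro m m'
    induction m using Finsupp.induction_linear with
    | zero => simp
    | add m n hm hn => rw [map_add, mul_add, add_mul, hm, hn, neg_add]
    | single t r => simp [h1 t m']
  refine ⟨ExteriorAlgebra.lift 𝕂 ⟨Finsupp.linearCombination 𝕂 θ, fun m => ?_⟩, fun m => by
    rw [ExteriorAlgebra.lift_ι_apply]⟩
  -- Anticommutation gives `m ^ 2 = 0` because `2` is invertible.
  have h := eq_neg_iff_add_eq_zero.mp (h2 m m)
  rw [← two_smul 𝕂] at h
  exact (smul_eq_zero.mp h).resolve_left two_ne_zero

theorem exists_fock_eval [CharZero 𝕂] {κ : Type*} (θ : ZMod 2 → κ × ℕ → R)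
    (hθ : ∀ i j s t, θ i s * θ j t = koszul i j • (θ j t * θ i s)) :
    ∃ Ω : Fock 𝕂 κ →ₐ[𝕂] R,
      (∀ s, Ω (ExteriorAlgebra.ι 𝕂 (Finsupp.single s 1) ⊗ₜ 1) = θ 1 s) ∧
      ∀ s, Ω (1 ⊗ₜ MvPolynomial.X s) = θ 0 s := by
  obtain ⟨f, hf⟩ := exists_exterior_eval (𝕂 := 𝕂) (θ 1) fun s t => by
    rw [hθ]; simp
  obtain ⟨g, hg⟩ := exists_polynomial_eval (𝕂 := 𝕂) (θ 0) fun s t => by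
    rw [Commute, SemiconjBy, hθ]; simp
  have comm1 : ∀ s q, Commute (θ 1 s) (g q) := by
    intro s q
    induction q using MvPolynomial.induction_on with
    | C a =>
      rw [← MvPolynomial.algebraMap_eq, AlgHom.commutes]
      exact (Algebra.commutes _ _).symm
    | add p q hp hq => rw [map_add]; exact hp.add_right hq
    | mul_X p t hp =>
      rw [map_mul, hg]
      refine hp.mul_right ?_
      rw [Commute, SemiconjBy, hθ]
      simp
  have comm : ∀ p q, Commute (f p) (g q) := by
    intro p q
    induction p using ExteriorAlgebra.induction with
    | algebraMap r => rw [AlgHom.commutes]; exact Algebra.commutes _ _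
    | ι m =>
      rw [hf, Finsupp.linearCombination_apply]
      exact Commute.sum_left _ _ _ fun s _ => (comm1 s q).smul_left _
    | mul a b ha hb => rw [map_mul]; exact ha.mul_left hb
    | add a b ha hb => rw [map_add]; exact ha.add_left hb
  refine ⟨Algebra.TensorProduct.lift f g comm, fun s => ?_, fun s => ?_⟩
  · rw [Algebra.TensorProduct.lift_tmul, hf, map_one, mul_one, Finsupp.linearCombination_single,
      one_smul]
  · rw [Algebra.TensorProduct.lift_tmul, hg, map_one, one_mul]

variable {V : Type*} [AddCommGroup V] [Module 𝕂 V] {ι : Type*} [Fintype ι] [DecidableEq ι]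

/-- The vector obtained from the vacuum by applying the creation modes of the letters
`((i, j), k)` of a word; the letter is `c^{e_j^*}_(-1-k)` for `i = 1` and `γ^{e_j^*}_(-1-k)` for
`i = 0`. -/
def creationWord (e : Module.Basis ι 𝕂 V) : List ((ZMod 2 × ι) × ℕ) → Weil 𝕂 V
  | [] => Weil.vacuum 𝕂 V
  | x :: w => modeOp 𝕂 x.1.1 (0, e.coord x.1.2) (-1 - x.2) (creationWord e w)

/-- The creation modes of `c` and `γ` applied to the vacuum of the Weil algebra generate a free
supercommutative algebra: supercommuting elements can be substituted for them. -/
theorem exists_creationWord_eval [CharZero 𝕂] (e : Module.Basis ι 𝕂 V)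
    (θ : ZMod 2 × ι → ℕ → R)
    (hθ : ∀ x y k l, θ x k * θ y l = koszul x.1 y.1 • (θ y l * θ x k)) :
    ∃ ε : Weil 𝕂 V →ₗ[𝕂] R,
      ∀ w, ε (creationWord e w) = (w.map fun x => θ x.1 x.2).prod := by
  let b := e.prod e.dualBasis
  have hb : ∀ j, ((0, e.coord j) : V × Module.Dual 𝕂 V) = b (Sum.inr j) := by
    intro j
    simp [b]
  obtain ⟨τ, hτ0, hτ⟩ := exists_weilLift (V := V) (fockOp b) (sbracket_fockOp b) 1
    fun i x n hn => fockOp_one b hn i x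
  -- The creation variables of `b` and `β` are evaluated at `0`.
  let θ' : ZMod 2 → (ι ⊕ ι) × ℕ → R := fun i s => Sum.elim (fun _ => 0) (fun j => θ (i, j) s.2) s.1
  obtain ⟨Ω, hΩ1, hΩ0⟩ := exists_fock_eval (𝕂 := 𝕂) θ' (by
    rintro i j ⟨s | s, k⟩ ⟨t | t, l⟩
    · simp [θ']
    · simp [θ']
    · simp [θ']
    · exact hθ (i, s) (j, t) k l)
  refine ⟨Ω.toLinearMap ∘ₗ τ, fun w => ?_⟩
  induction w with
  | nil => simp [creationWord, hτ0]
  | cons x w ih =>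
    obtain ⟨⟨i, j⟩, k⟩ := x
    rw [LinearMap.comp_apply, AlgHom.toLinearMap_apply] at ih ⊢
    rw [creationWord, hτ, fockOp_create, map_mul, ih, List.map_cons, List.prod_cons]
    congr 1
    have two : ∀ i : ZMod 2, i = 0 ∨ i = 1 := by decide
    rcases two i with rfl | rfl
    · rw [fockVar, if_neg (by decide : ¬ (0 : ZMod 2) = 1), hb, evenVar,
        Module.Basis.constr_basis, hΩ0]
      rfl
    · rw [fockVar, if_pos rfl, hb, oddVar, Module.Basis.constr_basis, hΩ1]
      rfl

end Evaluation

/-! ### Shifted fields -/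

section Shift

variable {𝕂 : Type*} [Field 𝕂] {A : Type*} [AddCommGroup A] [Module 𝕂 A]

/-- The field `z ^ n a(z)`. -/
def Fld.shift (n : ℤ) (a : Fld 𝕂 A) : Fld 𝕂 A :=
  ⟨fun k => a.coeff (k + n), fun v => by
    obtain ⟨N, hN⟩ := a.2 v
    exact ⟨N - n, fun k hk => hN _ (by omega)⟩⟩

@[simp] theorem Fld.shift_coeff (n k : ℤ) (a : Fld 𝕂 A) :
    (a.shift n).coeff k = a.coeff (k + n) := rfl

theorem nProd_shift_right (i j : ZMod 2) (m n : ℤ) (a b : Fld 𝕂 A) :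
    nProd i j m a (b.shift n) = (nProd i j m a b).shift n := by
  refine Fld.ext fun k v => ?_
  rw [Fld.shift_coeff, nProd_coeff, nProd_coeff]
  refine finsum_congr fun l => ?_
  simp only [nProdTerm, Fld.shift_coeff]
  rw [show k + l + n = k + n + l by ring, show m + k - l + n = m + (k + n) - l by ring]

theorem nProd_vac_right (i : ZMod 2) (a : Fld 𝕂 A) :
    nProd i 0 (-1) a (Fld.vac 𝕂 A) = a := by
  refine Fld.ext fun k v => ?_
  rw [nProd_coeff]
  have h : ∀ l, nProdTerm i 0 (-1) a (Fld.vac 𝕂 A) k v l =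
      (if k + l = -1 then a.coeff k v else 0) + if k = l then a.coeff k v else 0 := by
    intro l
    have hc := IsRestr.neg_one_pow_mul_choose 0 l
    rw [Nat.cast_zero, sub_zero, add_zero, Nat.choose_zero_right, Nat.cast_one] at hc
    rw [nProdTerm, hc, Fld.coeff_vac, Fld.coeff_vac]
    rw [one_smul]
    by_cases h1 : k + l = -1
    · rw [if_pos h1, if_neg (by omega), if_pos h1, if_neg (by omega)]
      rw [show (-1 - (l : ℤ)) = k by omega]
      simp
    · by_cases h2 : k = l
      · rw [if_neg h1, if_pos (by omega), if_neg h1, if_pos h2, h2]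
        simp
      · rw [if_neg h1, if_neg (by omega), if_neg h1, if_neg h2]
        simp
  rw [finsum_congr h]
  rcases le_or_gt 0 k with hk | hk
  · rw [finsum_eq_single _ k.toNat]
    · rw [if_neg (by omega), if_pos (by omega), zero_add]
    · intro l hl
      rw [if_neg (by omega), if_neg (by omega), zero_add]
  · rw [finsum_eq_single _ (-1 - k).toNat]
    · rw [if_pos (by omega), if_neg (by omega), add_zero]
    · intro l hl
      rw [if_neg (by omega), if_neg (by omega), zero_add]

theorem nProd_shift_vac_right (i : ZMod 2) (n : ℤ) (a : Fld 𝕂 A) :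
    nProd i 0 (-1) a ((Fld.vac 𝕂 A).shift n) = a.shift n := by
  rw [nProd_shift_right, nProd_vac_right]

theorem nProd_shift_vac_left (j : ZMod 2) (n : ℤ) (a : Fld 𝕂 A) :
    nProd 0 j (-1) ((Fld.vac 𝕂 A).shift n) a = a.shift n := by
  refine Fld.ext fun k v => ?_
  rw [nProd_coeff, Fld.shift_coeff]
  have h : ∀ l, nProdTerm 0 j (-1) ((Fld.vac 𝕂 A).shift n) a k v l =
      (if n = l then a.coeff (k + n) v else 0) + if l + n = -1 then a.coeff (k + n) v else 0 := by
    intro l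
    have hc := IsRestr.neg_one_pow_mul_choose 0 l
    rw [Nat.cast_zero, sub_zero, add_zero, Nat.choose_zero_right, Nat.cast_one] at hc
    rw [nProdTerm, hc, Fld.shift_coeff, Fld.shift_coeff, Fld.coeff_vac, Fld.coeff_vac]
    by_cases h1 : n = l
    · rw [if_pos (by omega), if_neg (by omega), if_pos h1, if_neg (by omega), h1]
      simp
    · by_cases h2 : l + n = -1
      · rw [if_neg (by omega), if_pos h2, if_neg h1, if_pos h2,
          show -1 + k - (l : ℤ) = k + n by omega]
        simp
      · rw [if_neg (by omega), if_neg h2, if_neg h1, if_neg h2]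
        simp
  rw [finsum_congr h]
  rcases le_or_gt 0 n with hn | hn
  · rw [finsum_eq_single _ n.toNat]
    · rw [if_pos (by omega), if_neg (by omega), add_zero]
    · intro l hl
      rw [if_neg (by omega), if_neg (by omega), zero_add]
  · rw [finsum_eq_single _ (-1 - n).toNat]
    · rw [if_neg (by omega), if_pos (by omega), zero_add]
    · intro l hl
      rw [if_neg (by omega), if_neg (by omega), zero_add]

end Shift

/-! ### Modules over vertex superalgebras of fields -/

section VertexModule

variable {𝕂 : Type*} [Field 𝕂] {A : Type*} [AddCommGroup A] [Module 𝕂 A]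
  {F : Type*} [AddCommGroup F] [Module 𝕂 F] {grF : Grade → Submodule 𝕂 F}
  {grA : Grade → Submodule 𝕂 A}

/-- The Borcherds identity with `m = 0`. -/
theorem IsVertexModule.map_nProd {V : Submodule 𝕂 (Fld 𝕂 F)} {hV : IsFieldAlgebra grF V}
    {Y : V →ₗ[𝕂] Fld 𝕂 A} (hY : IsVertexModule grF hV grA Y) {i j : ZMod 2} (n : ℤ) (a b : V)
    (hi : HasParity grF a.1 i) (hj : HasParity grF b.1 j) :
    Y ⟨nProd i j n a.1 b.1, hV.nProd_mem i j n a.1 b.1 a.2 b.2 hi hj⟩ =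
      nProd i j n (Y a) (Y b) := by
  refine Fld.ext fun k v => ?_
  have h := hY.borcherds i j a b hi hj 0 n k v
  rw [finsum_eq_single _ 0] at h
  · simp only [Nat.cast_zero, add_zero, zero_add, sub_zero, Ring.choose_zero_right,
      one_smul] at h
    rw [h, nProd_coeff]
    rfl
  · intro l hl
    obtain ⟨l, rfl⟩ := Nat.exists_eq_succ_of_ne_zero hl
    rw [Ring.choose_zero_succ, zero_smul]

/-- A module structure is determined by the action of a generating set of fields. -/
theorem IsVertexModule.ext_of_generators {S : Set (Fld 𝕂 F)}
    {Y Y' : generatedBy grF S →ₗ[𝕂] Fld 𝕂 A}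
    (hY : IsVertexModule grF (generatedBy_isFieldAlgebra grF S) grA Y)
    (hY' : IsVertexModule grF (generatedBy_isFieldAlgebra grF S) grA Y')
    (h : ∀ a (ha : a ∈ S), Y ⟨a, subset_generatedBy grF S ha⟩ =
      Y' ⟨a, subset_generatedBy grF S ha⟩) : Y = Y' := by
  let E : Submodule 𝕂 (Fld 𝕂 F) := (LinearMap.eqLocus Y Y').map (generatedBy grF S).subtype
  have hE : ∀ a : generatedBy grF S, a.1 ∈ E ↔ Y a = Y' a := by
    intro a
    constructor
    · rintro ⟨b, hb, hab⟩
      rw [← Subtype.ext hab]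
      exact hb
    · exact fun ha => ⟨a, ha, rfl⟩
  have hle : generatedBy grF S ≤ E := by
    refine sInf_le ⟨⟨?_, ?_⟩, fun a ha => (hE ⟨a, subset_generatedBy grF S ha⟩).mpr (h a ha)⟩
    · exact (hE ⟨_, (generatedBy_isFieldAlgebra grF S).vac_mem⟩).mpr
        (hY.map_vac.trans hY'.map_vac.symm)
    · rintro i j n _ _ ⟨a, ha, rfl⟩ ⟨b, hb, rfl⟩ hi hj
      refine (hE ⟨_, (generatedBy_isFieldAlgebra grF S).nProd_mem i j n a.1 b.1 a.2 b.2 hi hj⟩).mpr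
        ?_
      rw [hY.map_nProd n a b hi hj, hY'.map_nProd n a b hi hj]
      rw [show Y a = Y' a from ha, show Y b = Y' b from hb]
  exact LinearMap.ext fun a => (hE a).mp (hle a.2)

end VertexModule

/-! ### Homogeneous components of fields on the Weil algebra -/

section Components

variable {𝕂 : Type*} [Field 𝕂] [CharZero 𝕂] {V : Type*} [AddCommGroup V] [Module 𝕂 V]

/-- A homogeneous component of a finite sum of homogeneous fields vanishes, if the sum has no
component of its grade. -/
theorem component_eq_zero (f : Grade →₀ Fld 𝕂 (Weil 𝕂 V))
    (hf : ∀ g : Grade, HasGrade (weilGr 𝕂 V) (f g) g.1 g.2.1 g.2.2) (g₁ : Grade)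
    (h : ∀ (n : ℤ) (j : ZMod 2) (q m : ℤ), ∀ v ∈ weilGr 𝕂 V (j, q, m),
      (f.sum fun _ x => x).coeff n v ∈
        ⨆ g ≠ (g₁.1 + j, g₁.2.1 + q, g₁.2.2 + m - n - 1), weilGr 𝕂 V g) : f g₁ = 0 := by
  classical
  refine Fld.ext fun n v => ?_
  have hker : ⨆ g, weilGr 𝕂 V g ≤ LinearMap.ker ((f g₁).coeff n) := by
    refine iSup_le ?_
    rintro ⟨j, q, m⟩ v hv
    rw [LinearMap.mem_ker]
    refine Submodule.disjoint_def.mp (iSupIndep_weilGr (𝕂 := 𝕂) (V := V)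
      (g₁.1 + j, g₁.2.1 + q, g₁.2.2 + m - n - 1)) _ (hf g₁ n j q m v hv) ?_
    have hs : (f g₁).coeff n v =
        (f.sum fun _ x => x).coeff n v - ∑ g ∈ f.support.erase g₁, (f g).coeff n v := by
      rw [eq_sub_iff_add_eq, Finsupp.sum, Fld.coeff_sum, LinearMap.sum_apply]
      by_cases hg : g₁ ∈ f.support
      · exact Finset.add_sum_erase f.support (fun g => (f g).coeff n v) hg
      · rw [Finset.erase_eq_of_notMem hg, Finsupp.notMem_support_iff.mp hg]
        exact zero_add _
    rw [hs]
    refine sub_mem (h n j q m v hv) (sum_mem fun g hg => ?_)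
    have hne : (g.1 + j, g.2.1 + q, g.2.2 + m - n - 1) ≠
        (g₁.1 + j, g₁.2.1 + q, g₁.2.2 + m - n - 1) := by
      intro he
      refine (Finset.mem_erase.mp hg).1 ?_
      simp only [Prod.mk.injEq, add_left_inj] at he
      exact Prod.ext he.1 (Prod.ext he.2.1 (by omega))
    exact Submodule.mem_iSup_of_mem _ (Submodule.mem_iSup_of_mem hne (hf g n j q m v hv))
  have : v ∈ ⨆ g, weilGr 𝕂 V g := iSup_weilGr (𝕂 := 𝕂) (V := V) ▸ Submodule.mem_top
  exact LinearMap.mem_ker.mp (hker this)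

theorem component_eq_zero_of_hasGrade (f : Grade →₀ Fld 𝕂 (Weil 𝕂 V))
    (hf : ∀ g : Grade, HasGrade (weilGr 𝕂 V) (f g) g.1 g.2.1 g.2.2) {g₀ g₁ : Grade} (hg : g₁ ≠ g₀)
    (h : HasGrade (weilGr 𝕂 V) (f.sum fun _ x => x) g₀.1 g₀.2.1 g₀.2.2) : f g₁ = 0 := by
  refine component_eq_zero f hf g₁ fun n j q m v hv => ?_
  refine Submodule.mem_iSup_of_mem _ (Submodule.mem_iSup_of_mem (fun he => hg ?_) (h n j q m v hv))
  simp only [Prod.mk.injEq, add_left_inj] at he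
  exact Prod.ext he.1.symm (Prod.ext he.2.1.symm (by omega))

theorem component_eq_zero_of_hasParity (f : Grade →₀ Fld 𝕂 (Weil 𝕂 V))
    (hf : ∀ g : Grade, HasGrade (weilGr 𝕂 V) (f g) g.1 g.2.1 g.2.2) {i : ZMod 2} {g₁ : Grade}
    (hg : g₁.1 ≠ i) (h : HasParity (weilGr 𝕂 V) (f.sum fun _ x => x) i) : f g₁ = 0 := by
  refine component_eq_zero f hf g₁ fun n j q m v hv => ?_
  have hv' : v ∈ parityPart (weilGr 𝕂 V) j :=
    Submodule.mem_iSup_of_mem q (Submodule.mem_iSup_of_mem m hv)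
  have hle : parityPart (weilGr 𝕂 V) (i + j) ≤
      ⨆ g ≠ (g₁.1 + j, g₁.2.1 + q, g₁.2.2 + m - n - 1), weilGr 𝕂 V g := by
    refine iSup_le fun p => iSup_le fun w => ?_
    refine le_iSup₂_of_le (f := fun g (_ : g ≠ (g₁.1 + j, g₁.2.1 + q, g₁.2.2 + m - n - 1)) =>
      weilGr 𝕂 V g) (i + j, p, w) (fun he => hg ?_) le_rfl
    simp only [Prod.mk.injEq, add_left_inj] at he
    exact he.1.symm
  exact hle (h n j v hv')

end Components

/-! ### The fields `c` and `γ` of the Weil algebra -/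

section WeilSide

variable {𝕂 : Type*} [Field 𝕂] {V : Type*} [AddCommGroup V] [Module 𝕂 V]

theorem adField_modeField (r i : ZMod 2) (n : ℤ) (x y : V × Module.Dual 𝕂 V) :
    adField (modeOp 𝕂 r x n) r i (modeField 𝕂 i y) =
      labelForm r i x y • (Fld.vac 𝕂 (Weil 𝕂 V)).shift n := by
  refine Fld.ext fun k v => ?_
  rw [adField_coeff, Fld.coeff_smul, Fld.shift_coeff, Fld.coeff_vac]
  change sbracket r i (modeOp 𝕂 r x n) (modeOp 𝕂 i y k) v = _
  rw [sbracket_modeOp, add_comm n k]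
  split_ifs <;> simp

theorem labelForm_dual (r i : ZMod 2) (φ ψ : Module.Dual 𝕂 V) :
    labelForm r i (0, φ) (0, ψ) = 0 := by
  simp [labelForm]

theorem sComm_modeField (r i : ZMod 2) (φ ψ : Module.Dual 𝕂 V) :
    SComm r i (modeField 𝕂 r (0, φ)) (modeField 𝕂 i (0, ψ)) :=
  sComm_iff_sbracket.mpr fun m n => by
    change sbracket r i (modeOp 𝕂 r (0, φ) m) (modeOp 𝕂 i (0, ψ) n) = 0
    rw [sbracket_modeOp, labelForm_dual]
    simp

theorem modeField_sum {ι : Type*} [Fintype ι] (e : Module.Basis ι 𝕂 V) (i : ZMod 2)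
    (φ : Module.Dual 𝕂 V) :
    modeField 𝕂 i (0, φ) = ∑ j, φ (e j) • modeField 𝕂 i (0, e.coord j) := by
  refine Fld.ext fun k v => ?_
  rw [Fld.coeff_sum]
  change modeOpHom 𝕂 V i k (LinearMap.inr 𝕂 V _ φ) v = _
  conv_lhs => rw [← e.sum_dual_apply_smul_coord φ]
  rw [map_sum, map_sum]
  simp only [map_smul]
  rfl

theorem sbracket_neg_symm {R : Type*} [Ring R] (i j : ZMod 2) (f g : R) :
    sbracket i j f g = -(koszul i j • sbracket j i g f) := by
  rcases koszul_eq_or i j with h | h <;> simp [sbracket, koszul_symm j i, h]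

end WeilSide

/-! ### The differential of the Weil algebra -/

section LieSide

variable {𝕂 : Type*} [Field 𝕂] {𝔤 : Type*} [LieRing 𝔤] [LieAlgebra 𝕂 𝔤]
  {ι : Type*} [Fintype ι] [DecidableEq ι] (e : Module.Basis ι 𝕂 𝔤)

theorem weilDiff_eq_adField (i : ZMod 2) (x : Fld 𝕂 (Weil 𝕂 𝔤)) :
    weilDiff e i x = adField ((weilD e).coeff 0) 1 i x := by
  refine Fld.ext fun k v => ?_
  rw [weilDiff, nProd_coeff, finsum_eq_single _ 0]
  · simp [nProdTerm, sbracket]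
  · intro l hl
    obtain ⟨l, rfl⟩ := Nat.exists_eq_succ_of_ne_zero hl
    rw [nProdTerm, Ring.choose_zero_succ, mul_zero, zero_smul]

/-- The bracket of `a_(0)` with the field `b` is read off from the brackets of the modes of `b` with
the field `a`. -/
theorem adField_coeff_zero_comm (s i : ZMod 2) (a b : Fld 𝕂 (Weil 𝕂 𝔤)) (n : ℤ) :
    (adField (a.coeff 0) s i b).coeff n =
      -(koszul s i • (adField (b.coeff n) i s a).coeff 0) := by
  rw [adField_coeff, adField_coeff, sbracket_neg_symm]

end LieSide

section Derivation

variable {𝕂 : Type*} [Field 𝕂] {A : Type*} [AddCommGroup A] [Module 𝕂 A]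

theorem nProd_smul_left (i j : ZMod 2) (n : ℤ) (r : 𝕂) (a b : Fld 𝕂 A) :
    nProd i j n (r • a) b = r • nProd i j n a b := by
  rw [← nProdHom_apply, map_smul, LinearMap.smul_apply, nProdHom_apply]

theorem nProd_smul_right (i j : ZMod 2) (n : ℤ) (r : 𝕂) (a b : Fld 𝕂 A) :
    nProd i j n a (r • b) = r • nProd i j n a b := by
  rw [← nProdHom_apply, map_smul, nProdHom_apply]

/-- `neg_smul` for fields, stated for the instances on `Fld` so that it can be used to rewrite. -/
theorem Fld.neg_smul (r : 𝕂) (a : Fld 𝕂 A) : -r • a = -(r • a) := _root_.neg_smul r a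

theorem adField_nProd_zero_left {d : Module.End 𝕂 A} {s i j : ZMod 2} {n : ℤ} {a b : Fld 𝕂 A}
    (ha : adField d s i a = 0) : adField d s (i + j) (nProd i j n a b) =
      koszul s i • nProd i (s + j) n a (adField d s j b) := by
  rw [adField_nProd, ha, nProd_zero_left, zero_add]

theorem adField_nProd_zero_right {d : Module.End 𝕂 A} {s i j : ZMod 2} {n : ℤ} {a b : Fld 𝕂 A}
    (hb : adField d s j b = 0) : adField d s (i + j) (nProd i j n a b) =
      nProd (s + i) j n (adField d s i a) b := by
  rw [adField_nProd, hb, nProd_zero_right, smul_zero, add_zero]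

variable {𝔤 : Type*} [LieRing 𝔤] {ι : Type*} [Fintype ι] (x : ι → 𝔤)
  (b β : 𝔤 → Fld 𝕂 A) (c γ : ι → Fld 𝕂 A) (d : Module.End 𝕂 A) (φ : 𝔤 → 𝕂) (n : ℤ)

/-- The bracket with `D` of an odd operator which has nonzero brackets only with `b`. -/
theorem adField_differential_odd (hc : ∀ i, adField d 1 1 (c i) = 0)
    (hγ : ∀ i, adField d 1 0 (γ i) = 0) (hβ : ∀ y, adField d 1 0 (β y) = 0)
    (hb : ∀ y, adField d 1 1 (b y) = φ y • (Fld.vac 𝕂 A).shift n) :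
    adField d 1 1 (- ∑ i, ∑ j, nProd 0 1 (-1) (β ⁅x i, x j⁆) (nProd 0 1 (-1) (γ j) (c i))
      - (1 / 2 : 𝕂) • ∑ i, ∑ j, nProd 1 0 (-1) (c i) (nProd 1 1 (-1) (c j) (b ⁅x i, x j⁆))
      + ∑ i, nProd 0 1 (-1) (γ i) (b (x i))) =
    ∑ i, φ (x i) • (γ i).shift n -
      (1 / 2 : 𝕂) • ∑ i, ∑ j, φ ⁅x i, x j⁆ • (nProd 1 1 (-1) (c i) (c j)).shift n := by
  have t1 : ∀ y i j, adField d 1 1 (nProd 0 1 (-1) (β y) (nProd 0 1 (-1) (γ i) (c j))) = 0 := by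
    intro y i j
    have a1 : adField d 1 1 (nProd 0 1 (-1) (γ i) (c j)) = 0 := by
      have := adField_nProd_zero_left (n := -1) (j := 1) (b := c j) (hγ i)
      rw [hc, nProd_zero_right, smul_zero] at this
      exact this
    have a2 := adField_nProd_zero_left (n := -1) (j := 1) (b := nProd 0 1 (-1) (γ i) (c j)) (hβ y)
    rw [a1, nProd_zero_right, smul_zero] at a2
    exact a2
  have t2 : ∀ i j y, adField d 1 1 (nProd 1 0 (-1) (c i) (nProd 1 1 (-1) (c j) (b y))) =
      φ y • (nProd 1 1 (-1) (c i) (c j)).shift n := by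
    intro i j y
    have a1 : adField d 1 0 (nProd 1 1 (-1) (c j) (b y)) = -(φ y • (c j).shift n) := by
      have := adField_nProd_zero_left (n := -1) (j := 1) (b := b y) (hc j)
      rw [hb, nProd_smul_right, koszul_one_one, neg_smul, one_smul] at this
      rw [← nProd_shift_vac_right 1 n (c j)]
      exact this
    have a2 := adField_nProd_zero_left (n := -1) (j := 0) (b := nProd 1 1 (-1) (c j) (b y)) (hc i)
    rw [a1, ← Fld.neg_smul, nProd_smul_right, koszul_one_one, nProd_shift_right, neg_smul,
      Fld.neg_smul, one_smul, neg_neg] at a2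
    exact a2
  have t3 : ∀ i y, adField d 1 1 (nProd 0 1 (-1) (γ i) (b y)) = φ y • (γ i).shift n := by
    intro i y
    have a1 := adField_nProd_zero_left (n := -1) (j := 1) (b := b y) (hγ i)
    rw [hb, nProd_smul_right, koszul_zero_right, one_smul] at a1
    rw [← nProd_shift_vac_right 0 n (γ i)]
    exact a1
  rw [map_add, map_sub, map_neg, map_smul]
  simp only [map_sum, t1, t2, t3, Finset.sum_const_zero, neg_zero, zero_sub]
  rw [neg_add_eq_sub]

/-- The bracket with `D` of an even operator which has nonzero brackets only with `β`. -/
theorem adField_differential_even (hc : ∀ i, adField d 0 1 (c i) = 0)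
    (hγ : ∀ i, adField d 0 0 (γ i) = 0) (hb : ∀ y, adField d 0 1 (b y) = 0)
    (hβ : ∀ y, adField d 0 0 (β y) = -φ y • (Fld.vac 𝕂 A).shift n) :
    adField d 0 1 (- ∑ i, ∑ j, nProd 0 1 (-1) (β ⁅x i, x j⁆) (nProd 0 1 (-1) (γ j) (c i))
      - (1 / 2 : 𝕂) • ∑ i, ∑ j, nProd 1 0 (-1) (c i) (nProd 1 1 (-1) (c j) (b ⁅x i, x j⁆))
      + ∑ i, nProd 0 1 (-1) (γ i) (b (x i))) =
    ∑ i, ∑ j, φ ⁅x i, x j⁆ • (nProd 0 1 (-1) (γ j) (c i)).shift n := by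
  have t1 : ∀ y i j, adField d 0 1 (nProd 0 1 (-1) (β y) (nProd 0 1 (-1) (γ i) (c j))) =
      -(φ y • (nProd 0 1 (-1) (γ i) (c j)).shift n) := by
    intro y i j
    have a1 : adField d 0 1 (nProd 0 1 (-1) (γ i) (c j)) = 0 := by
      have := adField_nProd_zero_left (n := -1) (j := 1) (b := c j) (hγ i)
      rw [hc, nProd_zero_right, smul_zero] at this
      exact this
    have a2 := adField_nProd_zero_right (n := -1) (i := 0) (a := β y) a1
    rw [hβ, nProd_smul_left, Fld.neg_smul] at a2
    rw [← nProd_shift_vac_left 1 n]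
    exact a2
  have t2 : ∀ i j y,
      adField d 0 1 (nProd 1 0 (-1) (c i) (nProd 1 1 (-1) (c j) (b y))) = 0 := by
    intro i j y
    have a1 : adField d 0 0 (nProd 1 1 (-1) (c j) (b y)) = 0 := by
      have := adField_nProd_zero_left (n := -1) (j := 1) (b := b y) (hc j)
      rw [hb, nProd_zero_right, smul_zero] at this
      exact this
    have a2 := adField_nProd_zero_left (n := -1) (j := 0) (b := nProd 1 1 (-1) (c j) (b y)) (hc i)
    rw [a1, nProd_zero_right, smul_zero] at a2
    exact a2
  have t3 : ∀ i y, adField d 0 1 (nProd 0 1 (-1) (γ i) (b y)) = 0 := by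
    intro i y
    have a1 := adField_nProd_zero_left (n := -1) (j := 1) (b := b y) (hγ i)
    rw [hb, nProd_zero_right, smul_zero] at a1
    exact a1
  rw [map_add, map_sub, map_neg, map_smul]
  simp only [map_sum, t1, t2, t3, Finset.sum_const_zero, smul_zero, sub_zero, add_zero,
    Finset.sum_neg_distrib, neg_neg]

end Derivation

section LieSide

variable {𝕂 : Type*} [Field 𝕂] {𝔤 : Type*} [LieRing 𝔤] [LieAlgebra 𝕂 𝔤]
  {ι : Type*} [Fintype ι] [DecidableEq ι] (e : Module.Basis ι 𝕂 𝔤)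

/-- `[D_(0), c^φ] = γ^φ - 1/2 ∑ φ([ξ_i, ξ_j]) c^{ξ_i^*} c^{ξ_j^*}`. -/
theorem adField_weilD_cField (φ : Module.Dual 𝕂 𝔤) :
    adField ((weilD e).coeff 0) 1 1 (cField 𝕂 φ) = gammaField 𝕂 φ -
      (1 / 2 : 𝕂) • ∑ i, ∑ j, φ ⁅e i, e j⁆ •
        nProd 1 1 (-1) (cField 𝕂 (e.coord i)) (cField 𝕂 (e.coord j)) := by
  have hγsum : gammaField 𝕂 φ = ∑ i, φ (e i) • gammaField 𝕂 (e.coord i) := modeField_sum e 0 φ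
  refine Fld.ext fun n v => ?_
  have h := adField_differential_odd e (bField 𝕂) (betaField 𝕂) (fun i => cField 𝕂 (e.coord i))
    (fun i => gammaField 𝕂 (e.coord i)) ((cField 𝕂 φ).coeff n) φ n
    (fun i => (adField_modeField 1 1 n (0, φ) (0, e.coord i)).trans
      (by rw [labelForm_dual, zero_smul]))
    (fun i => (adField_modeField 1 0 n (0, φ) (0, e.coord i)).trans
      (by rw [labelForm_dual, zero_smul]))
    (fun y => (adField_modeField 1 0 n (0, φ) (y, 0)).trans (by
      rw [show labelForm 1 0 ((0 : 𝔤), φ) (y, 0) = 0 from if_neg (by decide), zero_smul]))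
    (fun y => (adField_modeField 1 1 n (0, φ) (y, 0)).trans (by
      rw [show labelForm 1 1 ((0 : 𝔤), φ) (y, 0) = φ y by simp [labelForm]]))
  rw [adField_coeff_zero_comm, koszul_one_one, neg_smul, one_smul, neg_neg]
  refine (LinearMap.congr_fun (congrArg (fun a : Fld 𝕂 (Weil 𝕂 𝔤) => a.coeff 0) h) v).trans ?_
  rw [hγsum]
  simp only [Fld.coeff_sub, Fld.coeff_sum, Fld.coeff_smul, Fld.shift_coeff, zero_add]

/-- `[D_(0), γ^φ] = - ∑ φ([ξ_i, ξ_j]) γ^{ξ_j^*} c^{ξ_i^*}`. -/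
theorem adField_weilD_gammaField (φ : Module.Dual 𝕂 𝔤) :
    adField ((weilD e).coeff 0) 1 0 (gammaField 𝕂 φ) = - ∑ i, ∑ j, φ ⁅e i, e j⁆ •
        nProd 0 1 (-1) (gammaField 𝕂 (e.coord j)) (cField 𝕂 (e.coord i)) := by
  refine Fld.ext fun n v => ?_
  have h := adField_differential_even e (bField 𝕂) (betaField 𝕂) (fun i => cField 𝕂 (e.coord i))
    (fun i => gammaField 𝕂 (e.coord i)) ((gammaField 𝕂 φ).coeff n) φ n
    (fun i => (adField_modeField 0 1 n (0, φ) (0, e.coord i)).trans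
      (by rw [labelForm_dual, zero_smul]))
    (fun i => (adField_modeField 0 0 n (0, φ) (0, e.coord i)).trans
      (by rw [labelForm_dual, zero_smul]))
    (fun y => (adField_modeField 0 1 n (0, φ) (y, 0)).trans (by
      rw [show labelForm 0 1 ((0 : 𝔤), φ) (y, 0) = 0 from if_neg (by decide), zero_smul]))
    (fun y => (adField_modeField 0 0 n (0, φ) (y, 0)).trans (by
      rw [show labelForm 0 0 ((0 : 𝔤), φ) (y, 0) = -φ y by simp [labelForm]]))
  rw [adField_coeff_zero_comm, koszul_zero_right, one_smul, Fld.coeff_neg]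
  refine congrArg Neg.neg
    ((LinearMap.congr_fun (congrArg (fun a : Fld 𝕂 (Weil 𝕂 𝔤) => a.coeff 0) h) v).trans ?_)
  simp only [Fld.coeff_sum, Fld.coeff_smul, Fld.shift_coeff, zero_add]

end LieSide

/-! ### Polynomials in the fields `c` and `γ` -/

theorem eq_of_mem_graph {𝕂 : Type*} [Field 𝕂] {A B : Type*} [AddCommGroup A] [Module 𝕂 A]
    [AddCommGroup B] [Module 𝕂 B] {S : Submodule 𝕂 (Fld 𝕂 B × Fld 𝕂 A)}
    (hS : ∀ u ∈ S, u.1 = 0 → u.2 = 0) {x : Fld 𝕂 B} {y y' : Fld 𝕂 A}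
    (h : (x, y) ∈ S) (h' : (x, y') ∈ S) : y = y' :=
  sub_eq_zero.mp (hS _ (S.sub_mem h h') (sub_self x))

section Gens

variable {𝕂 : Type*} [Field 𝕂] {V : Type*} [AddCommGroup V] [Module 𝕂 V]
  {ι : Type*} (e : Module.Basis ι 𝕂 V)

/-- The generators of `⟨c, γ⟩`: the label `(1, j)` stands for `c^{e_j^*}` and `(0, j)` for
`γ^{e_j^*}`. -/
def gens (x : ZMod 2 × ι) : Fld 𝕂 (Weil 𝕂 V) := modeField 𝕂 x.1 (0, e.coord x.2)

theorem sCommFamily_gens : SCommFamily Prod.fst (gens e) := fun _ _ => sComm_modeField _ _ _ _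

/-- The vertex operator of a product of creation modes applied to the vacuum is the monomial. -/
theorem word_gens_vacuum (w : List ((ZMod 2 × ι) × ℕ)) :
    (∀ n, 0 ≤ n → (word Prod.fst (gens e) w).coeff n (Weil.vacuum 𝕂 V) = 0) ∧
      (word Prod.fst (gens e) w).coeff (-1) (Weil.vacuum 𝕂 V) = creationWord e w := by
  induction w with
  | nil =>
    refine ⟨fun n hn => ?_, ?_⟩
    · rw [word, Fld.coeff_vac, if_neg (by omega)]
      rfl
    · rw [word, Fld.coeff_vac, if_pos rfl]
      rfl
  | cons x w ih =>
    have h0 : ∀ l : ℕ, (gens e x.1).coeff l (Weil.vacuum 𝕂 V) = 0 := fun l =>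
      modeOp_vacuum _ _ (Int.natCast_nonneg l)
    refine ⟨fun n hn => ?_, ?_⟩
    · rw [word, nProd_coeff]
      refine finsum_eq_zero_of_forall_eq_zero fun l => ?_
      rw [nProdTerm, h0, ih.1 _ (by omega), map_zero, map_zero, smul_zero, sub_zero, smul_zero]
    · rw [word, nProd_coeff, finsum_eq_single _ 0]
      · rw [nProdTerm, h0, map_zero, smul_zero, sub_zero, Nat.cast_zero, add_zero, sub_zero, ih.2,
          Ring.choose_zero_right, pow_zero, one_mul, one_smul]
        rfl
      · intro l hl
        rw [nProdTerm, h0, ih.1 _ (by omega), map_zero, map_zero, smul_zero, sub_zero, smul_zero]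

end Gens

/-- The grade of a word in the generators of `⟨c, γ⟩`. -/
def wordGrade {ι : Type*} : List ((ZMod 2 × ι) × ℕ) → Grade
  | [] => 0
  | x :: w => (x.1.1, if x.1.1 = 1 then 1 else 2, (x.2 : ℤ)) + wordGrade w

theorem wordGrade_fst {ι : Type*} (w : List ((ZMod 2 × ι) × ℕ)) :
    (wordGrade w).1 = wordPar Prod.fst w := by
  induction w with
  | nil => rfl
  | cons x w ih => rw [wordGrade, wordPar, ← ih]; rfl

section Module

variable {𝕂 : Type*} [Field 𝕂] {V : Type*} [AddCommGroup V] [Module 𝕂 V]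
  {A : Type*} [AddCommGroup A] [Module 𝕂 A] {ι : Type*}

/-- A monomial has the grade of its word, if the fields substituted for the generators have the
parities, degrees and weights of the `c^φ` and `γ^φ`. -/
theorem hasGrade_word {gr : Grade → Submodule 𝕂 A} {X : ZMod 2 × ι → Fld 𝕂 A}
    (hX : ∀ x, HasGrade gr (X x) x.1 (if x.1 = 1 then 1 else 2) 0) (w : List ((ZMod 2 × ι) × ℕ)) :
    HasGrade gr (word Prod.fst X w) (wordGrade w).1 (wordGrade w).2.1 (wordGrade w).2.2 := by
  induction w with
  | nil => exact hasGrade_vac gr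
  | cons x w ih =>
    have h := HasGrade.nProd (hX x.1) ih (-1 - x.2)
    rw [wordGrade_fst] at h
    rw [show 0 + (wordGrade w).2.2 - (-1 - (x.2 : ℤ)) - 1 = x.2 + (wordGrade w).2.2 by ring] at h
    rw [wordGrade_fst]
    exact h

theorem hasGrade_gens (e : Module.Basis ι 𝕂 V) (x : ZMod 2 × ι) :
    HasGrade (weilGr 𝕂 V) (gens e x) x.1 (if x.1 = 1 then 1 else 2) 0 := by
  obtain ⟨i, j⟩ := x
  have two : ∀ i : ZMod 2, i = 0 ∨ i = 1 := by decide
  rcases two i with rfl | rfl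
  · exact hasGrade_gammaField _
  · exact hasGrade_cField _

variable (e : Module.Basis ι 𝕂 V) (Y : ZMod 2 × ι → Fld 𝕂 A)

/-- The graph of the action of `⟨c, γ⟩` in which the generators act by the fields `Y`: the pairs
obtained by evaluating one polynomial on the generators and on the fields `Y`. -/
def actionGraph : Submodule 𝕂 (Fld 𝕂 (Weil 𝕂 V) × Fld 𝕂 A) :=
  Submodule.span 𝕂 (Set.range fun w => (word Prod.fst (gens e) w, word Prod.fst Y w))

/-- The part of `actionGraph` given by the polynomials of grade `g`. -/
def actionGraphPart (g : Grade) : Submodule 𝕂 (Fld 𝕂 (Weil 𝕂 V) × Fld 𝕂 A) :=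
  Submodule.span 𝕂
    {u | ∃ w, wordGrade w = g ∧ u = (word Prod.fst (gens e) w, word Prod.fst Y w)}

theorem wordPairs_le_actionGraph (i : ZMod 2) :
    wordPairs Prod.fst (gens e) Y i ≤ actionGraph e Y :=
  wordPairs_le fun w _ => Submodule.subset_span ⟨w, rfl⟩

theorem actionGraphPart_le (g : Grade) :
    actionGraphPart e Y g ≤ wordPairs Prod.fst (gens e) Y g.1 := by
  refine Submodule.span_le.mpr ?_
  rintro _ ⟨w, rfl, rfl⟩
  exact Submodule.subset_span ⟨w, (wordGrade_fst w).symm, rfl⟩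

theorem actionGraph_le : actionGraph e Y ≤ ⨆ g, actionGraphPart e Y g := by
  refine Submodule.span_le.mpr ?_
  rintro _ ⟨w, rfl⟩
  exact Submodule.mem_iSup_of_mem (wordGrade w) (Submodule.subset_span ⟨w, rfl, rfl⟩)

variable {e Y}

theorem actionGraphPart_hasGrade_left {g : Grade} {u : Fld 𝕂 (Weil 𝕂 V) × Fld 𝕂 A}
    (hu : u ∈ actionGraphPart e Y g) : HasGrade (weilGr 𝕂 V) u.1 g.1 g.2.1 g.2.2 := by
  induction hu using Submodule.span_induction with
  | mem u hu =>
    obtain ⟨w, rfl, rfl⟩ := hu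
    exact hasGrade_word (hasGrade_gens e) w
  | zero => exact hasGrade_zero _ _ _ _
  | add u v _ _ hu hv => exact hu.add hv
  | smul r u _ hu => exact hu.smul r

theorem actionGraphPart_hasGrade_right {gr : Grade → Submodule 𝕂 A}
    (hY : ∀ x, HasGrade gr (Y x) x.1 (if x.1 = 1 then 1 else 2) 0) {g : Grade}
    {u : Fld 𝕂 (Weil 𝕂 V) × Fld 𝕂 A} (hu : u ∈ actionGraphPart e Y g) :
    HasGrade gr u.2 g.1 g.2.1 g.2.2 := by
  induction hu using Submodule.span_induction with
  | mem u hu =>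
    obtain ⟨w, rfl, rfl⟩ := hu
    exact hasGrade_word hY w
  | zero => exact hasGrade_zero _ _ _ _
  | add u v _ _ hu hv => exact hu.add hv
  | smul r u _ hu => exact hu.smul r

theorem wordSeries_eq_prod {R : Type*} [Ring R] [Algebra 𝕂 R] {L : Type*}
    (f : L → HahnSeries ℤ R) (w : List (L × ℕ)) :
    wordSeries (𝕂 := 𝕂) f w = (w.map fun x => hasseDeriv 𝕂 x.2 (f x.1)).prod := by
  induction w with
  | nil => rfl
  | cons x w ih => rw [wordSeries, ih, List.map_cons, List.prod_cons]

theorem exists_finsupp_of_mem_actionGraph {u : Fld 𝕂 (Weil 𝕂 V) × Fld 𝕂 A}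
    (hu : u ∈ actionGraph e Y) : ∃ f : Grade →₀ Fld 𝕂 (Weil 𝕂 V) × Fld 𝕂 A,
      (∀ g, f g ∈ actionGraphPart e Y g) ∧ f.sum (fun _ x => x) = u :=
  (Submodule.mem_iSup_iff_exists_finsupp _ _).mp (actionGraph_le e Y hu)

theorem sum_mapRange_fst (f : Grade →₀ Fld 𝕂 (Weil 𝕂 V) × Fld 𝕂 A) :
    ((f.mapRange Prod.fst Prod.fst_zero).sum fun _ x => x) = (f.sum fun _ x => x).1 := by
  rw [Finsupp.sum_mapRange_index (fun _ => rfl), Finsupp.sum, Finsupp.sum, Prod.fst_sum]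

theorem word_gens_mem_cgAlg (w : List ((ZMod 2 × ι) × ℕ)) :
    word Prod.fst (gens e) w ∈ cgAlg 𝕂 V := by
  induction w with
  | nil => exact (cgAlg_isFieldAlgebra 𝕂 V).vac_mem
  | cons x w ih =>
    have h := (hasGrade_word (hasGrade_gens e) w).hasParity
    rw [wordGrade_fst] at h
    refine (cgAlg_isFieldAlgebra 𝕂 V).nProd_mem _ _ _ _ _ ?_ ih (hasGrade_gens e x.1).hasParity h
    obtain ⟨⟨i, j⟩, k⟩ := x
    have two : ∀ i : ZMod 2, i = 0 ∨ i = 1 := by decide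
    rcases two i with rfl | rfl
    · exact (cgAlg.gamma 𝕂 (e.coord j)).2
    · exact (cgAlg.c 𝕂 (e.coord j)).2

theorem fst_mem_cgAlg {u : Fld 𝕂 (Weil 𝕂 V) × Fld 𝕂 A} (hu : u ∈ actionGraph e Y) :
    u.1 ∈ cgAlg 𝕂 V := by
  have : actionGraph e Y ≤ (cgAlg 𝕂 V).comap (LinearMap.fst 𝕂 _ _) := by
    refine Submodule.span_le.mpr ?_
    rintro _ ⟨w, rfl⟩
    exact word_gens_mem_cgAlg w
  exact this hu

variable [CharZero 𝕂] [Fintype ι]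

/-- The relation `actionGraph` is single-valued. A polynomial in the generators of `⟨c, γ⟩` is
determined by the vector which it creates from the vacuum, and on the vectors on which the fields
`Y` have poles of bounded order, `Y` gives the evaluation of this polynomial at supercommuting
Laurent series. -/
theorem actionGraph_eq_zero (hY : SCommFamily Prod.fst Y) {u : Fld 𝕂 (Weil 𝕂 V) × Fld 𝕂 A}
    (hu : u ∈ actionGraph e Y) (h0 : u.1 = 0) : u.2 = 0 := by
  classical
  refine ext_of_isRestr Y fun N => ⟨0, ?_, IsRestr.zero⟩
  have hθ : ∀ (x y : ZMod 2 × ι) (k l : ℕ),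
      hasseDeriv 𝕂 k (genSeries 𝕂 hY N x) * hasseDeriv 𝕂 l (genSeries 𝕂 hY N y) =
        koszul x.1 y.1 •
          (hasseDeriv 𝕂 l (genSeries 𝕂 hY N y) * hasseDeriv 𝕂 k (genSeries 𝕂 hY N x)) := by
    intro x y k l
    refine laurent_mul_comm fun p q => ?_
    rw [LaurentSeries.hasseDeriv_coeff, LaurentSeries.hasseDeriv_coeff, smul_mul_smul_comm,
      smul_mul_smul_comm, IsRestr.coeff_mul_comm (hY x y) (isRestr_genSeries hY N x)
        (isRestr_genSeries hY N y), smul_comm (koszul x.1 y.1), mul_comm (Ring.choose _ _)]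
  obtain ⟨ε, hε⟩ := exists_creationWord_eval e
    (fun x k => hasseDeriv 𝕂 k (genSeries 𝕂 hY N x)) hθ
  have key : ∀ v ∈ actionGraph e Y,
      IsRestr (bounded Y N) v.2 (ε (v.1.coeff (-1) (Weil.vacuum 𝕂 V))) := by
    intro v hv
    induction hv using Submodule.span_induction with
    | mem v hv =>
      obtain ⟨w, rfl⟩ := hv
      dsimp only
      rw [(word_gens_vacuum e w).2, hε, ← wordSeries_eq_prod]
      exact isRestr_word hY N w
    | zero =>
      rw [Prod.fst_zero, Fld.coeff_zero, LinearMap.zero_apply, map_zero]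
      exact IsRestr.zero
    | add u v _ _ hu hv =>
      rw [Prod.fst_add, Fld.coeff_add, LinearMap.add_apply, map_add]
      exact hu.add hv
    | smul r u _ hu =>
      rw [Prod.smul_fst, Fld.coeff_smul, LinearMap.smul_apply, map_smul]
      exact hu.smul r
  have := key u hu
  rwa [h0, Fld.coeff_zero, LinearMap.zero_apply, map_zero] at this

theorem actionGraph_unique (hY : SCommFamily Prod.fst Y) {x : Fld 𝕂 (Weil 𝕂 V)}
    {y y' : Fld 𝕂 A} (h : (x, y) ∈ actionGraph e Y) (h' : (x, y') ∈ actionGraph e Y) :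
    y = y' :=
  eq_of_mem_graph (fun _ hu h0 => actionGraph_eq_zero hY hu h0) h h'

theorem actionGraph_component (hY : SCommFamily Prod.fst Y)
    {f : Grade →₀ Fld 𝕂 (Weil 𝕂 V) × Fld 𝕂 A} (hf : ∀ g, f g ∈ actionGraphPart e Y g) {g : Grade}
    (h : (f.mapRange Prod.fst Prod.fst_zero) g = 0) : f g = 0 :=
  Prod.ext h (actionGraph_eq_zero hY
    (wordPairs_le_actionGraph e Y _ (actionGraphPart_le e Y g (hf g))) h)

/-- A field of a given grade in `⟨c, γ⟩` is a polynomial of this grade in the generators. -/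
theorem mem_actionGraphPart_of_hasGrade (hY : SCommFamily Prod.fst Y)
    {u : Fld 𝕂 (Weil 𝕂 V) × Fld 𝕂 A} (hu : u ∈ actionGraph e Y) {i : ZMod 2} {p w : ℤ}
    (h : HasGrade (weilGr 𝕂 V) u.1 i p w) : u ∈ actionGraphPart e Y (i, p, w) := by
  obtain ⟨f, hf, rfl⟩ := exists_finsupp_of_mem_actionGraph hu
  rw [Finsupp.sum]
  refine sum_mem fun g _ => ?_
  by_cases hg : g = (i, p, w)
  · exact hg ▸ hf g
  · rw [← sum_mapRange_fst] at h
    rw [actionGraph_component hY hf (component_eq_zero_of_hasGrade _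
      (fun g => actionGraphPart_hasGrade_left (hf g)) hg h)]
    exact zero_mem _

theorem mem_wordPairs_of_hasParity (hY : SCommFamily Prod.fst Y)
    {u : Fld 𝕂 (Weil 𝕂 V) × Fld 𝕂 A} (hu : u ∈ actionGraph e Y) {i : ZMod 2}
    (h : HasParity (weilGr 𝕂 V) u.1 i) : u ∈ wordPairs Prod.fst (gens e) Y i := by
  obtain ⟨f, hf, rfl⟩ := exists_finsupp_of_mem_actionGraph hu
  rw [Finsupp.sum]
  refine sum_mem fun g _ => ?_
  by_cases hg : g.1 = i
  · exact hg ▸ actionGraphPart_le e Y g (hf g)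
  · rw [← sum_mapRange_fst] at h
    rw [actionGraph_component hY hf (component_eq_zero_of_hasParity _
      (fun g => actionGraphPart_hasGrade_left (hf g)) hg h)]
    exact zero_mem _

end Module

section Action

variable {𝕂 : Type*} [Field 𝕂] {V : Type*} [AddCommGroup V] [Module 𝕂 V]
  {A : Type*} [AddCommGroup A] [Module 𝕂 A] {ι : Type*} [Fintype ι]
  {e : Module.Basis ι 𝕂 V} {Y : ZMod 2 × ι → Fld 𝕂 A}

theorem mem_actionGraph_modeField (hY : SCommFamily Prod.fst Y) (i : ZMod 2)
    (φ : Module.Dual 𝕂 V) :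
    (modeField 𝕂 i (0, φ), ∑ j, φ (e j) • Y (i, j)) ∈ actionGraph e Y := by
  rw [modeField_sum e i φ]
  have : (∑ j, φ (e j) • modeField 𝕂 i (0, e.coord j), ∑ j, φ (e j) • Y (i, j)) =
      ∑ j, φ (e j) • (gens e (i, j), Y (i, j)) := by
    ext1
    · rw [Prod.fst_sum]
      rfl
    · rw [Prod.snd_sum]
      rfl
  rw [this]
  exact sum_mem fun j _ => Submodule.smul_mem _ _ (wordPairs_le_actionGraph e Y i
    (wordPairs_gen (sCommFamily_gens e) hY (i, j)))

variable [CharZero 𝕂]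

theorem exists_mem_actionGraph (hY : SCommFamily Prod.fst Y) (x : cgAlg 𝕂 V) :
    ∃ y, (x.1, y) ∈ actionGraph e Y := by
  have hle : cgAlg 𝕂 V ≤ (actionGraph e Y).map (LinearMap.fst 𝕂 _ _) := by
    refine sInf_le ⟨⟨⟨_, Submodule.subset_span ⟨[], rfl⟩, rfl⟩, ?_⟩, ?_⟩
    · rintro i j n _ _ ⟨u, hu, rfl⟩ ⟨v, hv, rfl⟩ hi hj
      exact ⟨_, wordPairs_le_actionGraph e Y _ (wordPairs_nProd (sCommFamily_gens e) hY n
        (mem_wordPairs_of_hasParity hY hu hi) (mem_wordPairs_of_hasParity hY hv hj)), rfl⟩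
    · rintro _ (⟨φ, rfl⟩ | ⟨φ, rfl⟩)
      · exact ⟨_, mem_actionGraph_modeField hY 1 φ, rfl⟩
      · exact ⟨_, mem_actionGraph_modeField hY 0 φ, rfl⟩
  obtain ⟨⟨_, y⟩, hu, rfl⟩ := hle x.2
  exact ⟨y, hu⟩

/-- Supercommuting fields can be substituted for the generators of `⟨c, γ⟩`. -/
theorem exists_action (e : Module.Basis ι 𝕂 V) (hY : SCommFamily Prod.fst Y) :
    ∃ Z : cgAlg 𝕂 V →ₗ[𝕂] Fld 𝕂 A, ∀ x, (x.1, Z x) ∈ actionGraph e Y := by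
  choose Z hZ using exists_mem_actionGraph (e := e) hY
  exact ⟨{
    toFun := Z
    map_add' := fun x y => actionGraph_unique hY (hZ (x + y)) (add_mem (hZ x) (hZ y))
    map_smul' := fun r x =>
      actionGraph_unique hY (hZ (r • x)) (Submodule.smul_mem _ r (hZ x)) }, hZ⟩

variable {Z : cgAlg 𝕂 V →ₗ[𝕂] Fld 𝕂 A}

theorem action_isVertexModule (hY : SCommFamily Prod.fst Y) {gr : Grade → Submodule 𝕂 A}
    (hgr : ∀ x, HasGrade gr (Y x) x.1 (if x.1 = 1 then 1 else 2) 0)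
    (hZ : ∀ x, (x.1, Z x) ∈ actionGraph e Y) :
    IsVertexModule (weilGr 𝕂 V) (cgAlg_isFieldAlgebra 𝕂 V) gr Z where
  map_vac := actionGraph_unique hY (hZ _) (Submodule.subset_span ⟨[], rfl⟩)
  graded := fun x i p w h =>
    actionGraphPart_hasGrade_right hgr (mem_actionGraphPart_of_hasGrade hY (hZ x) h)
  borcherds := by
    intro i j a b hi hj m n k v
    have ha := mem_wordPairs_of_hasParity hY (hZ a) hi
    have hb := mem_wordPairs_of_hasParity hY (hZ b) hj
    rw [← (wordPairs_sComm (sCommFamily_gens e) hY ha hb).2.borcherds m n k v]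
    refine finsum_congr fun l => ?_
    rw [actionGraph_unique hY (hZ _) (wordPairs_le_actionGraph e Y _
      (wordPairs_nProd (sCommFamily_gens e) hY (n + l) ha hb))]

/-- The action intertwines two derivations if it does so on the generators. -/
theorem action_adField (hY : SCommFamily Prod.fst Y) (hZ : ∀ x, (x.1, Z x) ∈ actionGraph e Y)
    {d : Module.End 𝕂 (Weil 𝕂 V)} {d' : Module.End 𝕂 A} {s : ZMod 2}
    (hd : ∀ x, (adField d s x.1 (gens e x), adField d' s x.1 (Y x)) ∈
      wordPairs Prod.fst (gens e) Y (s + x.1))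
    {i : ZMod 2} {x : cgAlg 𝕂 V} (hx : HasParity (weilGr 𝕂 V) x.1 i) :
    ∃ y : cgAlg 𝕂 V, y.1 = adField d s i x.1 ∧ Z y = adField d' s i (Z x) := by
  have h := wordPairs_le_actionGraph e Y _ (wordPairs_adField (sCommFamily_gens e) hY hd
    (mem_wordPairs_of_hasParity hY (hZ x) hx))
  exact ⟨⟨_, fst_mem_cgAlg h⟩, rfl, actionGraph_unique hY (hZ _) h⟩

end Action

/-! ### The quadratic differential -/

section Jacobi

variable {𝕂 : Type*} [Field 𝕂] {𝔤 : Type*} [LieRing 𝔤] [LieAlgebra 𝕂 𝔤]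
  {ι : Type*} [Fintype ι] (e : Module.Basis ι 𝕂 𝔤) (φ : Module.Dual 𝕂 𝔤)

theorem sum_bracket_swap {M : Type*} [AddCommGroup M] [Module 𝕂 M] (F : ι → ι → M) :
    ∑ i, ∑ j, φ ⁅e i, e j⁆ • F j i = -∑ i, ∑ j, φ ⁅e i, e j⁆ • F i j := by
  rw [Finset.sum_comm, ← Finset.sum_neg_distrib]
  refine Finset.sum_congr rfl fun i _ => ?_
  rw [← Finset.sum_neg_distrib]
  refine Finset.sum_congr rfl fun j _ => ?_
  rw [← lie_skew, map_neg, neg_smul]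

theorem sum_cycle {M : Type*} [AddCommMonoid M] (F : ι → ι → ι → M) :
    ∑ k, ∑ l, ∑ j, F k l j = ∑ k, ∑ l, ∑ j, F l j k := by
  rw [Finset.sum_comm (f := fun k l => ∑ j, F l j k)]
  exact Finset.sum_congr rfl fun l _ => Finset.sum_comm

variable [CharZero 𝕂]

theorem half_sum_sub_swap {M : Type*} [AddCommGroup M] [Module 𝕂 M] (F : ι → ι → M) :
    (1 / 2 : 𝕂) • ∑ i, ∑ j, φ ⁅e i, e j⁆ • (F i j - F j i) = ∑ i, ∑ j, φ ⁅e i, e j⁆ • F i j := by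
  simp only [smul_sub, Finset.sum_sub_distrib]
  rw [sum_bracket_swap e φ F]
  module

variable {R : Type*} [Ring R] [Algebra 𝕂 R] {C : ι → R}

/-- For anticommuting `C_i`, the products `C_k C_l C_j` are invariant under cyclic permutations, so
that the sum is a third of a sum of Jacobiators. -/
theorem sum_cubic_eq_zero (hC : ∀ i j, C i * C j = -(C j * C i)) :
    ∑ k, ∑ l, ∑ j, φ ⁅⁅e k, e l⁆, e j⁆ • (C k * C l * C j) = 0 := by
  have hcyc : ∀ k l j, C l * C j * C k = C k * C l * C j := by
    intro k l j
    rw [hC k l, neg_mul, mul_assoc, mul_assoc, hC k j, mul_neg, neg_neg]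
  have h1 : ∑ k, ∑ l, ∑ j, φ ⁅⁅e k, e l⁆, e j⁆ • (C k * C l * C j) =
      ∑ k, ∑ l, ∑ j, φ ⁅⁅e l, e j⁆, e k⁆ • (C k * C l * C j) := by
    rw [sum_cycle]
    simp only [hcyc]
  have h2 : ∑ k, ∑ l, ∑ j, φ ⁅⁅e l, e j⁆, e k⁆ • (C k * C l * C j) =
      ∑ k, ∑ l, ∑ j, φ ⁅⁅e j, e k⁆, e l⁆ • (C k * C l * C j) := by
    rw [sum_cycle]
    simp only [hcyc]
  have h3 : ∑ k, ∑ l, ∑ j, φ ⁅⁅e k, e l⁆, e j⁆ • (C k * C l * C j) +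
      ∑ k, ∑ l, ∑ j, φ ⁅⁅e l, e j⁆, e k⁆ • (C k * C l * C j) +
      ∑ k, ∑ l, ∑ j, φ ⁅⁅e j, e k⁆, e l⁆ • (C k * C l * C j) = 0 := by
    simp only [← Finset.sum_add_distrib, ← add_smul, ← map_add]
    refine Finset.sum_eq_zero fun k _ => Finset.sum_eq_zero fun l _ =>
      Finset.sum_eq_zero fun j _ => ?_
    have := lie_jacobi (e k) (e l) (e j)
    rw [← lie_skew ⁅e k, e l⁆ (e j), ← lie_skew ⁅e l, e j⁆ (e k), ← lie_skew ⁅e j, e k⁆ (e l),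
      show -⁅e j, ⁅e k, e l⁆⁆ + -⁅e k, ⁅e l, e j⁆⁆ + -⁅e l, ⁅e j, e k⁆⁆ =
        -(⁅e k, ⁅e l, e j⁆⁆ + ⁅e l, ⁅e j, e k⁆⁆ + ⁅e j, ⁅e k, e l⁆⁆) by abel, this, neg_zero, map_zero,
      zero_smul]
  rw [← h2, ← h1] at h3
  have h4 : (3 : 𝕂) • ∑ k, ∑ l, ∑ j, φ ⁅⁅e k, e l⁆, e j⁆ • (C k * C l * C j) = 0 := by
    rw [← h3]
    module
  exact (smul_eq_zero.mp h4).resolve_left three_ne_zero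

/-- If `E_i = d C_i` and `Γ_i = E_i + 1/2 ∑ ⟨ξ_i^*, [ξ_k, ξ_l]⟩ C_k C_l`, then the value of `d` on
`Γ^φ`, on the left, is a quadratic polynomial in the `Γ_i` and `C_i`. -/
theorem quadratic_differential (hC : ∀ i j, C i * C j = -(C j * C i)) {E Γ : ι → R}
    (hE : ∀ i j, C i * E j = E j * C i)
    (hΓ : ∀ i, E i = Γ i - (1 / 2 : 𝕂) • ∑ k, ∑ l, e.coord i ⁅e k, e l⁆ • (C k * C l)) :
    (1 / 2 : 𝕂) • ∑ i, ∑ j, φ ⁅e i, e j⁆ • (E i * C j - C i * E j) =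
      -∑ i, ∑ j, φ ⁅e i, e j⁆ • (Γ j * C i) := by
  have hcub : ∑ i, ∑ j, φ ⁅e i, e j⁆ •
      ((∑ k, ∑ l, e.coord i ⁅e k, e l⁆ • (C k * C l)) * C j) = 0 := by
    rw [← sum_cubic_eq_zero e φ hC]
    have h1 : ∀ k l j, φ ⁅⁅e k, e l⁆, e j⁆ = ∑ i, φ ⁅e i, e j⁆ * e.coord i ⁅e k, e l⁆ := by
      intro k l j
      conv_lhs => rw [← e.sum_repr ⁅e k, e l⁆]
      rw [sum_lie, map_sum]
      refine Finset.sum_congr rfl fun i _ => ?_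
      rw [smul_lie, map_smul, smul_eq_mul, mul_comm]
      rfl
    simp only [h1, Finset.sum_mul, Finset.smul_sum, Finset.sum_smul, smul_mul_assoc, smul_smul]
    refine (Finset.sum_congr rfl fun i _ => (sum_cycle _).trans (sum_cycle _)).trans ?_
    rw [Finset.sum_comm]
    refine Finset.sum_congr rfl fun k _ => ?_
    rw [Finset.sum_comm]
    refine Finset.sum_congr rfl fun l _ => ?_
    rw [Finset.sum_comm]
  simp only [hE]
  rw [half_sum_sub_swap e φ fun i j => E i * C j, ← sum_bracket_swap]
  have h2 : ∀ i j, E i * C j = Γ i * C j -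
      (1 / 2 : 𝕂) • ((∑ k, ∑ l, e.coord i ⁅e k, e l⁆ • (C k * C l)) * C j) := by
    intro i j
    rw [hΓ, sub_mul, smul_mul_assoc]
  simp only [h2, smul_sub, Finset.sum_sub_distrib, smul_comm _ (1 / 2 : 𝕂) (_ * _)]
  simp only [← Finset.smul_sum]
  rw [hcub, smul_zero, sub_zero]

end Jacobi

/-! ### The fields lifting the generators -/

section Sums

variable {𝕂 : Type*} [Field 𝕂] {A : Type*} [AddCommGroup A] [Module 𝕂 A] {ι : Type*}

theorem SComm.sum_right {i j : ZMod 2} {a : Fld 𝕂 A} {s : Finset ι} {b : ι → Fld 𝕂 A}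
    (h : ∀ x, SComm i j a (b x)) : SComm i j a (∑ x ∈ s, b x) :=
  Finset.sum_induction _ (SComm i j a) (fun _ _ => SComm.add_right) SComm.zero_right fun x _ => h x

theorem HasGrade.sum {gr : Grade → Submodule 𝕂 A} {i : ZMod 2} {p w : ℤ} {s : Finset ι}
    {b : ι → Fld 𝕂 A} (h : ∀ x, HasGrade gr (b x) i p w) : HasGrade gr (∑ x ∈ s, b x) i p w :=
  Finset.sum_induction _ (HasGrade gr · i p w) (fun _ _ => HasGrade.add) (hasGrade_zero _ _ _ _)
    fun x _ => h x

theorem IsRestr.sum {C : Submodule 𝕂 A} {s : Finset ι} {a : ι → Fld 𝕂 A}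
    {f : ι → HahnSeries ℤ (Module.End 𝕂 C)} (h : ∀ x, IsRestr C (a x) (f x)) :
    IsRestr C (∑ x ∈ s, a x) (∑ x ∈ s, f x) := by
  classical
  induction s using Finset.induction_on with
  | empty => exact IsRestr.zero
  | insert x s hx ih =>
    rw [Finset.sum_insert hx, Finset.sum_insert hx]
    exact (h x).add ih

theorem IsRestr.sub {C : Submodule 𝕂 A} {a b : Fld 𝕂 A} {f g : HahnSeries ℤ (Module.End 𝕂 C)}
    (ha : IsRestr C a f) (hb : IsRestr C b g) : IsRestr C (a - b) (f - g) := fun k v => by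
  simp [ha k v, hb k v]

theorem IsRestr.neg {C : Submodule 𝕂 A} {a : Fld 𝕂 A} {f : HahnSeries ℤ (Module.End 𝕂 C)}
    (ha : IsRestr C a f) : IsRestr C (-a) (-f) := fun k v => by
  simp [ha k v]

theorem IsRestr.mul {C : Submodule 𝕂 A} {i j : ZMod 2} {a b : Fld 𝕂 A}
    {f g : HahnSeries ℤ (Module.End 𝕂 C)} (h : SComm i j a b) (ha : IsRestr C a f)
    (hb : IsRestr C b g) : IsRestr C (ChiralWeil.nProd i j (-1) a b) (f * g) := by
  have := IsRestr.nProd h ha hb 0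
  rwa [LaurentSeries.hasseDeriv_zero, LinearMap.id_apply, Nat.cast_zero, sub_zero] at this

theorem IsRestr.mul_comm {C : Submodule 𝕂 A} {i j : ZMod 2} {a b : Fld 𝕂 A}
    {f g : HahnSeries ℤ (Module.End 𝕂 C)} (h : SComm i j a b) (ha : IsRestr C a f)
    (hb : IsRestr C b g) : f * g = koszul i j • (g * f) :=
  laurent_mul_comm (IsRestr.coeff_mul_comm h ha hb)

theorem adField_adField {d : Module.End 𝕂 A} (hd : d * d = 0) (a : Fld 𝕂 A) :
    adField d 1 0 (adField d 1 1 a) = 0 := by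
  refine Fld.ext fun n v => ?_
  rw [adField_coeff, adField_coeff]
  have h : ∀ v, d (d v) = 0 := LinearMap.congr_fun hd
  simp [sbracket, h]

/-- If `d ^ 2 = 0` and `[a, [d, b]] = 0`, then `[[d, a], [d, b]] = 0`. -/
theorem sComm_adField_adField {d : Module.End 𝕂 A} (hd : d * d = 0) {a b : Fld 𝕂 A}
    (h : SComm 1 0 a (adField d 1 1 b)) : SComm 0 0 (adField d 1 1 a) (adField d 1 1 b) := by
  intro m n
  have h1 := h m n
  have h2 := LinearMap.ext fun v => congrArg (fun x : Fld 𝕂 A => x.coeff n v) (adField_adField hd b)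
  rw [koszul_zero_right, one_smul] at h1
  rw [adField_coeff, sbracket, koszul_zero_right, one_smul] at h2
  replace h2 := sub_eq_zero.mp h2
  rw [koszul_zero_right, one_smul, adField_coeff (a := a), sbracket, koszul_one_one, neg_smul,
    one_smul, sub_neg_eq_add]
  generalize (adField d 1 1 b).coeff n = g at *
  rw [add_mul, mul_add, mul_assoc, h1, ← mul_assoc, h2, mul_assoc (a.coeff m), h2, ← mul_assoc, h1,
    mul_assoc, mul_assoc]

end Sums

section Lift

variable {𝕂 : Type*} [Field 𝕂] {𝔤 : Type*} [LieRing 𝔤] [LieAlgebra 𝕂 𝔤]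
  {ι : Type*} [Fintype ι] (e : Module.Basis ι 𝕂 𝔤) {A : Type*} [AddCommGroup A] [Module 𝕂 A]
  (d : Module.End 𝕂 A) (c : ι → Fld 𝕂 A)

/-- The fields by which the generators of `⟨c, γ⟩` act, if the `c^{ξ_k^*}` act by the fields `c k`
and the action is compatible with the differential `d`: the field of `γ^{ξ_k^*}` is
`[d, c_k] + 1/2 ∑ ⟨ξ_k^*, [ξ_i, ξ_j]⟩ c_i c_j`. -/
def liftGens (x : ZMod 2 × ι) : Fld 𝕂 A :=
  if x.1 = 1 then c x.2 else adField d 1 1 (c x.2) +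
    (1 / 2 : 𝕂) • ∑ i, ∑ j, e.coord x.2 ⁅e i, e j⁆ • nProd 1 1 (-1) (c i) (c j)

theorem liftGens_one (k : ι) : liftGens e d c (1, k) = c k := if_pos rfl

theorem liftGens_zero (k : ι) : liftGens e d c (0, k) = adField d 1 1 (c k) +
    (1 / 2 : 𝕂) • ∑ i, ∑ j, e.coord k ⁅e i, e j⁆ • nProd 1 1 (-1) (c i) (c j) :=
  if_neg zero_ne_one

theorem adField_eq_liftGens (k : ι) : adField d 1 1 (c k) = liftGens e d c (0, k) -
    (1 / 2 : 𝕂) • ∑ i, ∑ j, e.coord k ⁅e i, e j⁆ • nProd 1 1 (-1) (c i) (c j) := by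
  rw [liftGens_zero, add_sub_cancel_right]

variable {d c}

theorem sCommFamily_liftGens (hd : d * d = 0) (hcc : ∀ i j, SComm 1 1 (c i) (c j))
    (hcd : ∀ i j, SComm 1 0 (c i) (adField d 1 1 (c j))) :
    SCommFamily Prod.fst (liftGens e d c) := by
  have h1 : ∀ k i j, SComm 1 0 (c k) (nProd 1 1 (-1) (c i) (c j)) := fun k i j =>
    SComm.nProd_right (hcc k i) (hcc k j) _
  have h10 : ∀ k l, SComm 1 0 (c k) (liftGens e d c (0, l)) := fun k l => by
    rw [liftGens_zero]
    exact (hcd k l).add_right ((SComm.sum_right fun i => SComm.sum_right fun j =>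
      (h1 k i j).smul_right _).smul_right _)
  have h2 : ∀ k i j, SComm 0 0 (adField d 1 1 (c k)) (nProd 1 1 (-1) (c i) (c j)) := fun k i j =>
    SComm.nProd_right (hcd i k).symm (hcd j k).symm _
  have h3 : ∀ k l, SComm 0 0 (adField d 1 1 (c k)) (liftGens e d c (0, l)) := fun k l => by
    rw [liftGens_zero]
    exact (sComm_adField_adField hd (hcd k l)).add_right ((SComm.sum_right fun i =>
      SComm.sum_right fun j => (h2 k i j).smul_right _).smul_right _)
  have h4 : ∀ i j l, SComm 0 0 (nProd 1 1 (-1) (c i) (c j)) (liftGens e d c (0, l)) := fun i j l =>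
    SComm.nProd_left (h10 i l) (h10 j l) _
  have h00 : ∀ k l, SComm 0 0 (liftGens e d c (0, k)) (liftGens e d c (0, l)) := fun k l => by
    rw [liftGens_zero e d c k]
    exact ((h3 k l).symm.add_right ((SComm.sum_right fun i => SComm.sum_right fun j =>
      (h4 i j l).symm.smul_right _).smul_right _)).symm
  have two : ∀ i : ZMod 2, i = 0 ∨ i = 1 := by decide
  rintro ⟨i, k⟩ ⟨j, l⟩
  rcases two i with rfl | rfl <;> rcases two j with rfl | rfl
  · exact h00 k l
  · rw [liftGens_one]
    exact (h10 l k).symm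
  · rw [liftGens_one]
    exact h10 k l
  · rw [liftGens_one, liftGens_one]
    exact hcc k l

theorem hasGrade_adField {gr : Grade → Submodule 𝕂 A}
    (hd : ∀ (i : ZMod 2) (p w : ℤ), ∀ v ∈ gr (i, p, w), d v ∈ gr (i + 1, p + 1, w))
    {i : ZMod 2} {p w : ℤ} {a : Fld 𝕂 A} (ha : HasGrade gr a i p w) :
    HasGrade gr (adField d 1 i a) (i + 1) (p + 1) w := by
  intro n j q m v hv
  rw [adField_coeff, sbracket, LinearMap.sub_apply, LinearMap.smul_apply,
    Module.End.mul_apply, Module.End.mul_apply]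
  refine sub_mem ?_ (Submodule.smul_of_tower_mem _ _ ?_)
  · convert! hd _ _ _ _ (ha n j q m v hv) using 3
    · ring
    · ring_nf
  · convert! ha n _ _ _ _ (hd _ _ _ v hv) using 3
    · ring
    · ring_nf

theorem hasGrade_liftGens {gr : Grade → Submodule 𝕂 A}
    (hd : ∀ (i : ZMod 2) (p w : ℤ), ∀ v ∈ gr (i, p, w), d v ∈ gr (i + 1, p + 1, w))
    (hc : ∀ k, HasGrade gr (c k) 1 1 0) (x : ZMod 2 × ι) :
    HasGrade gr (liftGens e d c x) x.1 (if x.1 = 1 then 1 else 2) 0 := by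
  have two : ∀ i : ZMod 2, i = 0 ∨ i = 1 := by decide
  obtain ⟨i, k⟩ := x
  rcases two i with rfl | rfl
  · rw [liftGens_zero]
    exact (hasGrade_adField hd (hc k)).add ((HasGrade.sum fun i => HasGrade.sum fun j =>
      (HasGrade.nProd (hc i) (hc j) (-1)).smul _).smul _)
  · rw [liftGens_one]
    exact hc k

/-- The bracket of `d` with the field of `γ^{ξ_k^*}`, by the Jacobi identity. -/
theorem adField_liftGens_zero [CharZero 𝕂] (hd : d * d = 0) (hcc : ∀ i j, SComm 1 1 (c i) (c j))
    (hcd : ∀ i j, SComm 1 0 (c i) (adField d 1 1 (c j))) (k : ι) :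
    adField d 1 0 (liftGens e d c (0, k)) = - ∑ i, ∑ j, e.coord k ⁅e i, e j⁆ •
      nProd 0 1 (-1) (liftGens e d c (0, j)) (liftGens e d c (1, i)) := by
  have hY := sCommFamily_liftGens e hd hcc hcd
  have had : ∀ i j, adField d 1 0 (nProd 1 1 (-1) (c i) (c j)) =
      nProd 0 1 (-1) (adField d 1 1 (c i)) (c j) - nProd 1 0 (-1) (c i) (adField d 1 1 (c j)) := by
    intro i j
    have := adField_nProd d 1 1 1 (-1) (c i) (c j)
    rw [koszul_one_one, neg_smul, one_smul, ← sub_eq_add_neg] at this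
    exact this
  have hL : adField d 1 0 (liftGens e d c (0, k)) = (1 / 2 : 𝕂) • ∑ i, ∑ j, e.coord k ⁅e i, e j⁆ •
      (nProd 0 1 (-1) (adField d 1 1 (c i)) (c j) -
        nProd 1 0 (-1) (c i) (adField d 1 1 (c j))) := by
    rw [liftGens_zero, map_add, adField_adField hd, zero_add, map_smul]
    simp only [map_sum, map_smul, had]
  refine ext_of_isRestr (liftGens e d c) fun N => ⟨_, ?_,
    IsRestr.neg (IsRestr.sum fun i => IsRestr.sum fun j => IsRestr.smul _
      (IsRestr.mul (hY (0, j) (1, i)) (isRestr_genSeries hY N _) (isRestr_genSeries hY N _)))⟩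
  · have hc : ∀ i, IsRestr (bounded (liftGens e d c) N) (c i) (genSeries 𝕂 hY N (1, i)) := by
      intro i
      have := isRestr_genSeries hY N (1, i)
      rwa [liftGens_one] at this
    have hE : ∀ i, IsRestr (bounded (liftGens e d c) N) (adField d 1 1 (c i))
        (genSeries 𝕂 hY N (0, i) - (1 / 2 : 𝕂) • ∑ k, ∑ l, e.coord i ⁅e k, e l⁆ •
          (genSeries 𝕂 hY N (1, k) * genSeries 𝕂 hY N (1, l))) := by
      intro i
      rw [adField_eq_liftGens e]
      exact (isRestr_genSeries hY N (0, i)).sub (IsRestr.smul _ (IsRestr.sum fun k =>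
        IsRestr.sum fun l => IsRestr.smul _ (IsRestr.mul (hcc k l) (hc k) (hc l))))
    have hq := quadratic_differential e (e.coord k) (C := fun i => genSeries 𝕂 hY N (1, i))
      (Γ := fun i => genSeries 𝕂 hY N (0, i)) (fun i j => ?_) (fun i j => ?_) fun i => rfl
    · refine (congrArg (IsRestr _ _) hq).mp ?_
      rw [hL]
      exact IsRestr.smul _ (IsRestr.sum fun i => IsRestr.sum fun j => IsRestr.smul _
        (IsRestr.sub (IsRestr.mul (hcd j i).symm (hE i) (hc j))
          (IsRestr.mul (hcd i j) (hc i) (hE j))))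
    · have := IsRestr.mul_comm (hcc i j) (hc i) (hc j)
      rw [koszul_one_one] at this
      rw [this]
      refine HahnSeries.ext (funext fun n => ?_)
      rw [HahnSeries.coeff_smul, HahnSeries.coeff_neg, neg_smul, one_smul]
    · have := IsRestr.mul_comm (hcd i j) (hc i) (hE j)
      rwa [koszul_zero_right, one_smul] at this

end Lift

/-! ### The action of `⟨c, γ⟩` -/

section Pairs

variable {𝕂 : Type*} [Field 𝕂] {A B : Type*} [AddCommGroup A] [Module 𝕂 A]
  [AddCommGroup B] [Module 𝕂 B] {ι : Type*} [Fintype ι] {S : Submodule 𝕂 (Fld 𝕂 B × Fld 𝕂 A)}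

theorem sum_pair_mem {v : ι → ι → Fld 𝕂 B × Fld 𝕂 A} (hv : ∀ i j, v i j ∈ S) (k : ι → ι → 𝕂) :
    (∑ i, ∑ j, k i j • (v i j).1, ∑ i, ∑ j, k i j • (v i j).2) ∈ S := by
  have h : ∑ i, ∑ j, k i j • v i j ∈ S :=
    sum_mem fun i _ => sum_mem fun j _ => Submodule.smul_mem _ _ (hv i j)
  convert! h using 1
  ext1
  · simp only [Prod.fst_sum, Prod.smul_fst]
  · simp only [Prod.snd_sum, Prod.smul_snd]

theorem pair_mem_of_eq_neg_sum {v : ι → ι → Fld 𝕂 B × Fld 𝕂 A} (hv : ∀ i j, v i j ∈ S)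
    (k : ι → ι → 𝕂) {a : Fld 𝕂 B} {b : Fld 𝕂 A} (ha : a = -∑ i, ∑ j, k i j • (v i j).1)
    (hb : b = -∑ i, ∑ j, k i j • (v i j).2) : (a, b) ∈ S :=
  ha ▸ hb ▸ S.neg_mem (sum_pair_mem hv k)

theorem pair_mem_of_eq_sub_sum {u : Fld 𝕂 B × Fld 𝕂 A} (hu : u ∈ S)
    {v : ι → ι → Fld 𝕂 B × Fld 𝕂 A} (hv : ∀ i j, v i j ∈ S)
    (r : 𝕂) (k : ι → ι → 𝕂) {a : Fld 𝕂 B} {b : Fld 𝕂 A}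
    (ha : a = u.1 - r • ∑ i, ∑ j, k i j • (v i j).1)
    (hb : b = u.2 - r • ∑ i, ∑ j, k i j • (v i j).2) : (a, b) ∈ S :=
  ha ▸ hb ▸ S.sub_mem hu (S.smul_mem r (sum_pair_mem hv k))

end Pairs

section VertexModule

variable {𝕂 : Type*} [Field 𝕂] {A : Type*} [AddCommGroup A] [Module 𝕂 A]
  {F : Type*} [AddCommGroup F] [Module 𝕂 F] {grF : Grade → Submodule 𝕂 F}
  {grA : Grade → Submodule 𝕂 A} {V : Submodule 𝕂 (Fld 𝕂 F)} {hV : IsFieldAlgebra grF V}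
  {Y : V →ₗ[𝕂] Fld 𝕂 A}

/-- Fields with supercommuting modes act by fields with supercommuting modes. -/
theorem IsVertexModule.sComm (hY : IsVertexModule grF hV grA Y) {i j : ZMod 2} {a b : V}
    (hi : HasParity grF a.1 i) (hj : HasParity grF b.1 j) (h : SComm i j a.1 b.1) :
    SComm i j (Y a) (Y b) := by
  intro m k
  refine LinearMap.ext fun v => ?_
  have hb := hY.borcherds i j a b hi hj m 0 k v
  have h0 : ∀ l : ℕ, Y ⟨nProd i j (0 + l) a.1 b.1,
      hV.nProd_mem i j (0 + l) a.1 b.1 a.2 b.2 hi hj⟩ = 0 := fun l => by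
    have : (⟨nProd i j (0 + l) a.1 b.1, hV.nProd_mem i j (0 + l) a.1 b.1 a.2 b.2 hi hj⟩ : V) = 0 :=
      Subtype.ext (h.nProd_of_nonneg (by omega))
    rw [this, map_zero]
  simp only [h0, Fld.coeff_zero, LinearMap.zero_apply, smul_zero, finsum_zero] at hb
  rw [finsum_eq_single _ 0] at hb
  · simp only [Nat.cast_zero, add_zero, sub_zero, pow_zero, Ring.choose_zero_right,
      one_smul, Int.negOnePow_zero, Units.val_one, mul_one, zero_add] at hb
    exact sub_eq_zero.mp hb.symm
  · intro l hl
    obtain ⟨l, rfl⟩ := Nat.exists_eq_succ_of_ne_zero hl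
    rw [Ring.choose_zero_succ, mul_zero, zero_smul]

theorem IsVertexModule.map_quadratic (hY : IsVertexModule grF hV grA Y) {ι : Type*} [Fintype ι]
    {y g : V} {c : ι → V} (hc : ∀ i, HasParity grF (c i).1 1) (r : 𝕂) (k : ι → ι → 𝕂)
    (h : y.1 = g.1 - r • ∑ i, ∑ j, k i j • nProd 1 1 (-1) (c i).1 (c j).1) :
    Y y = Y g - r • ∑ i, ∑ j, k i j • nProd 1 1 (-1) (Y (c i)) (Y (c j)) := by
  have hy : y = g - r • ∑ i, ∑ j, k i j • (⟨nProd 1 1 (-1) (c i).1 (c j).1,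
      hV.nProd_mem 1 1 (-1) _ _ (c i).2 (c j).2 (hc i) (hc j)⟩ : V) := by
    refine Subtype.ext (h.trans ?_)
    simp
  have hsub : ∀ a b : V, Y (a - b) = Y a - Y b := fun a b => Y.map_sub a b
  rw [hy, hsub, LinearMap.map_smul]
  simp only [map_sum, LinearMap.map_smul]
  refine congrArg (fun x => Y g - r • x) (Finset.sum_congr rfl fun i _ =>
    Finset.sum_congr rfl fun j _ => congrArg (k i j • ·) (hY.map_nProd (-1) _ _ (hc i) (hc j)))

end VertexModule

section Uniqueness

variable {𝕂 : Type*} [Field 𝕂] {𝔤 : Type*} [LieRing 𝔤] [LieAlgebra 𝕂 𝔤]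
  {ι : Type*} [Fintype ι] {A : Type*} [AddCommGroup A] [Module 𝕂 A] {M : DiffSgtModule 𝕂 𝔤 A}

/-- An action of `⟨c, γ⟩` in which the `c^{ξ_k^*}` act as under `Y₀` restricts to `Y₀`. -/
theorem comp_inclusion_eq (e : Module.Basis ι 𝕂 𝔤) {Y₀ : cAlg 𝕂 𝔤 →ₗ[𝕂] Fld 𝕂 A} {Y : cgAlg 𝕂 𝔤 →ₗ[𝕂] Fld 𝕂 A}
    (hY₀ : IsVertexModule (weilGr 𝕂 𝔤) (cAlg_isFieldAlgebra 𝕂 𝔤) M.gr Y₀)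
    (hY : IsVertexModule (weilGr 𝕂 𝔤) (cgAlg_isFieldAlgebra 𝕂 𝔤) M.gr Y)
    (h : ∀ φ, Y (cgAlg.c 𝕂 φ) = ∑ j, φ (e j) • Y₀ (cAlg.c 𝕂 (e.coord j))) :
    Y ∘ₗ Submodule.inclusion (cAlg_le_cgAlg 𝕂 𝔤) = Y₀ := by
  have hinc : IsVertexModule (weilGr 𝕂 𝔤) (cAlg_isFieldAlgebra 𝕂 𝔤) M.gr
      (Y ∘ₗ Submodule.inclusion (cAlg_le_cgAlg 𝕂 𝔤)) :=
    { map_vac := hY.map_vac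
      graded := fun x => hY.graded (Submodule.inclusion (cAlg_le_cgAlg 𝕂 𝔤) x)
      borcherds := fun i j a b => hY.borcherds i j (Submodule.inclusion _ a)
        (Submodule.inclusion _ b) }
  refine hinc.ext_of_generators hY₀ ?_
  rintro _ ⟨φ, rfl⟩
  have h2 : cAlg.c 𝕂 φ = ∑ j, φ (e j) • cAlg.c 𝕂 (e.coord j) := by
    refine Subtype.ext ((modeField_sum e 1 φ).trans ?_)
    rw [AddSubmonoidClass.coe_finsetSum]
    rfl
  refine (h φ).trans (Eq.trans ?_ (congrArg Y₀ h2).symm)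
  rw [map_sum]
  simp only [LinearMap.map_smul]

variable [DecidableEq ι] {e : Module.Basis ι 𝕂 𝔤}

/-- The compatibility with the differentials determines the action of `γ^φ`. -/
theorem DiffCompatible.adField_c {Y : cgAlg 𝕂 𝔤 →ₗ[𝕂] Fld 𝕂 A}
    (hY : IsVertexModule (weilGr 𝕂 𝔤) (cgAlg_isFieldAlgebra 𝕂 𝔤) M.gr Y)
    (hd : DiffCompatible e M Y) (φ : Module.Dual 𝕂 𝔤) :
    adField M.d 1 1 (Y (cgAlg.c 𝕂 φ)) = Y (cgAlg.gamma 𝕂 φ) -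
      (1 / 2 : 𝕂) • ∑ i, ∑ j, φ ⁅e i, e j⁆ •
        nProd 1 1 (-1) (Y (cgAlg.c 𝕂 (e.coord i))) (Y (cgAlg.c 𝕂 (e.coord j))) := by
  obtain ⟨y, hy, h⟩ := hd 1 (cgAlg.c 𝕂 φ) (hasGrade_cField φ).hasParity
  have h1 : adField M.d 1 1 (Y (cgAlg.c 𝕂 φ)) = Y y :=
    Fld.ext fun n v => LinearMap.congr_fun (h n) v
  rw [weilDiff_eq_adField] at hy
  exact h1.trans (hY.map_quadratic (c := fun i => cgAlg.c 𝕂 (e.coord i))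
    (fun i => (hasGrade_cField _).hasParity) _ _ (hy.trans (adField_weilD_cField e φ)))

theorem diffCompatible_unique {Y Y' : cgAlg 𝕂 𝔤 →ₗ[𝕂] Fld 𝕂 A}
    (hY : IsVertexModule (weilGr 𝕂 𝔤) (cgAlg_isFieldAlgebra 𝕂 𝔤) M.gr Y)
    (hY' : IsVertexModule (weilGr 𝕂 𝔤) (cgAlg_isFieldAlgebra 𝕂 𝔤) M.gr Y')
    (hd : DiffCompatible e M Y) (hd' : DiffCompatible e M Y')
    (h : ∀ φ, Y (cgAlg.c 𝕂 φ) = Y' (cgAlg.c 𝕂 φ)) : Y = Y' := by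
  refine hY.ext_of_generators hY' ?_
  rintro _ (⟨φ, rfl⟩ | ⟨φ, rfl⟩)
  · exact h φ
  · have h1 := hd.adField_c hY φ
    have h2 := hd'.adField_c hY' φ
    simp only [h] at h1
    exact sub_left_injective (h1.symm.trans h2)

end Uniqueness

section Existence

variable {𝕂 : Type*} [Field 𝕂] [CharZero 𝕂]

theorem wordPairs_nProd_gens {V : Type*} [AddCommGroup V] [Module 𝕂 V] {ι : Type*} [Fintype ι]
    (e : Module.Basis ι 𝕂 V) {A : Type*} [AddCommGroup A] [Module 𝕂 A] {Y : ZMod 2 × ι → Fld 𝕂 A}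
    (hY : SCommFamily Prod.fst Y) (i j : ZMod 2) (k l : ι) :
    (nProd i j (-1) (gens e (i, k)) (gens e (j, l)), nProd i j (-1) (Y (i, k)) (Y (j, l))) ∈
      wordPairs Prod.fst (gens e) Y (i + j) := by
  have h1 := wordPairs_gen (sCommFamily_gens e) hY (i, k)
  have h2 := wordPairs_gen (sCommFamily_gens e) hY (j, l)
  have h := wordPairs_nProd (sCommFamily_gens e) hY (-1) h1 h2
  exact h

variable {𝔤 : Type*} [LieRing 𝔤] [LieAlgebra 𝕂 𝔤]
  {ι : Type*} [Fintype ι] [DecidableEq ι] {A : Type*} [AddCommGroup A] [Module 𝕂 A]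
  (e : Module.Basis ι 𝕂 𝔤) {c : ι → Fld 𝕂 A} {d : Module.End 𝕂 A}

/-- The differentials on the generators of `⟨c, γ⟩` and on the fields by which they act are given
by the same polynomials. -/
theorem differential_mem_wordPairs (hd : d * d = 0) (hcc : ∀ i j, SComm 1 1 (c i) (c j))
    (hcd : ∀ i j, SComm 1 0 (c i) (adField d 1 1 (c j))) (x : ZMod 2 × ι) :
    (adField ((weilD e).coeff 0) 1 x.1 (gens e x), adField d 1 x.1 (liftGens e d c x)) ∈
      wordPairs Prod.fst (gens e) (liftGens e d c) (1 + x.1) := by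
  have hfam := sCommFamily_liftGens e hd hcc hcd
  have two : ∀ i : ZMod 2, i = 0 ∨ i = 1 := by decide
  obtain ⟨i, k⟩ := x
  rcases two i with rfl | rfl
  · refine pair_mem_of_eq_neg_sum (v := fun i j => (_, _))
      (fun i j => wordPairs_nProd_gens e hfam 0 1 j i) _ ?_ (adField_liftGens_zero e hd hcc hcd k)
    exact adField_weilD_gammaField e (e.coord k)
  · have h := wordPairs_gen (sCommFamily_gens e) hfam (0, k)
    refine pair_mem_of_eq_sub_sum (v := fun i j => (_, _)) h
      (fun i j => wordPairs_nProd_gens e hfam 1 1 i j) (1 / 2)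
      (fun i j => e.coord k ⁅e i, e j⁆) ?_ ?_
    · exact adField_weilD_cField e (e.coord k)
    · simp only [liftGens_one]
      exact adField_eq_liftGens e d c k

variable {M : DiffSgtModule 𝕂 𝔤 A}

/-- The existence of the action of `⟨c, γ⟩`. -/
theorem exists_diffCompatible {Y₀ : cAlg 𝕂 𝔤 →ₗ[𝕂] Fld 𝕂 A}
    (hY₀ : IsVertexModule (weilGr 𝕂 𝔤) (cAlg_isFieldAlgebra 𝕂 𝔤) M.gr Y₀)
    (hcdc : ∀ φ ψ, SComm 1 0 (Y₀ (cAlg.c 𝕂 φ)) (adField M.d 1 1 (Y₀ (cAlg.c 𝕂 ψ)))) :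
    ∃ Y : cgAlg 𝕂 𝔤 →ₗ[𝕂] Fld 𝕂 A,
      IsVertexModule (weilGr 𝕂 𝔤) (cgAlg_isFieldAlgebra 𝕂 𝔤) M.gr Y ∧
      Y ∘ₗ Submodule.inclusion (cAlg_le_cgAlg 𝕂 𝔤) = Y₀ ∧ DiffCompatible e M Y := by
  obtain ⟨c, hc⟩ : ∃ c : ι → Fld 𝕂 A, ∀ k, c k = Y₀ (cAlg.c 𝕂 (e.coord k)) := ⟨_, fun _ => rfl⟩
  have hcc : ∀ i j, SComm 1 1 (c i) (c j) := by
    intro i j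
    rw [hc, hc]
    exact hY₀.sComm (hasGrade_cField _).hasParity (hasGrade_cField _).hasParity
      (sComm_modeField 1 1 _ _)
  have hcd : ∀ i j, SComm 1 0 (c i) (adField M.d 1 1 (c j)) := by
    intro i j
    rw [hc, hc]
    exact hcdc _ _
  have hcgr : ∀ k, HasGrade M.gr (c k) 1 1 0 := by
    intro k
    rw [hc]
    exact hY₀.graded (cAlg.c 𝕂 (e.coord k)) 1 1 0 (hasGrade_cField _)
  have hfam := sCommFamily_liftGens e M.d_sq hcc hcd
  obtain ⟨Y, hYgraph⟩ := exists_action e hfam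
  have hY := action_isVertexModule hfam (hasGrade_liftGens e M.d_mem hcgr) hYgraph
  refine ⟨Y, hY, comp_inclusion_eq e hY₀ hY fun φ => ?_, fun i x hx => ?_⟩
  · refine (actionGraph_unique hfam (hYgraph _) (mem_actionGraph_modeField hfam 1 φ)).trans ?_
    simp only [liftGens_one, hc]
  · obtain ⟨y, hy, h⟩ := action_adField hfam hYgraph
      (differential_mem_wordPairs e M.d_sq hcc hcd) hx
    refine ⟨y, by rw [hy, weilDiff_eq_adField], fun n => ?_⟩
    rw [h]
    rfl

end Existence

/-! ### The commutators with the Lie superalgebra -/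

section Lie

/-- The Jacobi identity for three odd elements, if the bracket of the last two commutes with the
first. -/
theorem sbracket_sbracket {R : Type*} [Ring R] {d i x : R}
    (h : d * sbracket 1 1 i x = sbracket 1 1 i x * d) :
    sbracket 0 1 (sbracket 1 1 d i) x = sbracket 1 0 i (sbracket 1 1 d x) := by
  rw [← sub_eq_zero, ← sub_eq_zero.mpr h]
  simp only [sbracket, koszul_one_one, koszul_zero_left, koszul_zero_right]
  noncomm_ring

variable {𝕂 : Type*} [Field 𝕂] [CharZero 𝕂] {𝔤 : Type*} [LieRing 𝔤] [LieAlgebra 𝕂 𝔤]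
  {ι : Type*} [Fintype ι] {A : Type*} [AddCommGroup A] [Module 𝕂 A]

theorem adField_quadratic (e : Module.Basis ι 𝕂 𝔤) (ξ : 𝔤) (φ : Module.Dual 𝕂 𝔤) (n : ℤ)
    {c : ι → Fld 𝕂 A} {d : Module.End 𝕂 A}
    (hd : ∀ i, adField d 1 1 (c i) = e.coord i ξ • (Fld.vac 𝕂 A).shift n) :
    adField d 1 0 ((1 / 2 : 𝕂) • ∑ i, ∑ j, φ ⁅e i, e j⁆ • nProd 1 1 (-1) (c i) (c j)) =
      ∑ j, φ ⁅ξ, e j⁆ • (c j).shift n := by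
  have h : ∀ i j, adField d 1 0 (nProd 1 1 (-1) (c i) (c j)) =
      e.coord i ξ • (c j).shift n - e.coord j ξ • (c i).shift n := by
    intro i j
    have := adField_nProd d 1 1 1 (-1) (c i) (c j)
    rw [hd, hd, koszul_one_one, neg_smul, one_smul, ← sub_eq_add_neg, nProd_smul_left,
      nProd_smul_right] at this
    rw [← nProd_shift_vac_left 1 n (c j), ← nProd_shift_vac_right 1 n (c i)]
    exact this
  have hsum : ∀ j, ∑ i, φ ⁅e i, e j⁆ * e.coord i ξ = φ ⁅ξ, e j⁆ := by
    intro j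
    conv_rhs => rw [← e.sum_repr ξ]
    rw [sum_lie, map_sum]
    refine Finset.sum_congr rfl fun i _ => ?_
    rw [smul_lie, LinearMap.map_smul, smul_eq_mul, mul_comm]
    rfl
  rw [LinearMap.map_smul]
  simp only [map_sum, LinearMap.map_smul, h]
  rw [half_sum_sub_swap e φ fun i j => e.coord i ξ • (c j).shift n, Finset.sum_comm]
  refine Finset.sum_congr rfl fun j _ => ?_
  simp only [smul_smul]
  rw [← Finset.sum_smul, hsum]

variable [DecidableEq ι] {e : Module.Basis ι 𝕂 𝔤} {M : DiffSgtModule 𝕂 𝔤 A}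

/-- The commutators of the `L_{ξ,(m)}` with `c^φ` follow from those of the `ι_{ξ,(m)}` with `c` and
`γ`: as `L = [d, ι]` and `[ι, c^φ]` is a scalar, `[L, c^φ] = [ι, [d, c^φ]]`. -/
theorem lCRelation {Y : cgAlg 𝕂 𝔤 →ₗ[𝕂] Fld 𝕂 A}
    (hY : IsVertexModule (weilGr 𝕂 𝔤) (cgAlg_isFieldAlgebra 𝕂 𝔤) M.gr Y)
    (hd : DiffCompatible e M Y) (hc : IotaCRelation M Y) (hγ : IotaGammaRelation M Y) :
    LCRelation M Y := by
  intro ξ φ m n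
  have hac : ∀ ψ, adField (M.iota m ξ) 1 1 (Y (cgAlg.c 𝕂 ψ)) = ψ ξ • (Fld.vac 𝕂 A).shift m := by
    intro ψ
    refine Fld.ext fun k v => ?_
    rw [adField_coeff, hc ξ ψ m k, Fld.coeff_smul, Fld.shift_coeff, Fld.coeff_vac, add_comm (m : ℤ)]
    split_ifs <;> simp
  have hLd : sbracket 0 1 (M.L m ξ) ((Y (cgAlg.c 𝕂 φ)).coeff n) =
      (adField (M.iota m ξ) 1 0 (adField M.d 1 1 (Y (cgAlg.c 𝕂 φ)))).coeff n := by
    rw [← M.d_iota, adField_coeff, adField_coeff]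
    refine sbracket_sbracket ?_
    rw [hc ξ φ m n]
    split_ifs <;> simp
  have hγ' : adField (M.iota m ξ) 1 0 (Y (cgAlg.gamma 𝕂 φ)) = 0 :=
    Fld.ext fun k v => LinearMap.congr_fun (hγ ξ φ m k) v
  have hcoad : Y (cgAlg.c 𝕂 (coad ξ φ)) = ∑ j, coad ξ φ (e j) • Y (cgAlg.c 𝕂 (e.coord j)) := by
    have : cgAlg.c 𝕂 (coad ξ φ) = ∑ j, coad ξ φ (e j) • cgAlg.c 𝕂 (e.coord j) := by
      refine Subtype.ext ((modeField_sum e 1 (coad ξ φ)).trans ?_)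
      rw [AddSubmonoidClass.coe_finsetSum]
      rfl
    rw [this, map_sum]
    simp only [LinearMap.map_smul]
  have hsub : ∀ a b, adField (M.iota m ξ) 1 0 (a - b) =
    adField (M.iota m ξ) 1 0 a - adField (M.iota m ξ) 1 0 b := fun a b => LinearMap.map_sub _ a b
  rw [hLd, hd.adField_c hY, hsub, hγ', zero_sub,
    adField_quadratic e ξ φ m fun i => hac (e.coord i), hcoad, Fld.coeff_neg, Fld.coeff_sum,
    Fld.coeff_sum, ← Finset.sum_neg_distrib]
  refine Finset.sum_congr rfl fun j _ => ?_
  rw [Fld.coeff_smul, Fld.coeff_smul, Fld.shift_coeff, add_comm n, ← neg_smul]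
  rfl

end Lie

end ChiralWeil

end

open ChiralWeil in
theorem mainTheorem4 {𝕂 : Type*} [RCLike 𝕂] {𝔤 : Type*} [LieRing 𝔤] [LieAlgebra 𝕂 𝔤]
    {ι : Type*} [Fintype ι] [DecidableEq ι] (e : Module.Basis ι 𝕂 𝔤)
    {A : Type*} [AddCommGroup A] [Module 𝕂 A] (M : DiffSgtModule 𝕂 𝔤 A)
    (Y₀ : cAlg 𝕂 𝔤 →ₗ[𝕂] Fld 𝕂 A)
    (hY₀ : IsVertexModule (weilGr 𝕂 𝔤) (cAlg_isFieldAlgebra 𝕂 𝔤) M.gr Y₀)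
    (hcdc : ∀ (φ ψ : Module.Dual 𝕂 𝔤) (m n : ℤ),
      sbracket 1 0 ((Y₀ (cAlg.c 𝕂 φ)).coeff m)
        (sbracket 1 1 M.d ((Y₀ (cAlg.c 𝕂 ψ)).coeff n)) = 0) :
    (∃! Y : cgAlg 𝕂 𝔤 →ₗ[𝕂] Fld 𝕂 A,
      IsVertexModule (weilGr 𝕂 𝔤) (cgAlg_isFieldAlgebra 𝕂 𝔤) M.gr Y ∧
      Y ∘ₗ Submodule.inclusion (cAlg_le_cgAlg 𝕂 𝔤) = Y₀ ∧
      DiffCompatible e M Y) ∧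
    ∀ Y : cgAlg 𝕂 𝔤 →ₗ[𝕂] Fld 𝕂 A,
      IsVertexModule (weilGr 𝕂 𝔤) (cgAlg_isFieldAlgebra 𝕂 𝔤) M.gr Y →
      Y ∘ₗ Submodule.inclusion (cAlg_le_cgAlg 𝕂 𝔤) = Y₀ →
      DiffCompatible e M Y →
      IotaCRelation M Y →
      IotaGammaRelation M Y →
      IsChiralWStarModule e M Y := by
  refine ⟨?_, fun Y hY _ hd hc hγ => ⟨hY, hd, lCRelation hY hd hc hγ, hc⟩⟩
  obtain ⟨Y, hY, hYc, hd⟩ := exists_diffCompatible e hY₀ fun φ ψ =>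
    sComm_iff_sbracket.mpr fun m n => hcdc φ ψ m n
  refine ⟨Y, ⟨hY, hYc, hd⟩, ?_⟩
  rintro Y' ⟨hY', hYc', hd'⟩
  exact diffCompatible_unique hY' hY hd' hd fun φ =>
    LinearMap.congr_fun (hYc'.trans hYc.symm) (cAlg.c 𝕂 φ)
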